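/- **Setting.** Let $p>0$ and $q$ be relatively prime odd integers with $|q|<p$, and let $K=K(p,q)$ be the corresponding 2-bridge knot. Put $d=(p-1)/2$, and for $1\le n\le d$ let $k_n\equiv nq \pmod{2p}$ with $-p<k_n<p$, $e_n=\operatorname{sign}(k_n)$. Let $v=b^{e_1}a^{e_2}b^{e_3}\cdots$ ($d$ letters), let $\bar v$ be $v$ written backwards with $a$ and $b$ switched, $w=v\bar v$, let $\tilde w$ be $w$ written backwards, and $\sigma=4\sum_{n=1}^d e_n$. The knot group is $\pi=\langle a,b\mid aw=wb\rangle$, with meridian $a$ and longitude $l=w\tilde w a^{-\sigma}$. The $SL_2$-character ring of $K$ is $\mathcal O_{char}(\pi)=\mathcal O(\mathrm{Rep}(\pi,SL_2))^{SL_2(\mathbb C)}$, the ring of conjugation-invariant functions on the representation scheme. The Brumfiel–Hilden algebra is $H[\pi]=\mathbb C[\pi]/\langle [g,h+h^{-1}] : g,h\in\pi\rangle$, with the $\mathbb C$-linear anti-involution $*$ such that $g^*=g^{-1}$ for $g\in\pi$; put $H^+=\{u\in H[\pi] : u^*=u\}$, a central subalgebra. Let $X,Y\in H[\pi]$ be the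 images of $a$ and $l$, let $H^+[X^{\pm1}]$ be the (commutative) subalgebra generated by $H^+$ and $X^{\pm1}$, and $\delta=X-X^{-1}$. The restriction $s$ of $*$ to $H^+[X^{\pm1}]$ is an involution with $s(\delta)=-\delta$; it extends to the localization $H^+[X^{\pm1}][\delta^{-1}]$. Define $x,i,j\in H[\pi]$ by $a^{\pm1}=x\pm(i+j)/2$, $b^{\pm1}=x\mp(i-j)/2$, and put $I=i^2$, $J=j^2$; then $x,I,J\in H^+$. Let $Q\in H^+$ be $Q=L-JN$, where $w=L+Mj+Nk$ is the expansion of the word $w$, with the letters $a^{\pm1},b^{\pm1}$ replaced by the above expressions, in the generalized quaternion algebra over $H^+$ with basis $1,i,j,k$ and $i^2=I$, $j^2=J$, $ij=-ji=k$. Let $$M=H^+[X^{\pm1}]+H^+[X^{\pm1}]\,Q\delta^{-1}\subset H^+[X^{\pm1}][\delta^{-1}].$$ For $q_0,t_1,\dots,t_4\in\mathbb C^*$ the double affine Hecke algebra $\mathsf H_{q_0,t_1,t_2,t_3,t_4}$ is generated by $T_0,T_0^\vee,T_1,T_1^\vee$ with relations $(T_0-t_1)(T_0+t_1^{-1})=(T_0^\vee-t_2)(T_0^\vee+t_2^{-1})=(T_1-t_3)(T_1+t_3^{-1})=(T_1^\vee-t_4)(T_1^\vee+t_4^{-1})=0$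 and $T_1^\vee T_1T_0T_0^\vee=q_0$. Put $\mathsf H_{-1,t_1,t_2}=\mathsf H_{-1,t_1,t_2,1,1}$, $e=(1+T_1)/2$ (an idempotent), and $\mathrm S\mathsf H_{-1,t_1,t_2}=e\,\mathsf H_{-1,t_1,t_2}\,e$, an algebra with unit $e$. **Statement.** For every 2-bridge knot $K(p,q)$ and all $t_1,t_2\in\mathbb C^*$: 1. $H^+$ embeds in $H^+[X^{\pm1}][\delta^{-1}]$, and the universal representation induces an algebra isomorphism $\Phi:H^+\to\mathcal O_{char}(\pi)$ (an element $u\in H^+$ is sent to the scalar matrix $\Phi(u)\cdot\mathrm{Id}$ over $\mathcal O(\mathrm{Rep}(\pi,SL_2))$). 2. $Y\in H^+[X^{\pm1}]$, and the operators (with $\bar t_i=t_i-t_i^{-1}$, where $X$ and $Y$ act by multiplication) $$T_0=-t_1sY+(\bar t_1X+\bar t_2)\delta^{-1}(1+sY),\qquad T_0^\vee=T_0^{-1}X,\qquad T_1=s,\qquad T_1^\vee=-X^{-1}s$$ define an action of $\mathsf H_{-1,t_1,t_2}$ on $M$. 3. $eM=H^+$. Hence $\mathrm S\mathsf H_{-1,t_1,t_2}$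 acts on $eM=H^+$, and the character ring $\mathcal O_{char}(\pi)$ carries the action of the spherical subalgebra $\mathrm S\mathsf H_{-1,t_1,t_2}$ obtained from it by transport along $\Phi$. -/

import Mathlib

open scoped Quaternion

noncomputable section

namespace TwoBridge

/-! ### The double affine Hecke algebra of type `(C^∨, C_1)` and its spherical subalgebra -/

/-- Names of the four generators of the double affine Hecke algebra. -/
inductive DAHAGen : Type
  | T0 | T0v | T1 | T1v

open DAHAGen in
/-- Defining relations of `H_{q, t₁, t₂, t₃, t₄}`. -/
inductive DAHARel (q t₁ t₂ t₃ t₄ : ℂˣ) :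
    FreeAlgebra ℂ DAHAGen → FreeAlgebra ℂ DAHAGen → Prop
  | T0 : DAHARel q t₁ t₂ t₃ t₄
      ((FreeAlgebra.ι ℂ T0 - algebraMap ℂ _ (t₁ : ℂ)) *
        (FreeAlgebra.ι ℂ T0 + algebraMap ℂ _ (t₁ : ℂ)⁻¹)) 0
  | T0v : DAHARel q t₁ t₂ t₃ t₄
      ((FreeAlgebra.ι ℂ T0v - algebraMap ℂ _ (t₂ : ℂ)) *
        (FreeAlgebra.ι ℂ T0v + algebraMap ℂ _ (t₂ : ℂ)⁻¹)) 0
  | T1 : DAHARel q t₁ t₂ t₃ t₄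
      ((FreeAlgebra.ι ℂ T1 - algebraMap ℂ _ (t₃ : ℂ)) *
        (FreeAlgebra.ι ℂ T1 + algebraMap ℂ _ (t₃ : ℂ)⁻¹)) 0
  | T1v : DAHARel q t₁ t₂ t₃ t₄
      ((FreeAlgebra.ι ℂ T1v - algebraMap ℂ _ (t₄ : ℂ)) *
        (FreeAlgebra.ι ℂ T1v + algebraMap ℂ _ (t₄ : ℂ)⁻¹)) 0
  | prod : DAHARel q t₁ t₂ t₃ t₄
      (FreeAlgebra.ι ℂ T1v * FreeAlgebra.ι ℂ T1 * FreeAlgebra.ι ℂ T0 * FreeAlgebra.ι ℂ T0v)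
      (algebraMap ℂ _ (q : ℂ))

/-- The five-parameter double affine Hecke algebra `H_{q, t₁, t₂, t₃, t₄}`. -/
def DAHA (q t₁ t₂ t₃ t₄ : ℂˣ) : Type := RingQuot (DAHARel q t₁ t₂ t₃ t₄)

instance (q t₁ t₂ t₃ t₄ : ℂˣ) : Ring (DAHA q t₁ t₂ t₃ t₄) :=
  inferInstanceAs (Ring (RingQuot (DAHARel q t₁ t₂ t₃ t₄)))

instance (q t₁ t₂ t₃ t₄ : ℂˣ) : Algebra ℂ (DAHA q t₁ t₂ t₃ t₄) :=
  inferInstanceAs (Algebra ℂ (RingQuot (DAHARel q t₁ t₂ t₃ t₄)))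

/-- The canonical projection from the free algebra. -/
def DAHA.mk (q t₁ t₂ t₃ t₄ : ℂˣ) : FreeAlgebra ℂ DAHAGen →ₐ[ℂ] DAHA q t₁ t₂ t₃ t₄ :=
  RingQuot.mkAlgHom ℂ (DAHARel q t₁ t₂ t₃ t₄)

/-- The generators of the double affine Hecke algebra. -/
def DAHA.gen (q t₁ t₂ t₃ t₄ : ℂˣ) (g : DAHAGen) : DAHA q t₁ t₂ t₃ t₄ :=
  DAHA.mk q t₁ t₂ t₃ t₄ (FreeAlgebra.ι ℂ g)

/-- The element `e = (T₁ + t₃⁻¹) / (t₃ + t₃⁻¹)`. -/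
def DAHA.e (q t₁ t₂ t₃ t₄ : ℂˣ) : DAHA q t₁ t₂ t₃ t₄ :=
  ((t₃ : ℂ) + (t₃ : ℂ)⁻¹)⁻¹ •
    (DAHA.gen q t₁ t₂ t₃ t₄ DAHAGen.T1 + algebraMap ℂ _ (t₃ : ℂ)⁻¹)

theorem DAHA.isIdempotentElem_e (q t₁ t₂ t₃ t₄ : ℂˣ) (h : (t₃ : ℂ) + (t₃ : ℂ)⁻¹ ≠ 0) :
    IsIdempotentElem (DAHA.e q t₁ t₂ t₃ t₄) := by
  have hr : DAHA.mk q t₁ t₂ t₃ t₄ _ = DAHA.mk q t₁ t₂ t₃ t₄ _ :=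
    RingQuot.mkAlgHom_rel ℂ DAHARel.T1
  simp only [map_mul, map_sub, map_add, map_zero, AlgHom.commutes] at hr
  change (DAHA.gen q t₁ t₂ t₃ t₄ DAHAGen.T1 - _) * (DAHA.gen q t₁ t₂ t₃ t₄ DAHAGen.T1 + _) = 0
    at hr
  unfold IsIdempotentElem DAHA.e
  set T := DAHA.gen q t₁ t₂ t₃ t₄ DAHAGen.T1
  have key : (T + algebraMap ℂ _ (t₃ : ℂ)⁻¹) * (T + algebraMap ℂ _ (t₃ : ℂ)⁻¹)
      = ((t₃ : ℂ) + (t₃ : ℂ)⁻¹) • (T + algebraMap ℂ (DAHA q t₁ t₂ t₃ t₄) (t₃ : ℂ)⁻¹) := by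
    rw [Algebra.smul_def, map_add, ← sub_eq_zero]
    refine Eq.trans ?_ hr
    rw [← sub_mul]
    congr 1
    abel
  rw [smul_mul_smul_comm, key, smul_smul]
  congr 1
  field_simp

/-- `H_{-1, t₁, t₂} = H_{-1, t₁, t₂, 1, 1}`. -/
abbrev H (t₁ t₂ : ℂˣ) : Type := DAHA (-1) t₁ t₂ 1 1

/-- The idempotent `e = (1 + T₁) / 2` of `H_{-1, t₁, t₂}`. -/
abbrev H.e (t₁ t₂ : ℂˣ) : H t₁ t₂ := DAHA.e (-1) t₁ t₂ 1 1

theorem H.isIdempotentElem_e (t₁ t₂ : ℂˣ) : IsIdempotentElem (H.e t₁ t₂) :=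
  DAHA.isIdempotentElem_e _ _ _ _ _ (by norm_num)

/-- The spherical subalgebra `SH_{-1, t₁, t₂} = e H_{-1, t₁, t₂} e`, with unit element `e`. -/
abbrev SH (t₁ t₂ : ℂˣ) : Type := (H.isIdempotentElem_e t₁ t₂).Corner

/-! ### The `SL₂` representation scheme and the character ring of a group -/

section Rep

variable (π : Type) [Group π]

/-- The ideal of relations that say that `g ↦ (x_{g,i,j})` is a homomorphism to `SL₂`. -/
def repIdeal : Ideal (MvPolynomial (π × Fin 2 × Fin 2) ℂ) :=
  Ideal.span
    ({f | ∃ i j, f = MvPolynomial.X (1, i, j) - (1 : Matrix (Fin 2) (Fin 2) _) i j} ∪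
     {f | ∃ g h i j, f = MvPolynomial.X (g * h, i, j) -
        ∑ k, MvPolynomial.X (g, i, k) * MvPolynomial.X (h, k, j)} ∪
     {f | ∃ g, f = (Matrix.of fun i j => MvPolynomial.X (g, i, j)).det - 1})

/-- The coordinate ring `O(Rep(π, SL₂))` of the representation scheme. -/
abbrev RepRing : Type := MvPolynomial (π × Fin 2 × Fin 2) ℂ ⧸ repIdeal π

/-- The generic matrix of a group element. -/
def genMat (g : π) : Matrix (Fin 2) (Fin 2) (RepRing π) :=
  Matrix.of fun i j => Ideal.Quotient.mk (repIdeal π) (MvPolynomial.X (g, i, j))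

theorem genMat_one : genMat π 1 = 1 := by
  ext i j
  have : Ideal.Quotient.mk (repIdeal π)
      (MvPolynomial.X (1, i, j) - (1 : Matrix (Fin 2) (Fin 2) _) i j) = 0 :=
    Ideal.Quotient.eq_zero_iff_mem.2
      (Ideal.subset_span (Or.inl (Or.inl ⟨i, j, rfl⟩)))
  rw [map_sub, sub_eq_zero] at this
  simp only [genMat, Matrix.of_apply, this, Matrix.one_apply]
  split_ifs <;> simp

theorem genMat_mul (g h : π) : genMat π (g * h) = genMat π g * genMat π h := by
  ext i j
  have : Ideal.Quotient.mk (repIdeal π) (MvPolynomial.X (g * h, i, j) -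
        ∑ k, MvPolynomial.X (g, i, k) * MvPolynomial.X (h, k, j)) = 0 :=
    Ideal.Quotient.eq_zero_iff_mem.2
      (Ideal.subset_span (Or.inl (Or.inr ⟨g, h, i, j, rfl⟩)))
  rw [map_sub, sub_eq_zero] at this
  simp [genMat, Matrix.mul_apply, this]

theorem genMat_det (g : π) : (genMat π g).det = 1 := by
  have : Ideal.Quotient.mk (repIdeal π)
      ((Matrix.of fun i j => MvPolynomial.X (g, i, j)).det - 1) = 0 :=
    Ideal.Quotient.eq_zero_iff_mem.2 (Ideal.subset_span (Or.inr ⟨g, rfl⟩))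
  rw [map_sub, sub_eq_zero, RingHom.map_det, map_one] at this
  exact this

/-- The universal representation `π → SL₂(O(Rep(π, SL₂)))`. -/
def univRep : π →* Matrix.SpecialLinearGroup (Fin 2) (RepRing π) where
  toFun g := ⟨genMat π g, genMat_det π g⟩
  map_one' := Subtype.ext (genMat_one π)
  map_mul' g h := Subtype.ext (genMat_mul π g h)

variable {π}

/-- The algebra map `O(Rep(π, SL₂)) → B` that classifies a representation `π → SL₂(B)`. -/
def repLift {B : Type*} [CommRing B] [Algebra ℂ B]
    (ρ : π →* Matrix.SpecialLinearGroup (Fin 2) B) : RepRing π →ₐ[ℂ] B :=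
  Ideal.Quotient.liftₐ (repIdeal π)
    (MvPolynomial.aeval fun v : π × Fin 2 × Fin 2 => (ρ v.1 : Matrix (Fin 2) (Fin 2) B) v.2.1 v.2.2)
    (by
      have hle : repIdeal π ≤ RingHom.ker (MvPolynomial.aeval (R := ℂ)
          fun v : π × Fin 2 × Fin 2 =>
            (ρ v.1 : Matrix (Fin 2) (Fin 2) B) v.2.1 v.2.2) := by
        refine Ideal.span_le.2 ?_
        rintro f ((⟨i, j, rfl⟩ | ⟨g, h, i, j, rfl⟩) | ⟨g, rfl⟩)
        · simp only [SetLike.mem_coe, RingHom.mem_ker, map_sub, MvPolynomial.aeval_X, map_one,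
            Matrix.SpecialLinearGroup.coe_one, Matrix.one_apply, sub_eq_zero]
          split_ifs <;> simp
        · simp [RingHom.mem_ker, Matrix.mul_apply]
        · have h1 := (ρ g).2
          rw [Matrix.det_fin_two] at h1
          simp [RingHom.mem_ker, Matrix.det_fin_two, h1]
      intro a ha
      exact hle ha)

variable (π)

/-- The action of `g ∈ SL₂(ℂ)` on functions, `(g • f)(ρ) = f(g⁻¹ ρ g)`. -/
def conjAct (g : Matrix.SpecialLinearGroup (Fin 2) ℂ) : RepRing π →ₐ[ℂ] RepRing π :=
  repLift <| (MulAut.conj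
    ((Matrix.SpecialLinearGroup.map (algebraMap ℂ (RepRing π)) g)⁻¹)).toMonoidHom.comp (univRep π)

/-- The `SL₂` character ring `O(Rep(π, SL₂))^{SL₂}`. -/
def charRing : Subalgebra ℂ (RepRing π) where
  carrier := {f | ∀ g, conjAct π g f = f}
  mul_mem' ha hb g := by rw [map_mul, ha g, hb g]
  add_mem' ha hb g := by rw [map_add, ha g, hb g]
  algebraMap_mem' c g := AlgHom.commutes _ c

end Rep

/-! ### The Brumfiel–Hilden algebra of a group -/

section BH

variable (π : Type) [Group π]

/-- The relations `g (h + h⁻¹) = (h + h⁻¹) g` of the Brumfiel–Hilden algebra. -/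
inductive BHRel : MonoidAlgebra ℂ π → MonoidAlgebra ℂ π → Prop
  | comm (g h : π) : BHRel
      (MonoidAlgebra.of ℂ π g * (MonoidAlgebra.of ℂ π h + MonoidAlgebra.of ℂ π h⁻¹))
      ((MonoidAlgebra.of ℂ π h + MonoidAlgebra.of ℂ π h⁻¹) * MonoidAlgebra.of ℂ π g)

/-- The Brumfiel–Hilden algebra `ℂ[π] / ⟨[g, h + h⁻¹]⟩`. -/
def BH : Type := RingQuot (BHRel π)

instance : Ring (BH π) := inferInstanceAs (Ring (RingQuot (BHRel π)))

instance : Algebra ℂ (BH π) := inferInstanceAs (Algebra ℂ (RingQuot (BHRel π)))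

/-- The canonical projection `ℂ[π] → BH π`. -/
def BH.mk : MonoidAlgebra ℂ π →ₐ[ℂ] BH π := RingQuot.mkAlgHom ℂ (BHRel π)

/-- The image of a group element in the Brumfiel–Hilden algebra. -/
def BH.of : π →* BH π :=
  (BH.mk π : MonoidAlgebra ℂ π →* BH π).comp (MonoidAlgebra.of ℂ π)

variable {π}

theorem BH.of_comm (g h : π) :
    BH.of π g * (BH.of π h + BH.of π h⁻¹) = (BH.of π h + BH.of π h⁻¹) * BH.of π g := by
  have : BH.mk π _ = BH.mk π _ := RingQuot.mkAlgHom_rel ℂ (BHRel.comm g h)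
  rw [map_mul, map_mul, map_add] at this
  exact this

/-- A homomorphism from `π` to an algebra that kills all `[g, h + h⁻¹]` extends to `BH π`. -/
def BH.lift {A : Type*} [Ring A] [Algebra ℂ A] (f : π →* A)
    (hf : ∀ g h, f g * (f h + f h⁻¹) = (f h + f h⁻¹) * f g) : BH π →ₐ[ℂ] A :=
  RingQuot.liftAlgHom ℂ ⟨MonoidAlgebra.lift ℂ A π f, by
    rintro _ _ ⟨g, h⟩
    simpa only [map_mul, map_add, MonoidAlgebra.lift_of] using hf g h⟩

@[simp] theorem BH.lift_of {A : Type*} [Ring A] [Algebra ℂ A] (f : π →* A)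
    (hf : ∀ g h, f g * (f h + f h⁻¹) = (f h + f h⁻¹) * f g) (g : π) :
    BH.lift f hf (BH.of π g) = f g := by
  exact (RingQuot.liftAlgHom_mkAlgHom_apply ℂ _ _ _).trans (MonoidAlgebra.lift_of f g)

@[elab_as_elim]
theorem BH.induction {p : BH π → Prop} (of : ∀ g, p (BH.of π g))
    (add : ∀ a b, p a → p b → p (a + b)) (smul : ∀ (c : ℂ) a, p a → p (c • a)) (a : BH π) :
    p a := by
  obtain ⟨a, rfl⟩ : ∃ b, BH.mk π b = a := RingQuot.mkAlgHom_surjective ℂ (BHRel π) a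
  induction a using MonoidAlgebra.induction_on with
  | of g => exact of g
  | add a b ha hb => rw [map_add]; exact add _ _ ha hb
  | smul c a ha => rw [map_smul]; exact smul _ _ ha

variable (π)

/-- `g ↦ g⁻¹` as a homomorphism to the opposite algebra. -/
def BH.invHom : π →* (BH π)ᵐᵒᵖ where
  toFun g := MulOpposite.op (BH.of π g⁻¹)
  map_one' := by simp
  map_mul' g h := by simp

/-- The canonical anti-involution `a ↦ a*` of `BH π`, as an algebra map to the opposite. -/
def BH.starHom : BH π →ₐ[ℂ] (BH π)ᵐᵒᵖ :=
  BH.lift (BH.invHom π) (by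
    intro g h
    apply MulOpposite.unop_injective
    have := BH.of_comm g⁻¹ h
    simp only [BH.invHom, MonoidHom.coe_mk, OneHom.coe_mk, MulOpposite.unop_mul,
      MulOpposite.unop_add, MulOpposite.unop_op, inv_inv]
    rw [add_comm (BH.of π h⁻¹)]
    exact this.symm)

variable {π}

/-- The canonical `ℂ`-linear anti-involution of `BH π`, with `g* = g⁻¹` for `g ∈ π`. -/
def BH.inv (a : BH π) : BH π := (BH.starHom π a).unop

@[simp] theorem BH.inv_of (g : π) : BH.inv (BH.of π g) = BH.of π g⁻¹ := by
  simp [BH.inv, BH.starHom, BH.invHom]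

@[simp] theorem BH.inv_add (a b : BH π) : BH.inv (a + b) = BH.inv a + BH.inv b := by
  simp [BH.inv]

@[simp] theorem BH.inv_sub (a b : BH π) : BH.inv (a - b) = BH.inv a - BH.inv b := by
  simp [BH.inv]

@[simp] theorem BH.inv_smul (c : ℂ) (a : BH π) : BH.inv (c • a) = c • BH.inv a := by
  simp [BH.inv]

@[simp] theorem BH.inv_mul (a b : BH π) : BH.inv (a * b) = BH.inv b * BH.inv a := by
  simp [BH.inv]

@[simp] theorem BH.inv_algebraMap (c : ℂ) :
    BH.inv (algebraMap ℂ (BH π) c) = algebraMap ℂ (BH π) c := by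
  simp [BH.inv]

@[simp] theorem BH.inv_inv (a : BH π) : BH.inv (BH.inv a) = a := by
  induction a using BH.induction with
  | of g => simp
  | add a b ha hb => simp [ha, hb]
  | smul c a ha => simp [ha]

theorem BH.add_inv_comm (a b : BH π) : b * (a + BH.inv a) = (a + BH.inv a) * b := by
  induction a using BH.induction with
  | of h =>
    induction b using BH.induction with
    | of g => simpa using BH.of_comm g h
    | add a b ha hb => rw [add_mul, ha, hb, mul_add]
    | smul c a ha => rw [smul_mul_assoc, mul_smul_comm, ha]
  | add x y hx hy =>
    rw [BH.inv_add, add_add_add_comm, mul_add, add_mul, hx, hy]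
  | smul c a ha => rw [BH.inv_smul, ← smul_add, smul_mul_assoc, mul_smul_comm, ha]

theorem BH.comm_of_inv_eq {a : BH π} (ha : BH.inv a = a) (b : BH π) : b * a = a * b := by
  have h := BH.add_inv_comm ((2 : ℂ)⁻¹ • a) b
  rw [BH.inv_smul, ha, ← add_smul] at h
  norm_num at h
  exact h

variable (π)

/-- The (central) subalgebra `BH⁺ = {a | a* = a}`. -/
def BHplus : Subalgebra ℂ (BH π) where
  carrier := {a | BH.inv a = a}
  mul_mem' {a b} ha hb := by
    have ha' : BH.inv a = a := ha
    have hb' : BH.inv b = b := hb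
    change BH.inv (a * b) = a * b
    rw [BH.inv_mul, ha', hb', BH.comm_of_inv_eq ha']
  add_mem' {a b} ha hb := by
    have ha' : BH.inv a = a := ha
    have hb' : BH.inv b = b := hb
    change BH.inv (a + b) = a + b
    rw [BH.inv_add, ha', hb']
  algebraMap_mem' c := BH.inv_algebraMap c

instance : CommRing (BHplus π) :=
  { Subalgebra.toRing (BHplus π) with
    mul_comm := fun a b => Subtype.ext (BH.comm_of_inv_eq b.2 a.1) }

theorem genMat_add_inv (h : π) :
    genMat π h + genMat π h⁻¹ = Matrix.scalar (Fin 2) (genMat π h).trace := by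
  have h1 : genMat π h⁻¹ = (genMat π h).adjugate := by
    exact (congrArg Subtype.val (map_inv (univRep π) h)).trans
      (Matrix.SpecialLinearGroup.coe_inv _)
  rw [h1, Matrix.adjugate_fin_two]
  ext i j
  fin_cases i <;> fin_cases j <;> simp [Matrix.trace_fin_two, add_comm]

/-- The algebra map `BH π → M₂(O(Rep(π, SL₂)))` induced by the universal representation. -/
def BH.toMat : BH π →ₐ[ℂ] Matrix (Fin 2) (Fin 2) (RepRing π) :=
  BH.lift
    { toFun := genMat π
      map_one' := genMat_one π
      map_mul' := genMat_mul π }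
    (by
      intro g h
      simp only [MonoidHom.coe_mk, OneHom.coe_mk, genMat_add_inv]
      exact (Matrix.scalar_commute _ (fun _ => Commute.all _ _) _).symm.eq)

/-! ### The commutative algebra `BH⁺[X^{±1}]` and its localization at `δ = X - X⁻¹` -/

variable {π}
variable (m : π)

/-- `BH⁺[X^{±1}]`, the subalgebra of `BH π` generated by `BH⁺` and `X^{±1}`, where `X` is the
image of the group element `m`. -/
def BHX : Subalgebra ℂ (BH π) :=
  Algebra.adjoin ℂ ((BHplus π : Set (BH π)) ∪ {BH.of π m, BH.of π m⁻¹})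

theorem isMulCommutative_BHX : IsMulCommutative (BHX m) :=
  Algebra.isMulCommutative_adjoin ℂ (by
    have hX : BH.of π m * BH.of π m⁻¹ = BH.of π m⁻¹ * BH.of π m := by
      rw [← map_mul, ← map_mul, mul_inv_cancel, inv_mul_cancel]
    rintro x (hx | rfl | rfl) y (hy | rfl | rfl) <;>
    first
    | rfl
    | exact hX
    | exact hX.symm
    | exact BH.comm_of_inv_eq hy _
    | exact (BH.comm_of_inv_eq hx _).symm)

instance : CommRing (BHX m) :=
  { Subalgebra.toRing (BHX m) with
    mul_comm := (isMulCommutative_BHX m).is_comm.comm }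

theorem BHplus_le_BHX : BHplus π ≤ BHX m := fun _ h => Algebra.subset_adjoin (Or.inl h)

theorem inv_mem_BHX {a : BH π} (ha : a ∈ BHX m) : BH.inv a ∈ BHX m := by
  induction ha using Algebra.adjoin_induction with
  | mem x hx =>
    rcases hx with hx | rfl | rfl
    · exact Algebra.subset_adjoin (Or.inl (by
        have h : BH.inv x = x := hx
        rw [h]; exact hx))
    · rw [BH.inv_of]; exact Algebra.subset_adjoin (by simp)
    · rw [BH.inv_of, _root_.inv_inv]; exact Algebra.subset_adjoin (by simp)
  | algebraMap c => rw [BH.inv_algebraMap]; exact Subalgebra.algebraMap_mem _ _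
  | add x y _ _ hx hy => rw [BH.inv_add]; exact add_mem hx hy
  | mul x y _ _ hx hy => rw [BH.inv_mul]; exact mul_mem hy hx

/-- The element `X` of `BH⁺[X^{±1}]`. -/
def elX : BHX m := ⟨BH.of π m, Algebra.subset_adjoin (by simp)⟩

/-- The element `X⁻¹` of `BH⁺[X^{±1}]`. -/
def elXinv : BHX m := ⟨BH.of π m⁻¹, Algebra.subset_adjoin (by simp)⟩

/-- The element `δ = X - X⁻¹`. -/
def elδ : BHX m := elX m - elXinv m

/-- The involution `s` of `BH⁺[X^{±1}]`: the restriction of the canonical anti-involution. -/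
def sX : BHX m →+* BHX m where
  toFun a := ⟨BH.inv a.1, inv_mem_BHX m a.2⟩
  map_one' := Subtype.ext (by simpa using BH.inv_algebraMap (π := π) 1)
  map_zero' := Subtype.ext (by simpa using BH.inv_algebraMap (π := π) 0)
  map_add' a b := Subtype.ext (by simp)
  map_mul' a b := by rw [mul_comm]; exact Subtype.ext (by simp)

theorem sX_δ : sX m (elδ m) = -elδ m :=
  Subtype.ext (by simp [sX, elδ, elX, elXinv])

/-- `BH⁺[X^{±1}][δ⁻¹]`. -/
abbrev BHLoc : Type := Localization.Away (elδ m)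

/-- The element `δ⁻¹` of the localization. -/
def δinv : BHLoc m := IsLocalization.Away.invSelf (elδ m)

/-- The extension of `s` to the localization. -/
def sLoc : BHLoc m →+* BHLoc m :=
  IsLocalization.Away.lift (elδ m) (g := (algebraMap (BHX m) (BHLoc m)).comp (sX m)) (by
    rw [RingHom.comp_apply, sX_δ, map_neg]
    exact (IsLocalization.Away.algebraMap_isUnit (elδ m)).neg)

/-- The inclusion `BH⁺ → BH⁺[X^{±1}] → BH⁺[X^{±1}][δ⁻¹]`. -/
def ιplus : BHplus π →ₐ[ℂ] BHLoc m :=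
  (IsScalarTower.toAlgHom ℂ (BHX m) (BHLoc m)).comp (Subalgebra.inclusion (BHplus_le_BHX m))

/-- The fractional ideal `BH⁺[X^{±1}] + BH⁺[X^{±1}] Q δ⁻¹`, for `Q ∈ BH⁺`. -/
def fracModule (Q : BHplus π) : Submodule ℂ (BHLoc m) :=
  (Submodule.span (BHX m) {1, ιplus m Q * δinv m}).restrictScalars ℂ

/-- The operator `T₀ = -t₁ s Y + (t̄₁ X + t̄₂) δ⁻¹ (1 + s Y)`, where `t̄ᵢ = tᵢ - tᵢ⁻¹`. -/
def opT0 (Y : BHX m) (t₁ t₂ : ℂˣ) (u : BHLoc m) : BHLoc m :=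
  -((t₁ : ℂ) • sLoc m (algebraMap _ _ Y * u)) +
    (((t₁ : ℂ) - (t₁ : ℂ)⁻¹) • algebraMap _ (BHLoc m) (elX m) +
      algebraMap ℂ (BHLoc m) ((t₂ : ℂ) - (t₂ : ℂ)⁻¹)) * δinv m *
      (u + sLoc m (algebraMap _ _ Y * u))

end BH

/-! ### Two-bridge knots `K(p, q)` -/

section Knot

/-- The integer `k_n`, with `k_n ≡ n q (mod 2 p)` and `-p ≤ k_n < p`. -/
def kn (p : ℕ) (q : ℤ) (n : ℕ) : ℤ := Int.bmod (n * q) (2 * p)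

/-- The word `v = b^{e_1} a^{e_2} b^{e_3} ⋯` with `(p - 1) / 2` letters, `e_n = sign k_n`. The
letter `(0, true)` is `a`, `(0, false)` is `a⁻¹`, `(1, true)` is `b`, `(1, false)` is `b⁻¹`. -/
def vWord (p : ℕ) (q : ℤ) : List (Fin 2 × Bool) :=
  (List.range ((p - 1) / 2)).map fun n =>
    (if Even n then 1 else 0, decide (0 < kn p q (n + 1)))

/-- The word `w = v v̄`, where `v̄` is `v` written backwards with `a` and `b` switched. -/
def wWord (p : ℕ) (q : ℤ) : List (Fin 2 × Bool) :=
  vWord p q ++ ((vWord p q).map fun c => (1 - c.1, c.2)).reverse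

/-- The integer `4 (e_1 + ⋯ + e_d)`, `d = (p - 1) / 2`. -/
def sExp (p : ℕ) (q : ℤ) : ℤ :=
  4 * ∑ n ∈ Finset.range ((p - 1) / 2), (kn p q (n + 1)).sign

/-- The group `⟨a, b | a w = w b⟩` of the two-bridge knot `K(p, q)`. -/
abbrev KnotGroup (p : ℕ) (q : ℤ) : Type :=
  PresentedGroup ({(FreeGroup.of (0 : Fin 2) * FreeGroup.mk (wWord p q)) *
    (FreeGroup.mk (wWord p q) * FreeGroup.of (1 : Fin 2))⁻¹} : Set (FreeGroup (Fin 2)))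

/-- The generator `a` (for `0`) or `b` (for `1`) of the knot group. -/
def knotGen (p : ℕ) (q : ℤ) (i : Fin 2) : KnotGroup p q := PresentedGroup.of i

/-- The meridian `m = a`. -/
def meridian (p : ℕ) (q : ℤ) : KnotGroup p q := knotGen p q 0

/-- The longitude `l = w w̃ a^{-s}`, where `w̃` is `w` written backwards. -/
def longitude (p : ℕ) (q : ℤ) : KnotGroup p q :=
  PresentedGroup.mk _ (FreeGroup.mk (wWord p q)) *
    PresentedGroup.mk _ (FreeGroup.mk (wWord p q).reverse) * meridian p q ^ (-sExp p q)

variable {R : Type*} [CommRing R] [Algebra ℂ R]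

/-- The quaternions `a^{±1} = x ± (i + j) / 2` and `b^{±1} = x ∓ (i - j) / 2` in the generalized
quaternion algebra over `R` with `i² = I`, `j² = J`, `ij = -ji = k`. -/
def letterQuat (x I J : R) (c : Fin 2 × Bool) : ℍ[R, I, 0, J] :=
  let h : R := algebraMap ℂ R (if c.2 then 1 / 2 else -1 / 2)
  if c.1 = 0 then ⟨x, h, h, 0⟩ else ⟨x, -h, h, 0⟩

/-- The universal polynomial `Q = L - J N`, where `w = L + M j + N k` in the generalized quaternion
algebra with `i² = I`, `j² = J`, evaluated at elements `x, I, J` of a commutative algebra. -/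
def polyQ (p : ℕ) (q : ℤ) (x I J : R) : R :=
  let w : ℍ[R, I, 0, J] := ((wWord p q).map (letterQuat x I J)).prod
  w.re - J * w.imK

/-- The element `(a - a⁻¹ ± (b - b⁻¹)) / 2` of the Brumfiel–Hilden algebra: `j` for the sign `+`
and `i` for the sign `-`. -/
def ijBH (p : ℕ) (q : ℤ) (ε : ℂ) : BH (KnotGroup p q) :=
  (1 / 2 : ℂ) • ((BH.of _ (knotGen p q 0) - BH.of _ (knotGen p q 0)⁻¹) +
    ε • (BH.of _ (knotGen p q 1) - BH.of _ (knotGen p q 1)⁻¹))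

theorem inv_ijBH (p : ℕ) (q : ℤ) (ε : ℂ) : BH.inv (ijBH p q ε) = -ijBH p q ε := by
  simp only [ijBH, BH.inv_smul, BH.inv_add, BH.inv_sub, BH.inv_of, _root_.inv_inv]
  module

/-- `x = (a + a⁻¹) / 2`, an element of `BH⁺`. -/
def elx (p : ℕ) (q : ℤ) : BHplus (KnotGroup p q) :=
  ⟨(1 / 2 : ℂ) • (BH.of _ (knotGen p q 0) + BH.of _ (knotGen p q 0)⁻¹), by
    change BH.inv _ = _
    simp [add_comm]⟩

/-- `I = i²` and `J = j²`, elements of `BH⁺`. -/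
def elIJ (p : ℕ) (q : ℤ) (ε : ℂ) : BHplus (KnotGroup p q) :=
  ⟨ijBH p q ε * ijBH p q ε, by
    change BH.inv _ = _
    rw [BH.inv_mul, inv_ijBH, neg_mul_neg]⟩

/-- The element `Q = Q(I, J)` of `BH⁺`. -/
def elQ (p : ℕ) (q : ℤ) : BHplus (KnotGroup p q) :=
  polyQ p q (elx p q) (elIJ p q (-1)) (elIJ p q 1)

/-- The module `M = BH⁺[X^{±1}] + BH⁺[X^{±1}] Q δ⁻¹` of the two-bridge knot `K(p, q)`. -/
abbrev knotModule (p : ℕ) (q : ℤ) :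
    Submodule ℂ (BHLoc (meridian p q)) :=
  fracModule (meridian p q) (elQ p q)

end Knot

end TwoBridge

end

noncomputable section

namespace TwoBridge

/-! ### Generalized quaternion algebras: evaluation, norm form and reversing symmetries. -/

section Quat

variable {R : Type*} [CommRing R] {I J : R}

/-! The knot relation makes `a` and `b` conjugate, so `a + a⁻¹ = b + b⁻¹ = 2x`. This forces `ij =
-ji` and `I + J = 4x² - 4`. Hence `BH π` is a quotient of the quaternion algebra over `ℂ[x][J]`, and
since the involution negates `i`, `j` and `k = ij`, the ring `BH⁺` is the image of `ℂ[x][J]`. The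
symmetry of `w` removes its `i`-component, and then `aw - wb` is exactly `Q i`
(`letterQuat_comm_wQuat`), so `Q I = 0` in `BH⁺`. Conversely, matrices with `Q = 0`, and matrices
with `i = 0`, give enough representations to show that a polynomial that dies in the universal
representation is divisible by `Q` and by `I`; as `I` is a prime that does not divide `Q`, it is
divisible by `Q I`. So `BH⁺ = ℂ[x][J]/(Q I)`, it injects into `O(Rep)`, and `δ² = 4x² - 4` is not a
zero divisor in it, whence the embedding in the localization.

Surjectivity onto the character ring is invariant theory. `O(Rep)` is an equivariant quotient of the
polynomial ring in `x` and the entries of the traceless matrices `i` and `j`. Invariants lift to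
invariants by complete reducibility for `𝔰𝔩₂`, proved with the extremal projector
(`exists_sl2_invariant`). The invariants upstairs are polynomials in `x`, the two determinants and
`tr(ij)` (`exists_eq_invSubst`); these go to `x`, `I`, `J` up to sign, and `0`, all in the image of
`BH⁺`.

For the action, the relations of the double affine Hecke algebra hold on the whole localization as
soon as `s` inverts `X` and `Y`. Only the stability of `M` depends on the knot. Writing `Y = A + Bδ`
with `A, B` in `BH⁺`, it reduces to `1 + A ∈ (Q, δ²)` and `Q(1 - A) ∈ (δ²)` (`stable_fracModule`).
Both follow from the norm identity `L² - JM² + IJN² = 1` for `w`, from `Q = L - JN` and from `Q I =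
0` (`exists_elY_eq`). Finally `s` negates `δ` and `Qδ⁻¹`, so averaging over `s` leaves `BH⁺`. -/

/-- The ring homomorphism out of a generalized quaternion algebra determined by a central ring
homomorphism on the coefficients and by the images of `i` and `j`. -/
def quatHom {A : Type*} [Ring A] (f : R →+* A) (hf : ∀ r a, f r * a = a * f r) (i j : A)
    (hi : i * i = f I) (hj : j * j = f J) (hij : j * i = -(i * j)) : ℍ[R, I, 0, J] →+* A :=
  letI := f.toAlgebra' hf
  (QuaternionAlgebra.lift (R := R) (A := A) (c₁ := I) (c₂ := 0) (c₃ := J)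
    { i := i, j := j, k := i * j
      i_mul_i := by rw [hi, zero_smul, add_zero, Algebra.smul_def, mul_one]; rfl
      j_mul_j := by rw [hj, Algebra.smul_def, mul_one]; rfl
      i_mul_j := rfl
      j_mul_i := by rw [hij, zero_smul, zero_sub] } : ℍ[R, I, 0, J] →ₐ[R] A)

theorem quatHom_apply {A : Type*} [Ring A] (f : R →+* A) (hf : ∀ r a, f r * a = a * f r) (i j : A)
    (hi : i * i = f I) (hj : j * j = f J) (hij : j * i = -(i * j)) (z : ℍ[R, I, 0, J]) :
    quatHom f hf i j hi hj hij z
      = f z.re + f z.imI * i + f z.imJ * j + f z.imK * (i * j) := by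
  let _ := f.toAlgebra' hf
  simp only [quatHom]
  change QuaternionAlgebra.Basis.lift _ z = _
  simp only [QuaternionAlgebra.Basis.lift, Algebra.smul_def]
  rfl

/-- The norm form of a generalized quaternion algebra. -/
def quatNorm (z : ℍ[R, I, 0, J]) : R :=
  z.re ^ 2 - I * z.imI ^ 2 - J * z.imJ ^ 2 + I * J * z.imK ^ 2

theorem quatNorm_mul (z w : ℍ[R, I, 0, J]) : quatNorm (z * w) = quatNorm z * quatNorm w := by
  simp only [quatNorm, QuaternionAlgebra.re_mul, QuaternionAlgebra.imI_mul,
    QuaternionAlgebra.imJ_mul, QuaternionAlgebra.imK_mul]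
  ring

/-- The map that negates the coefficient of `i`, an anti-automorphism. -/
def negI (z : ℍ[R, I, 0, J]) : ℍ[R, I, 0, J] := ⟨z.re, -z.imI, z.imJ, z.imK⟩

/-- The map that negates the coefficient of `k`, an anti-automorphism. -/
def negK (z : ℍ[R, I, 0, J]) : ℍ[R, I, 0, J] := ⟨z.re, z.imI, z.imJ, -z.imK⟩

theorem negI_mul (z w : ℍ[R, I, 0, J]) : negI (z * w) = negI w * negI z := by
  ext <;> simp only [negI, QuaternionAlgebra.re_mul, QuaternionAlgebra.imI_mul,
    QuaternionAlgebra.imJ_mul, QuaternionAlgebra.imK_mul] <;> ring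

theorem negK_mul (z w : ℍ[R, I, 0, J]) : negK (z * w) = negK w * negK z := by
  ext <;> simp only [negK, QuaternionAlgebra.re_mul, QuaternionAlgebra.imI_mul,
    QuaternionAlgebra.imJ_mul, QuaternionAlgebra.imK_mul] <;> ring

theorem negI_one : negI (1 : ℍ[R, I, 0, J]) = 1 := by ext <;> simp [negI]

theorem negK_one : negK (1 : ℍ[R, I, 0, J]) = 1 := by ext <;> simp [negK]

end Quat

/-! ### The word `w` in the quaternion algebra and the polynomial `Q`. -/

section Word

variable {R : Type*} [CommRing R] [Algebra ℂ R] (p : ℕ) (q : ℤ) (x I J : R)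

/-- The quaternion expansion of the word `w`. -/
def wQuat : ℍ[R, I, 0, J] := ((wWord p q).map (letterQuat x I J)).prod

theorem polyQ_eq : polyQ p q x I J = (wQuat p q x I J).re - J * (wQuat p q x I J).imK := rfl

/-- Exchanging `a` and `b` is the sign change `i ↦ -i` on letters; together with reversal this is an
anti-automorphism. -/
theorem prod_map_reverse_swap (L : List (Fin 2 × Bool)) :
    (((L.map fun c => (1 - c.1, c.2)).reverse).map (letterQuat x I J)).prod
      = negI ((L.map (letterQuat x I J)).prod) := by
  induction L with
  | nil => simp [negI_one]
  | cons c L ih =>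
    have hc : letterQuat x I J (1 - c.1, c.2) = negI (letterQuat x I J c) := by
      obtain ⟨c, b⟩ := c
      fin_cases c <;> simp [letterQuat, negI]
    rw [List.map_cons, List.reverse_cons, List.map_append, List.prod_append, ih]
    simp only [List.map_cons, List.prod_cons, negI_mul, hc, List.map_nil, List.prod_nil, mul_one]

/-- Letters have no `k`-component, so they are fixed by the anti-automorphism that fixes `i` and
`j`. -/
theorem prod_map_reverse (L : List (Fin 2 × Bool)) :
    ((L.reverse).map (letterQuat x I J)).prod = negK ((L.map (letterQuat x I J)).prod) := by
  induction L with
  | nil => simp [negK_one]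
  | cons c L ih =>
    have hc : letterQuat x I J c = negK (letterQuat x I J c) := by
      simp only [letterQuat, negK]; split_ifs <;> simp
    simp only [List.reverse_cons, List.map_append, List.prod_append, ih, List.map_cons,
      List.prod_cons, negK_mul, ← hc]
    simp

/-- Since `w = v v̄` is `v * negI v`, it is fixed by `negI`. -/
theorem imI_wQuat : (wQuat p q x I J).imI = 0 := by
  simp only [wQuat, wWord, List.map_append, List.prod_append, prod_map_reverse_swap]
  generalize (List.map (letterQuat x I J) (vWord p q)).prod = v
  simp only [negI, QuaternionAlgebra.imI_mul]
  ring

theorem algebraMap_half_sq : (algebraMap ℂ R (1 / 2)) ^ 2 * 4 = 1 := by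
  rw [← map_pow, ← map_ofNat (algebraMap ℂ R) 4, ← map_mul]; norm_num

theorem algebraMap_half_two : algebraMap ℂ R (1 / 2) * 2 = 1 := by
  rw [← map_ofNat (algebraMap ℂ R) 2, ← map_mul]; norm_num

/-- A letter has norm `x² - (I + J)/4`. -/
theorem quatNorm_letterQuat (h : I + J = 4 * x ^ 2 - 4) (c : Fin 2 × Bool) :
    quatNorm (letterQuat x I J c) = 1 := by
  have hh := algebraMap_half_sq (R := R)
  have h1 : algebraMap ℂ R (-1 / 2) = - algebraMap ℂ R (1 / 2) := by rw [← map_neg]; norm_num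
  simp only [letterQuat, quatNorm]
  split_ifs <;> simp only [h1] <;> linear_combination (1 - x ^ 2) * hh -
    (algebraMap ℂ R (1 / 2)) ^ 2 * h

theorem quatNorm_wQuat (h : I + J = 4 * x ^ 2 - 4) : quatNorm (wQuat p q x I J) = 1 := by
  unfold wQuat
  induction wWord p q with
  | nil => simp [quatNorm]
  | cons c L ih => simp [quatNorm_mul, quatNorm_letterQuat x I J h, ih]

/-- With `w = L + Mj + Nk`, the terms `Mj` and `Nk` anticommute with `i`, so `iw + wi = 2L i`, while
`jw - wj = N(jk - kj) = -2JN i`. Half the sum is `(L - JN) i`. This turns the knot relation into the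
one equation `Q i = 0`. -/
theorem letterQuat_comm_wQuat :
    letterQuat x I J (0, true) * wQuat p q x I J - wQuat p q x I J * letterQuat x I J (1, true)
      = ⟨0, polyQ p q x I J, 0, 0⟩ := by
  have h0 := imI_wQuat p q x I J
  have h2 := algebraMap_half_two (R := R)
  rw [polyQ_eq]
  generalize wQuat p q x I J = w at *
  simp only [letterQuat, if_true, one_ne_zero, if_false]
  ext <;> simp [h0]
  · ring
  · simp at h2
    linear_combination (w.re - J * w.imK) * h2
  · ring
  · ring

theorem map_prod_letterQuat {S : Type*} [CommRing S] [Algebra ℂ S] (f : R →ₐ[ℂ] S)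
    (L : List (Fin 2 × Bool)) :
    (L.map (letterQuat (f x) (f I) (f J))).prod =
      ⟨f ((L.map (letterQuat x I J)).prod).re, f ((L.map (letterQuat x I J)).prod).imI,
        f ((L.map (letterQuat x I J)).prod).imJ, f ((L.map (letterQuat x I J)).prod).imK⟩ := by
  induction L with
  | nil => ext <;> simp
  | cons c L ih =>
    have hc : letterQuat (f x) (f I) (f J) c = ⟨f (letterQuat x I J c).re,
        f (letterQuat x I J c).imI, f (letterQuat x I J c).imJ, f (letterQuat x I J c).imK⟩ := by
      simp only [letterQuat]; split_ifs <;> ext <;> simp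
    rw [List.map_cons, List.prod_cons, ih, hc]
    ext <;> simp

theorem map_polyQ {S : Type*} [CommRing S] [Algebra ℂ S] (f : R →ₐ[ℂ] S) :
    f (polyQ p q x I J) = polyQ p q (f x) (f I) (f J) := by
  simp [polyQ, map_prod_letterQuat]

/-- For `I = J = 0` the scalar part is multiplicative and each letter contributes `x`. This value
shows later that `Q` is divisible neither by `I` nor by `x ∓ 1`. -/
theorem polyQ_zero_zero : polyQ p q x 0 0 = x ^ (wWord p q).length := by
  rw [polyQ_eq, zero_mul, sub_zero, wQuat]
  induction wWord p q with
  | nil => simp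
  | cons c L ih =>
    have hc : (letterQuat x 0 0 c).re = x := by simp only [letterQuat]; split_ifs <;> rfl
    simp [ih, hc, pow_succ']

end Word

/-- A homomorphism from a free group maps a word to the product of the values of its letters. -/
theorem map_freeGroup_mk {M α : Type*} [Monoid M] (φ : FreeGroup α →* M) (L : List (α × Bool)) :
    φ (FreeGroup.mk L) =
      (L.map fun c => φ (if c.2 then FreeGroup.of c.1 else (FreeGroup.of c.1)⁻¹)).prod := by
  induction L with
  | nil => simp [← FreeGroup.one_eq_mk]
  | cons c L ih =>
    have : FreeGroup.mk (c :: L) =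
        (if c.2 then FreeGroup.of c.1 else (FreeGroup.of c.1)⁻¹) * FreeGroup.mk L := by
      obtain ⟨c, b⟩ := c
      cases b <;> simp [FreeGroup.of, FreeGroup.inv_mk, FreeGroup.mul_mk, FreeGroup.invRev]
    rw [this, map_mul, ih, List.map_cons, List.prod_cons]

/-! ### The ring `ℂ[x][J]` -/

/-- The polynomial ring `ℂ[x][J]`. -/
abbrev PolyXJ : Type := Polynomial (Polynomial ℂ)

namespace PolyXJ

/-- The variable `x`. -/
def x : PolyXJ := Polynomial.C Polynomial.X

/-- The variable `J`. -/
def J : PolyXJ := Polynomial.X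

/-- The polynomial `I = 4 x² - 4 - J`. -/
def I : PolyXJ := 4 * x ^ 2 - 4 - J

variable {S : Type*} [CommRing S] [Algebra ℂ S]

/-- Evaluation of polynomials in `x` and `J`. -/
def ev (a b : S) : PolyXJ →ₐ[ℂ] S :=
  Polynomial.eval₂AlgHom (Polynomial.aeval a) b (fun _ => Commute.all _ _)

@[simp] theorem ev_x (a b : S) : ev a b x = a := by
  change Polynomial.eval₂ _ b (Polynomial.C _) = a
  simp

@[simp] theorem ev_J (a b : S) : ev a b J = b := by
  change Polynomial.eval₂ _ b Polynomial.X = b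
  simp

theorem ev_I (a b : S) : ev a b I = 4 * a ^ 2 - 4 - b := by
  rw [I, map_sub, map_sub, map_mul, map_pow, map_ofNat, ev_x, ev_J]

theorem I_add_J : I + J = 4 * x ^ 2 - 4 := by simp [I]

theorem algHom_ext {A : Type*} [Semiring A] [Algebra ℂ A] {f g : PolyXJ →ₐ[ℂ] A} (hx : f x = g x)
    (hJ : f J = g J) : f = g := by
  apply Polynomial.algHom_ext'
  · apply Polynomial.algHom_ext
    exact hx
  · exact hJ

end PolyXJ

open PolyXJ

/-! ### The structure of the Brumfiel–Hilden algebra of a two-bridge knot -/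

section Structure

variable (p : ℕ) (q : ℤ)

theorem knot_relation : knotGen p q 0 * PresentedGroup.mk _ (FreeGroup.mk (wWord p q)) =
    PresentedGroup.mk _ (FreeGroup.mk (wWord p q)) * knotGen p q 1 := by
  have h : (PresentedGroup.mk {(FreeGroup.of (0 : Fin 2) * FreeGroup.mk (wWord p q)) *
    (FreeGroup.mk (wWord p q) * FreeGroup.of (1 : Fin 2))⁻¹}) _ = 1 :=
    PresentedGroup.one_of_mem (Set.mem_singleton _)
  rw [map_mul, map_inv, mul_inv_eq_one, map_mul, map_mul] at h
  exact h

/-- The element `i` of the Brumfiel–Hilden algebra. -/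
abbrev iBH : BH (KnotGroup p q) := ijBH p q (-1)

/-- The element `j` of the Brumfiel–Hilden algebra. -/
abbrev jBH : BH (KnotGroup p q) := ijBH p q 1

/-- The element `g + g⁻¹` is central, hence unchanged by conjugation. -/
theorem of_conj_add_inv {π : Type} [Group π] (g w : π) :
    BH.of π (w⁻¹ * g * w) + BH.of π (w⁻¹ * g * w)⁻¹ = BH.of π g + BH.of π g⁻¹ := by
  rw [show (w⁻¹ * g * w)⁻¹ = w⁻¹ * g⁻¹ * w by group, map_mul, map_mul, map_mul, map_mul, ← add_mul,
    ← mul_add, BH.of_comm, mul_assoc, ← map_mul, inv_mul_cancel, map_one, mul_one]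

theorem of_knotGen_add_inv :
    BH.of _ (knotGen p q 1) + BH.of _ (knotGen p q 1)⁻¹ =
      BH.of _ (knotGen p q 0) + BH.of _ (knotGen p q 0)⁻¹ := by
  have h : knotGen p q 1 = (PresentedGroup.mk _ (FreeGroup.mk (wWord p q)))⁻¹ * knotGen p q 0 *
      PresentedGroup.mk _ (FreeGroup.mk (wWord p q)) := by
    rw [mul_assoc, knot_relation, inv_mul_cancel_left]
  rw [h, of_conj_add_inv]

theorem iBH_add_jBH :
    iBH p q + jBH p q = BH.of _ (knotGen p q 0) - BH.of _ (knotGen p q 0)⁻¹ := by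
  simp only [ijBH]; module

theorem jBH_sub_iBH :
    jBH p q - iBH p q = BH.of _ (knotGen p q 1) - BH.of _ (knotGen p q 1)⁻¹ := by
  simp only [ijBH]; module

theorem sub_inv_sq {π : Type} [Group π] (g : π) :
    (BH.of π g - BH.of π g⁻¹) * (BH.of π g - BH.of π g⁻¹) =
      (BH.of π g + BH.of π g⁻¹) * (BH.of π g + BH.of π g⁻¹) - 4 := by
  have h1 : BH.of π g * BH.of π g⁻¹ = 1 := by rw [← map_mul, mul_inv_cancel, map_one]
  have h2 : BH.of π g⁻¹ * BH.of π g = 1 := by rw [← map_mul, inv_mul_cancel, map_one]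
  rw [show (4 : BH π) = 1 + 1 + 1 + 1 by norm_num]
  simp only [sub_mul, mul_sub, add_mul, mul_add, h1, h2]
  abel

theorem elx_coe : (elx p q : BH (KnotGroup p q)) =
  (1 / 2 : ℂ) • (BH.of _ (knotGen p q 0) + BH.of _ (knotGen p q 0)⁻¹) := rfl

theorem two_smul_elx : (2 : ℂ) • (elx p q : BH (KnotGroup p q)) =
    BH.of _ (knotGen p q 0) + BH.of _ (knotGen p q 0)⁻¹ := by
  rw [elx_coe, smul_smul]; norm_num

/-- The elements `a - a⁻¹ = i + j` and `b - b⁻¹ = j - i` have the same square, because `(g - g⁻¹)² =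
(g + g⁻¹)² - 4`; the cross terms give `2(ij + ji) = 0`. -/
theorem jBH_mul_iBH : jBH p q * iBH p q = -(iBH p q * jBH p q) := by
  have h1 := sub_inv_sq (knotGen p q 0)
  have h2 := sub_inv_sq (knotGen p q 1)
  rw [of_knotGen_add_inv, ← h1, ← iBH_add_jBH, ← jBH_sub_iBH] at h2
  simp only [sub_mul, mul_sub, add_mul, mul_add] at h2
  have h3 : (2 : ℂ) • (jBH p q * iBH p q + iBH p q * jBH p q) = 0 := by
    rw [two_smul, ← sub_eq_zero.2 h2.symm]
    abel
  rw [smul_eq_zero] at h3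
  exact eq_neg_of_add_eq_zero_left (h3.resolve_left two_ne_zero)

theorem elI_add_elJ : elIJ p q (-1) + elIJ p q 1 = 4 * elx p q ^ 2 - 4 := by
  apply Subtype.ext
  have h1 := sub_inv_sq (knotGen p q 0)
  rw [← two_smul_elx, ← iBH_add_jBH] at h1
  simp only [add_mul, mul_add, jBH_mul_iBH, smul_mul_smul_comm] at h1
  have h2 : iBH p q * iBH p q + jBH p q * jBH p q =
    (4 : ℂ) • ((elx p q : BH (KnotGroup p q)) * elx p q) - 4 := by
    rw [show (4 : ℂ) = 2 * 2 by norm_num, ← h1]; abel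
  change iBH p q * iBH p q + jBH p q * jBH p q = _
  rw [h2, Algebra.smul_def, map_ofNat, pow_two]
  rfl

/-- The evaluation `ℂ[x][J] → BH⁺`. -/
def evPlus : PolyXJ →ₐ[ℂ] BHplus (KnotGroup p q) := ev (elx p q) (elIJ p q 1)

@[simp] theorem evPlus_x : evPlus p q x = elx p q := ev_x _ _

@[simp] theorem evPlus_J : evPlus p q J = elIJ p q 1 := ev_J _ _

@[simp] theorem evPlus_I : evPlus p q I = elIJ p q (-1) := by
  rw [evPlus, ev_I, ← elI_add_elJ]; ring

/-- The evaluation of quaternions over `ℂ[x][J]` in the Brumfiel–Hilden algebra. -/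
def quatBH : ℍ[PolyXJ, I, 0, J] →+* BH (KnotGroup p q) :=
  quatHom ((BHplus _).val.comp (evPlus p q) : PolyXJ →+* BH (KnotGroup p q))
    (fun r a => (BH.comm_of_inv_eq (evPlus p q r).2 a).symm) (iBH p q) (jBH p q)
    (congrArg Subtype.val (evPlus_I p q)).symm (congrArg Subtype.val (evPlus_J p q)).symm
    (jBH_mul_iBH p q)

theorem quatBH_apply (z : ℍ[PolyXJ, I, 0, J]) : quatBH p q z =
    evPlus p q z.re + evPlus p q z.imI * iBH p q + evPlus p q z.imJ * jBH p q +
      evPlus p q z.imK * (iBH p q * jBH p q) :=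
  quatHom_apply _ _ _ _ _ _ _ z

theorem coe_evPlus_algebraMap (c : ℂ) : (evPlus p q (algebraMap ℂ _ c) : BH (KnotGroup p q)) =
    algebraMap ℂ _ c := by rw [AlgHom.commutes]; rfl

theorem coe_evPlus_algebraMap_mul (c : ℂ) (u : BH (KnotGroup p q)) :
    (evPlus p q (algebraMap ℂ _ c) : BH (KnotGroup p q)) * u = c • u := by
  rw [coe_evPlus_algebraMap, Algebra.smul_def]

theorem quatBH_letterQuat (c : Fin 2 × Bool) : quatBH p q (letterQuat x I J c) =
    BH.of _ (if c.2 then knotGen p q c.1 else (knotGen p q c.1)⁻¹) := by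
  have h0 : BH.of _ (knotGen p q 0) = (elx p q : BH (KnotGroup p q)) +
    (1 / 2 : ℂ) • (iBH p q + jBH p q) := by rw [iBH_add_jBH, elx_coe]; module
  have h0' : BH.of _ (knotGen p q 0)⁻¹ = (elx p q : BH (KnotGroup p q)) -
    (1 / 2 : ℂ) • (iBH p q + jBH p q) := by rw [iBH_add_jBH, elx_coe]; module
  have h1 : BH.of _ (knotGen p q 1) = (elx p q : BH (KnotGroup p q)) +
    (1 / 2 : ℂ) • (jBH p q - iBH p q) := by
      rw [jBH_sub_iBH, elx_coe, ← of_knotGen_add_inv]; module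
  have h1' : BH.of _ (knotGen p q 1)⁻¹ = (elx p q : BH (KnotGroup p q)) -
    (1 / 2 : ℂ) • (jBH p q - iBH p q) := by
      rw [jBH_sub_iBH, elx_coe, ← of_knotGen_add_inv]; module
  rw [quatBH_apply]
  obtain ⟨c, b⟩ := c
  fin_cases c <;> cases b <;>
    simp only [letterQuat, Fin.zero_eta, Fin.mk_one, if_true, one_ne_zero, if_false, map_neg,
      NegMemClass.coe_neg, coe_evPlus_algebraMap_mul, evPlus_x, map_zero, ZeroMemClass.coe_zero,
      zero_mul, h0, h0', h1, h1', Bool.false_eq_true, add_zero, neg_mul] <;> module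

theorem quatBH_prod (L : List (Fin 2 × Bool)) :
    quatBH p q ((L.map (letterQuat x I J)).prod) =
      BH.of (KnotGroup p q) (PresentedGroup.mk _ (FreeGroup.mk L)) := by
  have h := map_freeGroup_mk ((BH.of (KnotGroup p q)).comp
    (PresentedGroup.mk _ : FreeGroup (Fin 2) →* KnotGroup p q)) L
  simp only [MonoidHom.comp_apply] at h
  rw [h, map_list_prod, List.map_map]
  congr 2
  ext c
  rw [Function.comp_apply, quatBH_letterQuat]
  congr 1
  split_ifs
  · rfl
  · exact (map_inv _ _).symm

theorem quatBH_surjective : Function.Surjective (quatBH p q) := by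
  intro u
  induction u using BH.induction with
  | of g =>
    obtain ⟨g, rfl⟩ := PresentedGroup.mk_surjective _ g
    obtain ⟨L, rfl⟩ := Quot.exists_rep g
    exact ⟨_, quatBH_prod p q L⟩
  | add a b ha hb =>
    obtain ⟨a, rfl⟩ := ha
    obtain ⟨b, rfl⟩ := hb
    exact ⟨a + b, map_add _ _ _⟩
  | smul c a ha =>
    obtain ⟨a, rfl⟩ := ha
    refine ⟨⟨algebraMap ℂ _ c, 0, 0, 0⟩ * a, ?_⟩
    rw [map_mul, quatBH_apply, Algebra.smul_def]
    simp only [coe_evPlus_algebraMap, map_zero, ZeroMemClass.coe_zero, zero_mul, add_zero]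

theorem inv_evPlus (r : PolyXJ) : BH.inv (evPlus p q r : BH (KnotGroup p q)) = evPlus p q r :=
  (evPlus p q r).2

theorem inv_evPlus_mul (r : PolyXJ) {u : BH (KnotGroup p q)} (hu : BH.inv u = -u) :
    BH.inv ((evPlus p q r : BH (KnotGroup p q)) * u) =
      -((evPlus p q r : BH (KnotGroup p q)) * u) := by
  rw [BH.inv_mul, hu, inv_evPlus, BH.comm_of_inv_eq (inv_evPlus p q r), mul_neg]

theorem inv_iBH_mul_jBH : BH.inv (iBH p q * jBH p q) = -(iBH p q * jBH p q) := by
  rw [BH.inv_mul, inv_ijBH, inv_ijBH, neg_mul_neg, jBH_mul_iBH]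

/-- The involution negates the `i`, `j` and `k` parts of a quaternion, so for a symmetric element
their sum vanishes and the scalar part alone represents it. -/
theorem evPlus_surjective : Function.Surjective (evPlus p q) := by
  intro u
  obtain ⟨z, hz⟩ := quatBH_surjective p q u
  refine ⟨z.re, Subtype.ext ?_⟩
  have h : BH.inv (u : BH (KnotGroup p q)) = u := u.2
  rw [← hz, quatBH_apply, BH.inv_add, BH.inv_add, BH.inv_add, inv_evPlus,
    inv_evPlus_mul _ _ _ (inv_ijBH p q _), inv_evPlus_mul _ _ _ (inv_ijBH p q _),
    inv_evPlus_mul _ _ _ (inv_iBH_mul_jBH p q)] at h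
  rw [← hz, quatBH_apply]
  set r := (evPlus p q z.re : BH (KnotGroup p q))
  set y := (evPlus p q z.imI : BH (KnotGroup p q)) * iBH p q
  set y' := (evPlus p q z.imJ : BH (KnotGroup p q)) * jBH p q
  set y'' := (evPlus p q z.imK : BH (KnotGroup p q)) * (iBH p q * jBH p q)
  have h2 : (2 : ℂ) • (y + y' + y'') = 0 := by
    rw [two_smul, ← sub_eq_zero.2 h.symm]; abel
  rw [smul_eq_zero] at h2
  rw [add_assoc, add_assoc, ← add_assoc y, h2.resolve_left two_ne_zero, add_zero]

/-- The universal polynomial `Q` in `x` and `J`. -/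
def Qpoly : PolyXJ := polyQ p q x I J

theorem evPlus_Qpoly : evPlus p q (Qpoly p q) = elQ p q := by
  rw [Qpoly, map_polyQ, evPlus_x, evPlus_I, evPlus_J]; rfl

/-- The image of `letterQuat_comm_wQuat`, whose left side vanishes by the knot relation. -/
theorem elQ_mul_iBH : (elQ p q : BH (KnotGroup p q)) * iBH p q = 0 := by
  have h := congrArg (quatBH p q) (letterQuat_comm_wQuat p q x I J)
  rw [map_sub, map_mul, map_mul, quatBH_letterQuat, quatBH_letterQuat, wQuat, quatBH_prod] at h
  simp only [if_true] at h
  rw [← map_mul, ← map_mul, knot_relation, sub_self, quatBH_apply] at h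
  simp only [map_zero, ZeroMemClass.coe_zero, zero_mul, add_zero, zero_add] at h
  rw [← evPlus_Qpoly]
  exact h.symm

theorem elQ_mul_elI : elQ p q * elIJ p q (-1) = 0 := by
  apply Subtype.ext
  change (elQ p q : BH (KnotGroup p q)) * (iBH p q * iBH p q) = 0
  rw [← mul_assoc, elQ_mul_iBH, zero_mul]

end Structure

open PolyXJ

/-! ### Representations into `SL₂` and injectivity -/

section Eval

variable {π : Type} [Group π] {B : Type*} [CommRing B] [Algebra ℂ B]

/-- The algebra map `BH π → M₂(B)` induced by a representation `π → SL₂(B)`. -/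
def evalMat (ρ : π →* Matrix.SpecialLinearGroup (Fin 2) B) :
    BH π →ₐ[ℂ] Matrix (Fin 2) (Fin 2) B :=
  (repLift ρ).mapMatrix.comp (BH.toMat π)

theorem toMat_of (g : π) : BH.toMat π (BH.of π g) = genMat π g := BH.lift_of _ _ g

theorem repLift_mk_X (ρ : π →* Matrix.SpecialLinearGroup (Fin 2) B) (v : π × Fin 2 × Fin 2) :
    repLift ρ (Ideal.Quotient.mk (repIdeal π) (MvPolynomial.X v)) =
      (ρ v.1 : Matrix (Fin 2) (Fin 2) B) v.2.1 v.2.2 := by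
  refine (Ideal.Quotient.lift_mk _ _ _).trans ?_
  exact MvPolynomial.aeval_X _ _

theorem evalMat_of (ρ : π →* Matrix.SpecialLinearGroup (Fin 2) B) (g : π) :
    evalMat ρ (BH.of π g) = ρ g := by
  rw [evalMat, AlgHom.comp_apply, toMat_of]
  ext i j
  simp [genMat, repLift_mk_X]

end Eval

/-! ### Representations of the knot group by quaternion matrices. -/

section Reps

variable {B : Type*} [CommRing B] [Algebra ℂ B] (p : ℕ) (q : ℤ) (x s ε κ : B)

/-- Evaluation of quaternions by the matrices `i = (0, ε; κ, 0)` and `j = diag(s, -s)`. -/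
def quatMat : ℍ[B, ε * κ, 0, s ^ 2] →+* Matrix (Fin 2) (Fin 2) B :=
  quatHom (Matrix.scalar (Fin 2))
    (fun r a => (Matrix.scalar_commute r (fun _ => Commute.all _ _) a).eq) !![0, ε; κ, 0] !![s, 0; 0, -s]
    (by ext i j; fin_cases i <;> fin_cases j <;> simp [mul_comm])
    (by ext i j; fin_cases i <;> fin_cases j <;> simp [pow_two])
    (by ext i j; fin_cases i <;> fin_cases j <;> simp [mul_comm])

omit [Algebra ℂ B] in
theorem quatMat_apply (z : ℍ[B, ε * κ, 0, s ^ 2]) : quatMat s ε κ z =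
    !![z.re + s * z.imJ, ε * z.imI - s * ε * z.imK; κ * z.imI + s * κ * z.imK, z.re - s * z.imJ] := by
  rw [quatMat, quatHom_apply]
  ext i j; fin_cases i <;> fin_cases j <;> simp <;> ring

variable {x s ε κ} (h : ε * κ = 4 * x ^ 2 - 4 - s ^ 2)

omit [Algebra ℂ B] in
theorem det_quatMat (z : ℍ[B, ε * κ, 0, s ^ 2]) : (quatMat s ε κ z).det = quatNorm z := by
  rw [quatMat_apply, Matrix.det_fin_two_of, quatNorm]; ring

/-- The element of `SL₂` that corresponds to a letter. -/
def letterSL (c : Fin 2 × Bool) : Matrix.SpecialLinearGroup (Fin 2) B :=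
  ⟨quatMat s ε κ (letterQuat x (ε * κ) (s ^ 2) c), by
    rw [det_quatMat, quatNorm_letterQuat _ _ _ (by rw [h]; ring)]⟩

theorem coe_letterSL (c : Fin 2 × Bool) : (letterSL h c : Matrix (Fin 2) (Fin 2) B) =
    quatMat s ε κ (letterQuat x (ε * κ) (s ^ 2) c) := rfl

theorem letterSL_inv (i : Fin 2) : (letterSL h (i, true))⁻¹ = letterSL h (i, false) := by
  have h1 : algebraMap ℂ B (-1 / 2) = - algebraMap ℂ B (1 / 2) := by rw [← map_neg]; norm_num
  apply Subtype.ext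
  refine (Matrix.SpecialLinearGroup.coe_inv _).trans ?_
  rw [coe_letterSL, Matrix.adjugate_fin_two]
  refine Eq.trans ?_ (coe_letterSL h _).symm
  rw [quatMat_apply, quatMat_apply]
  ext k l
  fin_cases i <;> fin_cases k <;> fin_cases l <;> simp [letterQuat, h1] <;> ring

theorem lift_letterSL_mk (L : List (Fin 2 × Bool)) :
    (FreeGroup.lift (fun i => letterSL h (i, true)) (FreeGroup.mk L) : Matrix (Fin 2) (Fin 2) B) =
      quatMat s ε κ ((L.map (letterQuat x (ε * κ) (s ^ 2))).prod) := by
  have h1 := map_freeGroup_mk (Matrix.SpecialLinearGroup.coeMonoidHom.comp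
    (FreeGroup.lift (fun i => letterSL h (i, true)))) L
  refine h1.trans ?_
  rw [map_list_prod, List.map_map]
  congr 2
  ext1 c
  obtain ⟨c, b⟩ := c
  cases b
  · simp only [Bool.false_eq_true, if_false, MonoidHom.comp_apply, map_inv, FreeGroup.lift_apply_of,
      letterSL_inv]
    rfl
  · simp only [if_true, MonoidHom.comp_apply, FreeGroup.lift_apply_of]
    rfl

/-- The representation of the knot group given by the letters. -/
def knotRep (h : ε * κ = 4 * x ^ 2 - 4 - s ^ 2) (hε : polyQ p q x (ε * κ) (s ^ 2) * ε = 0)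
    (hκ : polyQ p q x (ε * κ) (s ^ 2) * κ = 0) :
    KnotGroup p q →* Matrix.SpecialLinearGroup (Fin 2) B :=
  PresentedGroup.toGroup (f := fun i => letterSL h (i, true)) (by
    intro r hr
    rw [Set.mem_singleton_iff] at hr
    rw [hr, map_mul, map_inv, mul_inv_eq_one, map_mul, map_mul, FreeGroup.lift_apply_of,
      FreeGroup.lift_apply_of]
    apply Subtype.ext
    refine (Matrix.SpecialLinearGroup.coe_mul _ _).trans (Eq.trans ?_
      (Matrix.SpecialLinearGroup.coe_mul _ _).symm)
    rw [lift_letterSL_mk, coe_letterSL, coe_letterSL, ← map_mul, ← map_mul, ← sub_eq_zero,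
      ← map_sub]
    -- The defect `aw - wb` is `Q i`, a matrix whose only nonzero entries are `Qε` and `Qκ`.
    refine (congrArg (quatMat s ε κ) (letterQuat_comm_wQuat p q x (ε * κ) (s ^ 2))).trans ?_
    rw [quatMat_apply]
    generalize polyQ p q x (ε * κ) (s ^ 2) = u at hε hκ
    rw [mul_comm] at hε hκ
    ext i j
    fin_cases i <;> fin_cases j <;> simp [hε, hκ])

variable (hε : polyQ p q x (ε * κ) (s ^ 2) * ε = 0) (hκ : polyQ p q x (ε * κ) (s ^ 2) * κ = 0)

theorem knotRep_knotGen (i : Fin 2) :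
    knotRep p q h hε hκ (knotGen p q i) = letterSL h (i, true) :=
  PresentedGroup.toGroup.of _

theorem evalMat_letter (c : Fin 2 × Bool) :
    evalMat (knotRep p q h hε hκ) (BH.of _ (if c.2 then knotGen p q c.1 else (knotGen p q c.1)⁻¹)) =
      quatMat s ε κ (letterQuat x (ε * κ) (s ^ 2) c) := by
  rw [evalMat_of]
  obtain ⟨c, b⟩ := c
  cases b
  · simp only [Bool.false_eq_true, if_false, map_inv, knotRep_knotGen, letterSL_inv]
    rfl
  · simp only [if_true, knotRep_knotGen]
    rfl

theorem evalMat_evPlus (r : PolyXJ) :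
    evalMat (knotRep p q h hε hκ) (evPlus p q r) = Matrix.scalar (Fin 2) (ev x (s ^ 2) r) := by
  have h2 := algebraMap_half_two (R := B)
  have h1 : algebraMap ℂ B (-1 / 2) = - algebraMap ℂ B (1 / 2) := by rw [← map_neg]; norm_num
  have ha := evalMat_letter p q h hε hκ (0, true)
  have ha' := evalMat_letter p q h hε hκ (0, false)
  have hb := evalMat_letter p q h hε hκ (1, true)
  have hb' := evalMat_letter p q h hε hκ (1, false)
  rw [quatMat_apply] at ha ha' hb hb'
  simp only [Bool.false_eq_true, if_false, if_true] at ha ha' hb hb'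
  have hx : evalMat (knotRep p q h hε hκ) (elx p q) = Matrix.scalar (Fin 2) x := by
    rw [elx_coe, map_smul, map_add, ha, ha', Algebra.smul_def, Matrix.algebraMap_eq_diagonal]
    ext k l
    fin_cases k <;> fin_cases l <;> simp [letterQuat, h1, -one_div]
    · linear_combination x * h2
    · linear_combination x * h2
  have hj : evalMat (knotRep p q h hε hκ) (jBH p q) = !![s, 0; 0, -s] := by
    rw [jBH, ijBH, map_smul, map_add, map_smul, map_sub, map_sub, ha, ha', hb, hb', one_smul,
      Algebra.smul_def, Matrix.algebraMap_eq_diagonal]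
    ext k l
    fin_cases k <;> fin_cases l <;> simp [letterQuat, h1, -one_div]
    · linear_combination (s * algebraMap ℂ B (1 / 2) * 2 + s) * h2
    · linear_combination -(s * algebraMap ℂ B (1 / 2) * 2 + s) * h2
  have hJ : evalMat (knotRep p q h hε hκ) (elIJ p q 1) = Matrix.scalar (Fin 2) (s ^ 2) := by
    change evalMat (knotRep p q h hε hκ) (jBH p q * jBH p q) = _
    rw [map_mul, hj]
    ext k l
    fin_cases k <;> fin_cases l <;> simp [pow_two]
  have key : (evalMat (knotRep p q h hε hκ)).comp ((BHplus _).val.comp (evPlus p q)) =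
      (Matrix.scalarAlgHom (Fin 2) ℂ).comp (ev x (s ^ 2)) := by
    apply PolyXJ.algHom_ext
    · simpa using hx
    · simpa using hJ
  exact DFunLike.congr_fun key r

/-- What vanishes in the universal representation vanishes in each `knotRep`, where `x` and `J`
become the scalars `x` and `s²`. -/
theorem ev_eq_zero_of_toMat {x s : B} (ε κ : B) (h : ε * κ = 4 * x ^ 2 - 4 - s ^ 2)
    (hε : polyQ p q x (ε * κ) (s ^ 2) * ε = 0) (hκ : polyQ p q x (ε * κ) (s ^ 2) * κ = 0)
    {r : PolyXJ} (hr : BH.toMat (KnotGroup p q) (evPlus p q r) = 0) :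
    ev x (s ^ 2) r = 0 := by
  have h1 := evalMat_evPlus p q h hε hκ r
  rw [evalMat, AlgHom.comp_apply, hr, map_zero] at h1
  simpa using (congrFun (congrFun h1 0) 0).symm

end Reps

/-! ### The kernel of `ℂ[x][J] → BH⁺`. -/

section Injectivity

variable (p : ℕ) (q : ℤ)

theorem ev_x_sq_eq_expand (r : PolyXJ) : ev x (J ^ 2) r = Polynomial.expand _ 2 r := by
  have : ev x (J ^ 2) = (Polynomial.expand (Polynomial ℂ) 2).restrictScalars ℂ := by
    apply PolyXJ.algHom_ext
    · rw [ev_x]; simp [x]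
    · rw [ev_J]; simp [J]
  exact DFunLike.congr_fun this r

/-- The matrix `j = diag(s, -s)` needs a square root of `J`, that is, the substitution `J ↦ J²`.
Divisibility descends from it because taking the even part, `contract 2`, is linear over the even
polynomials. -/
theorem dvd_of_expand_dvd {f g : PolyXJ} (h : ev x (J ^ 2) g ∣ ev x (J ^ 2) f) : g ∣ f := by
  rw [ev_x_sq_eq_expand, ev_x_sq_eq_expand] at h
  obtain ⟨c, hc⟩ := h
  refine ⟨Polynomial.contract 2 c, ?_⟩
  rw [mul_comm, ← Polynomial.contract_mul_expand two_ne_zero, mul_comm, ← hc,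
    Polynomial.contract_expand _ two_ne_zero]

/-- The universal test algebra is the quotient by `g(x, J²)`. -/
theorem dvd_of_forall_algHom {f g : PolyXJ}
    (h : ∀ (B : Type) [CommRing B] [Algebra ℂ B] (φ : PolyXJ →ₐ[ℂ] B),
      φ (ev x (J ^ 2) g) = 0 → φ (ev x (J ^ 2) f) = 0) : g ∣ f := by
  have h1 := h (PolyXJ ⧸ Ideal.span {ev x (J ^ 2) g}) (Ideal.Quotient.mkₐ ℂ _)
    (Ideal.Quotient.eq_zero_iff_mem.2 (Ideal.mem_span_singleton_self _))
  exact dvd_of_expand_dvd (Ideal.mem_span_singleton.1 (Ideal.Quotient.eq_zero_iff_mem.1 h1))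

theorem algHom_ev_x_sq {B : Type*} [CommRing B] [Algebra ℂ B] (φ : PolyXJ →ₐ[ℂ] B) (r : PolyXJ) :
    φ (ev x (J ^ 2) r) = ev (φ x) (φ J ^ 2) r := by
  have : φ.comp (ev x (J ^ 2)) = ev (φ x) (φ J ^ 2) := by
    apply PolyXJ.algHom_ext <;> simp
  exact DFunLike.congr_fun this r

/-- Where `Q = 0`, the relation puts no condition on `i`, so `ε = 1` and `κ = I` give a
representation. -/
theorem Qpoly_dvd_of_toMat {r : PolyXJ} (hr : BH.toMat (KnotGroup p q) (evPlus p q r) = 0) :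
    Qpoly p q ∣ r := by
  apply dvd_of_forall_algHom
  intro B _ _ φ hφ
  rw [algHom_ev_x_sq] at hφ ⊢
  have hQ : polyQ p q (φ x) (1 * (4 * φ x ^ 2 - 4 - φ J ^ 2)) (φ J ^ 2) = 0 := by
    rw [Qpoly, map_polyQ, ev_I, ev_x, ev_J] at hφ
    rw [one_mul, hφ]
  exact ev_eq_zero_of_toMat p q 1 _ (one_mul _) (by rw [hQ, zero_mul]) (by rw [hQ, zero_mul]) hr

/-- Where `I = 0`, the matrix `i = 0` is allowed; these are the representations with `a = b`. -/
theorem I_dvd_of_toMat {r : PolyXJ} (hr : BH.toMat (KnotGroup p q) (evPlus p q r) = 0) :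
    I ∣ r := by
  apply dvd_of_forall_algHom
  intro B _ _ φ hφ
  rw [algHom_ev_x_sq] at hφ ⊢
  rw [ev_I] at hφ
  exact ev_eq_zero_of_toMat p q 0 0 (by rw [hφ, zero_mul]) (mul_zero _) (mul_zero _) hr

theorem prime_I : Prime I := by
  have : I = -(Polynomial.X - Polynomial.C (4 * Polynomial.X ^ 2 - 4)) := by
    rw [I, x, J, map_sub, map_mul, map_pow, map_ofNat]; ring
  rw [this]
  exact (Polynomial.prime_X_sub_C _).neg

theorem ev_Qpoly_ne_zero {c : ℂ} (hc : c ^ 2 = 1) : ev c 0 (Qpoly p q) ≠ 0 := by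
  rw [Qpoly, map_polyQ, ev_I, ev_x, ev_J, hc, show (4 * 1 - 4 - 0 : ℂ) = 0 by norm_num,
    polyQ_zero_zero]
  refine pow_ne_zero _ ?_
  rintro rfl
  norm_num at hc

/-- The ideals `(Q)` and `(I)` meet in `(Q I)`: `I` is prime, and at `x = 1`, `J = 0` it vanishes
while `Q` does not. -/
theorem Qpoly_mul_I_dvd {r : PolyXJ} (hr : BH.toMat (KnotGroup p q) (evPlus p q r) = 0) :
    Qpoly p q * I ∣ r := by
  obtain ⟨c, rfl⟩ := Qpoly_dvd_of_toMat p q hr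
  refine mul_dvd_mul_left _ ((prime_I.dvd_or_dvd (I_dvd_of_toMat p q hr)).resolve_left ?_)
  rintro ⟨d, hd⟩
  apply ev_Qpoly_ne_zero p q (one_pow 2 : (1 : ℂ) ^ 2 = 1)
  rw [hd, map_mul, ev_I]
  norm_num

theorem evPlus_Qpoly_mul_I : evPlus p q (Qpoly p q * I) = 0 := by
  rw [map_mul, evPlus_Qpoly, evPlus_I, elQ_mul_elI]

theorem evPlus_eq_zero_iff (r : PolyXJ) : evPlus p q r = 0 ↔ Qpoly p q * I ∣ r := by
  constructor
  · intro h
    exact Qpoly_mul_I_dvd p q (by rw [h, ZeroMemClass.coe_zero, map_zero])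
  · rintro ⟨c, rfl⟩
    rw [map_mul, evPlus_Qpoly_mul_I, zero_mul]

/-- The map from `BH⁺` to matrices over the coordinate ring of the representation scheme is
injective. -/
theorem eq_zero_of_toMat_eq_zero {u : BHplus (KnotGroup p q)}
    (hu : BH.toMat (KnotGroup p q) u = 0) : u = 0 := by
  obtain ⟨r, rfl⟩ := evPlus_surjective p q u
  exact (evPlus_eq_zero_iff p q r).2 (Qpoly_mul_I_dvd p q hu)

/-- The prime `x - c` with `c = ±1` divides neither factor: `Q` is nonzero at `(c, 0)` and `I` is
`-1` at `(c, 1)`. -/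
theorem dvd_of_dvd_mul_x_sub {c : ℂ} (hc : c ^ 2 = 1) {r : PolyXJ}
    (h : Qpoly p q * I ∣ r * (x - algebraMap ℂ _ c)) : Qpoly p q * I ∣ r := by
  have hx : (x - algebraMap ℂ PolyXJ c) = Polynomial.C (Polynomial.X - Polynomial.C c) := by
    simp [x, Polynomial.algebraMap_apply]
  have hpr : Prime (x - algebraMap ℂ PolyXJ c) := by
    rw [hx, Polynomial.prime_C_iff]; exact Polynomial.prime_X_sub_C c
  have hev : ∀ z, ev c z (x - algebraMap ℂ PolyXJ c) = 0 := fun z => by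
    rw [map_sub, ev_x, AlgHom.commutes]; exact sub_self c
  obtain ⟨d, hd⟩ := h
  have h1 : x - algebraMap ℂ PolyXJ c ∣ Qpoly p q * I * d := ⟨r, by rw [← hd, mul_comm]⟩
  rcases hpr.dvd_or_dvd h1 with h2 | ⟨e, rfl⟩
  · exfalso
    rcases hpr.dvd_or_dvd h2 with ⟨e, he⟩ | ⟨e, he⟩
    · apply ev_Qpoly_ne_zero p q hc
      rw [he, map_mul, hev, zero_mul]
    · have h3 : ev c 1 I = 0 := by rw [he, map_mul, hev, zero_mul]
      rw [ev_I, hc] at h3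
      norm_num at h3
  · refine ⟨e, mul_right_cancel₀ hpr.ne_zero ?_⟩
    rw [hd]; ring

/-- `4 x² - 4` is not a zero divisor in `BH⁺`. -/
theorem eq_zero_of_mul_sq_eq_zero {u : BHplus (KnotGroup p q)}
    (hu : u * (4 * elx p q ^ 2 - 4) = 0) : u = 0 := by
  obtain ⟨r, rfl⟩ := evPlus_surjective p q u
  rw [evPlus_eq_zero_iff]
  have h1 : evPlus p q (r * (4 * x ^ 2 - 4)) = 0 := by
    rw [← hu, map_mul, map_sub, map_mul, map_pow, map_ofNat, evPlus_x]
  rw [evPlus_eq_zero_iff] at h1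
  have h4 : IsUnit (4 : PolyXJ) := by
    rw [← map_ofNat (algebraMap ℂ PolyXJ) 4]
    exact (isUnit_iff_ne_zero.2 (by norm_num : (4 : ℂ) ≠ 0)).map _
  apply dvd_of_dvd_mul_x_sub p q (one_pow 2)
  apply dvd_of_dvd_mul_x_sub p q (c := -1) (by norm_num)
  rw [← h4.dvd_mul_right]
  convert h1 using 1
  rw [map_neg, map_one]
  ring

end Injectivity

/-! ### Invariants of `𝔰𝔩₂` and the extremal projector -/

section SlTwo

variable {V : Type*} [AddCommGroup V] [Module ℂ V] {e f h : Module.End ℂ V}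

theorem sl2_h_pow_f (hf : ∀ v, h (f v) = f (h v) - (2 : ℂ) • f v) {μ : ℂ} {w : V}
    (hw : h w = μ • w) (k : ℕ) : h ((f ^ k) w) = (μ - 2 * k) • (f ^ k) w := by
  induction k with
  | zero => simp [hw]
  | succ k ih =>
    rw [pow_succ', Module.End.mul_apply, hf, ih, map_smul, ← sub_smul]
    congr 1; push_cast; ring

theorem sl2_h_pow_e (he : ∀ v, h (e v) = e (h v) + (2 : ℂ) • e v) {μ : ℂ} {w : V}
    (hw : h w = μ • w) (k : ℕ) : h ((e ^ k) w) = (μ + 2 * k) • (e ^ k) w := by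
  induction k with
  | zero => simp [hw]
  | succ k ih =>
    rw [pow_succ', Module.End.mul_apply, he, ih, map_smul, ← add_smul]
    congr 1; push_cast; ring

theorem sl2_e_pow_f (hf : ∀ v, h (f v) = f (h v) - (2 : ℂ) • f v)
    (hef : ∀ v, e (f v) = f (e v) + h v) {μ : ℂ} {w : V} (hw : h w = μ • w) (k : ℕ) :
    e ((f ^ (k + 1)) w) = (f ^ (k + 1)) (e w) + ((k + 1) * (μ - k)) • (f ^ k) w := by
  induction k with
  | zero => simp [hef, hw]
  | succ k ih =>
    rw [pow_succ', Module.End.mul_apply, hef, ih, sl2_h_pow_f hf hw, map_add, map_smul,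
      Module.End.mul_apply, ← Module.End.mul_apply f (f ^ k), ← pow_succ',
      add_assoc, ← add_smul]
    congr 2; push_cast; ring

/-- The coefficients of the extremal projector of `𝔰𝔩₂` in weight zero. -/
def extremalCoeff : ℕ → ℂ
  | 0 => 1
  | k + 1 => -extremalCoeff k / ((k + 1) * (k + 2))

theorem extremalCoeff_succ (k : ℕ) :
    extremalCoeff (k + 1) * ((k + 1) * (k + 2)) = -extremalCoeff k := by
  have h1 : (k : ℂ) + 1 ≠ 0 := by exact_mod_cast Nat.succ_ne_zero k
  have h2 : (k : ℂ) + 2 ≠ 0 := by exact_mod_cast Nat.succ_ne_zero (k + 1)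
  rw [extremalCoeff]
  field_simp

/-- The sum telescopes. The vector `e^(n+1) v` has weight `2(n+1)`, so moving `e` past `f^(n+1)`
produces `(n+1)(n+2) f^n e^(n+1) v`, which the recursion of the coefficients cancels against the
previous remainder. -/
theorem e_extremal_sum (he : ∀ v, h (e v) = e (h v) + (2 : ℂ) • e v)
    (hf : ∀ v, h (f v) = f (h v) - (2 : ℂ) • f v)
    (hef : ∀ v, e (f v) = f (e v) + h v) {v : V} (hv : h v = 0) (n : ℕ) :
    e (∑ k ∈ Finset.range (n + 1), extremalCoeff k • (f ^ k) ((e ^ k) v)) =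
      extremalCoeff n • (f ^ n) ((e ^ (n + 1)) v) := by
  induction n with
  | zero => simp
  | succ n ih =>
    have hw := sl2_h_pow_e he (show h v = (0 : ℂ) • v by rw [hv, zero_smul]) (n + 1)
    rw [Finset.sum_range_succ, map_add, ih, map_smul, sl2_e_pow_f hf hef hw, smul_add, smul_smul,
      ← Module.End.mul_apply e, ← pow_succ' e, add_left_comm, ← add_smul]
    rw [show extremalCoeff n + extremalCoeff (n + 1) * ((↑n + 1) * (0 + 2 * ↑(n + 1) - ↑n)) = 0 by
      have := extremalCoeff_succ n
      push_cast
      linear_combination this, zero_smul, add_zero]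

/-- Complete reducibility for `𝔰𝔩₂`: a vector that is invariant modulo a submodule is congruent to
an invariant vector. -/
theorem exists_sl2_invariant (he : ∀ v, h (e v) = e (h v) + (2 : ℂ) • e v)
    (hf : ∀ v, h (f v) = f (h v) - (2 : ℂ) • f v)
    (hef : ∀ v, e (f v) = f (e v) + h v)
    (nilE : ∀ v, ∃ n, (e ^ n) v = 0) (nilF : ∀ v, ∃ n, (f ^ n) v = 0)
    (wt : ∀ v, ∃ P : Polynomial ℂ, P.eval 0 = 1 ∧ h (Polynomial.aeval h P v) = 0)
    (K : Submodule ℂ V) (hKe : ∀ v ∈ K, e v ∈ K) (hKf : ∀ v ∈ K, f v ∈ K)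
    {v : V} (hve : e v ∈ K) (hvf : f v ∈ K) :
    ∃ u, u - v ∈ K ∧ e u = 0 ∧ f u = 0 := by
  have hh : ∀ v, h v = e (f v) - f (e v) := fun v => by rw [hef]; abel
  have hKh : ∀ v ∈ K, h v ∈ K := fun v hv => by
    rw [hh]; exact sub_mem (hKe _ (hKf _ hv)) (hKf _ (hKe _ hv))
  have hvh : h v ∈ K := by rw [hh]; exact sub_mem (hKe _ hvf) (hKf _ hve)
  have hKp : ∀ (P : Polynomial ℂ) (v), v ∈ K → Polynomial.aeval h P v ∈ K := by
    intro P v hv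
    induction P using Polynomial.induction_on' with
    | add P P' hP hP' => rw [map_add]; exact add_mem hP hP'
    | monomial n c =>
      rw [Polynomial.aeval_monomial, Module.End.mul_apply, Module.algebraMap_end_apply]
      refine K.smul_mem _ ?_
      induction n with
      | zero => simpa using hv
      | succ n ih => rw [pow_succ', Module.End.mul_apply]; exact hKh _ ih
  -- Projection to weight zero: `P(0) = 1` gives `P(h) v - v = P'(h)(h v)`, which lies in `K`.
  obtain ⟨P, hP, hPv⟩ := wt v
  set v₁ := Polynomial.aeval h P v with hv₁
  have hsub : v₁ - v ∈ K := by
    have hX : Polynomial.X ∣ P - 1 := by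
      rw [Polynomial.X_dvd_iff, Polynomial.coeff_zero_eq_eval_zero, Polynomial.eval_sub, hP,
        Polynomial.eval_one, sub_self]
    obtain ⟨P', hP'⟩ := hX
    have h1 : v₁ - v = Polynomial.aeval h P' (h v) := by
      rw [hv₁, eq_add_of_sub_eq hP', mul_comm]
      simp
    rw [h1]
    exact hKp _ _ hvh
  have hv₁e : e v₁ ∈ K := by
    have := add_mem (hKe _ hsub) hve
    rwa [map_sub, sub_add_cancel] at this
  -- Apply the extremal projector. It starts with `v₁`, each further term contains `e v₁ ∈ K`, and
  -- the remainder is zero since `e ^ N` kills `v₁`.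
  obtain ⟨N, hN⟩ := nilE v₁
  set v₂ := ∑ k ∈ Finset.range (N + 1), extremalCoeff k • (f ^ k) ((e ^ k) v₁) with hv₂
  have hev₂ : e v₂ = 0 := by
    rw [hv₂, e_extremal_sum he hf hef hPv, pow_succ', Module.End.mul_apply, hN, map_zero, map_zero,
      smul_zero]
  have hhv₂ : h v₂ = (0 : ℂ) • v₂ := by
    rw [zero_smul, hv₂, map_sum]
    refine Finset.sum_eq_zero fun k _ => ?_
    have hw := sl2_h_pow_e he (show h v₁ = (0 : ℂ) • v₁ by rw [hPv, zero_smul]) k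
    rw [map_smul, sl2_h_pow_f hf hw, zero_add, sub_self, zero_smul, smul_zero]
  refine ⟨v₂, ?_, hev₂, ?_⟩
  · have h1 : v₂ - v₁ ∈ K := by
      rw [hv₂, Finset.sum_range_succ']
      simp only [pow_zero, Module.End.one_apply, extremalCoeff, one_smul, add_sub_cancel_right]
      refine sum_mem fun k _ => K.smul_mem _ ?_
      have hfK : ∀ (n : ℕ) (v), v ∈ K → (f ^ n) v ∈ K := by
        intro n v hv
        induction n with
        | zero => simpa using hv
        | succ n ih => rw [pow_succ', Module.End.mul_apply]; exact hKf _ ih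
      have heK : ∀ (n : ℕ) (v), v ∈ K → (e ^ n) v ∈ K := by
        intro n v hv
        induction n with
        | zero => simpa using hv
        | succ n ih => rw [pow_succ', Module.End.mul_apply]; exact hKe _ ih
      rw [pow_succ e, Module.End.mul_apply]
      exact hfK _ _ (heK _ _ hv₁e)
    simpa using add_mem h1 hsub
  -- A vector of weight zero that is killed by `e` is killed by `f`: if `f^(m+2) v₂ = 0`, then
  -- applying `e` gives `-(m+2)(m+1) f^(m+1) v₂ = 0`, against minimality.
  · have hex := nilF v₂
    classical
    have hspec := Nat.find_spec hex
    have hmin := fun m => Nat.find_min (m := m) hex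
    rcases hn : Nat.find hex with _ | _ | m
    · rw [hn] at hspec
      have : v₂ = 0 := by simpa using hspec
      rw [this, map_zero]
    · rw [hn] at hspec
      simpa using hspec
    · exfalso
      rw [hn] at hspec
      apply hmin (m + 1) (by omega)
      have h1 := sl2_e_pow_f hf hef hhv₂ (m + 1)
      rw [hspec, hev₂, map_zero, map_zero, zero_add] at h1
      have h2 := (smul_eq_zero.1 h1.symm).resolve_left (by
        have h3 : ((m : ℂ) + 1 + 1) ≠ 0 := by exact_mod_cast Nat.succ_ne_zero (m + 1)
        have h4 : ((m : ℂ) + 1) ≠ 0 := by exact_mod_cast Nat.succ_ne_zero m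
        push_cast
        rw [zero_sub]
        exact mul_ne_zero h3 (neg_ne_zero.2 h4))
      exact h2

end SlTwo

/-! ### Polynomial functions of a scalar and two traceless `2 × 2` matrices -/

/-- The polynomial ring in a scalar `x` (the variable `none`) and the entries of two traceless
matrices `(u₀, u₁; u₂, -u₀)`. -/
abbrev PolyPair : Type := MvPolynomial (Option (Fin 2 × Fin 3)) ℂ

namespace PolyPair

open MvPolynomial

/-- The scalar coordinate. -/
abbrev s : PolyPair := X none

/-- The coordinates of the matrices. -/
abbrev u (r : Fin 2) (c : Fin 3) : PolyPair := X (some (r, c))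

/-- The derivation `M ↦ [N, M]` for the matrix `N = (0, a; b, 0)`. -/
def der (a b : ℂ) : Derivation ℂ PolyPair PolyPair :=
  mkDerivation ℂ fun v => v.elim 0 fun rc =>
    ![C a * u rc.1 2 - C b * u rc.1 1, -2 * C a * u rc.1 0, 2 * C b * u rc.1 0] rc.2

/-- The derivation `M ↦ [N, M]` for the matrix `N = diag(1, -1)`. -/
def derH : Derivation ℂ PolyPair PolyPair :=
  mkDerivation ℂ fun v => v.elim 0 fun rc => ![0, 2 * u rc.1 1, -2 * u rc.1 2] rc.2

/-- The conjugation `M ↦ (1 + t N) M (1 - t N)` for the matrix `N = (0, a; b, 0)`. -/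
def flow (a b : ℂ) : PolyPair →ₐ[ℂ] Polynomial PolyPair :=
  aeval fun v => v.elim (Polynomial.C s) fun rc =>
    ![Polynomial.C (u rc.1 0) + Polynomial.X * Polynomial.C (C a * u rc.1 2 - C b * u rc.1 1),
      Polynomial.C (u rc.1 1) - Polynomial.X * Polynomial.C (2 * C a * u rc.1 0) -
        Polynomial.X ^ 2 * Polynomial.C (C a ^ 2 * u rc.1 2),
      Polynomial.C (u rc.1 2) + Polynomial.X * Polynomial.C (2 * C b * u rc.1 0) -
        Polynomial.X ^ 2 * Polynomial.C (C b ^ 2 * u rc.1 1)] rc.2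

/-- As `N² = ab = 0`, the matrix `1 + tN` is `exp(tN)`, and the flow is the one-parameter group
generated by the derivation. Both sides obey the Leibniz rule along the flow, so variables suffice.
-/
theorem derivative_flow {a b : ℂ} (hab : a * b = 0) (G : PolyPair) :
    Polynomial.derivative (flow a b G) = flow a b (der a b G) := by
  have hab' : (Polynomial.C (C a) * Polynomial.C (C b) : Polynomial PolyPair) = 0 := by
    rw [← Polynomial.C_mul, ← C_mul, hab]; simp
  induction G using MvPolynomial.induction_on with
  | C c =>
    have h1 : flow a b (C c) = Polynomial.C (C c) := AlgHom.commutes _ c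
    rw [h1, Polynomial.derivative_C]
    simp [der]
  | add P Q hP hQ => simp [hP, hQ]
  | mul_X P v hP =>
    have hv : Polynomial.derivative (flow a b (X v)) = flow a b (der a b (X v)) := by
      have hC : ∀ c, flow a b (C c) = Polynomial.C (C c) := fun c => AlgHom.commutes _ c
      rcases v with _ | ⟨r, c⟩
      · simp [flow, der]
      · have h0 : flow a b (u r 0) = Polynomial.C (u r 0) +
          Polynomial.X * Polynomial.C (C a * u r 2 - C b * u r 1) := by simp [flow]
        have h1 : flow a b (u r 1) = Polynomial.C (u r 1) -
          Polynomial.X * Polynomial.C (2 * C a * u r 0) -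
          Polynomial.X ^ 2 * Polynomial.C (C a ^ 2 * u r 2) := by simp [flow]
        have h2 : flow a b (u r 2) = Polynomial.C (u r 2) +
          Polynomial.X * Polynomial.C (2 * C b * u r 0) -
          Polynomial.X ^ 2 * Polynomial.C (C b ^ 2 * u r 1) := by simp [flow]
        have d0 : der a b (u r 0) = C a * u r 2 - C b * u r 1 := by simp [der, mkDerivation_X]
        have d1 : der a b (u r 1) = -2 * C a * u r 0 := by simp [der, mkDerivation_X]
        have d2 : der a b (u r 2) = 2 * C b * u r 0 := by simp [der, mkDerivation_X]
        fin_cases c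
        · change Polynomial.derivative (flow a b (u r 0)) = flow a b (der a b (u r 0))
          rw [d0, h0]
          simp only [map_sub, map_mul, hC, h1, h2, map_add, Polynomial.derivative_C,
            Polynomial.derivative_mul, Polynomial.derivative_X, map_ofNat, map_pow]
          linear_combination (-4 * Polynomial.X * Polynomial.C (u r 0) + Polynomial.X ^ 2 *
            (Polynomial.C (C b) * Polynomial.C (u r 1) -
              Polynomial.C (C a) * Polynomial.C (u r 2))) * hab'
        · change Polynomial.derivative (flow a b (u r 1)) = flow a b (der a b (u r 1))
          rw [d1, h1]
          simp only [map_sub, map_mul, hC, h0, Polynomial.derivative_C,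
            Polynomial.derivative_mul, Polynomial.derivative_X, map_ofNat, map_pow, map_neg,
            Polynomial.derivative_pow, Polynomial.derivative_ofNat]
          push_cast
          simp only [map_ofNat]
          linear_combination (-2 * Polynomial.X * Polynomial.C (u r 1)) * hab'
        · change Polynomial.derivative (flow a b (u r 2)) = flow a b (der a b (u r 2))
          rw [d2, h2]
          simp only [map_sub, map_mul, hC, h0, map_add, Polynomial.derivative_C,
            Polynomial.derivative_mul, Polynomial.derivative_X, map_ofNat, map_pow,
            Polynomial.derivative_pow, Polynomial.derivative_ofNat]
          push_cast
          simp only [map_ofNat]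
          linear_combination (-2 * Polynomial.X * Polynomial.C (u r 2)) * hab'
    rw [map_mul, Polynomial.derivative_mul, hP, hv, Derivation.leibniz, map_add, smul_eq_mul,
      smul_eq_mul, map_mul, map_mul]
    ring

theorem eval_zero_flow (a b : ℂ) (G : PolyPair) : (flow a b G).eval 0 = G := by
  have h : ((Polynomial.aeval (0 : PolyPair)).restrictScalars ℂ).comp (flow a b) =
      AlgHom.id ℂ PolyPair := by
    apply MvPolynomial.algHom_ext
    rintro (_ | ⟨r, c⟩)
    · simp [flow]
    · fin_cases c <;> simp [flow]
  simpa [Polynomial.aeval_def] using DFunLike.congr_fun h G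

theorem iterate_derivative_flow {a b : ℂ} (hab : a * b = 0) (G : PolyPair) (n : ℕ) :
    Polynomial.derivative^[n] (flow a b G) =
      flow a b (((der a b : Module.End ℂ PolyPair) ^ n) G) := by
  induction n with
  | zero => simp
  | succ n ih =>
    rw [Function.iterate_succ_apply', ih, derivative_flow hab, pow_succ']
    rfl

/-- Iterates of the derivation are derivatives at `0` of the flow, a polynomial in the parameter. -/
theorem der_nilpotent {a b : ℂ} (hab : a * b = 0) (G : PolyPair) :
    ∃ n, ((der a b : Module.End ℂ PolyPair) ^ n) G = 0 := by
  refine ⟨(flow a b G).natDegree + 1, ?_⟩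
  rw [← eval_zero_flow a b (((der a b : Module.End ℂ PolyPair) ^ _) G),
    ← iterate_derivative_flow hab, Polynomial.iterate_derivative_eq_zero (Nat.lt_succ_self _),
    Polynomial.eval_zero]

theorem flow_eq_C {a b : ℂ} (hab : a * b = 0) {G : PolyPair} (hG : der a b G = 0) :
    flow a b G = Polynomial.C G := by
  have h1 : Polynomial.derivative (flow a b G) = 0 := by rw [derivative_flow hab, hG, map_zero]
  have h2 := Polynomial.eq_C_of_natDegree_eq_zero
    (Polynomial.derivative_eq_zero.1 h1)
  have h3 := eval_zero_flow a b G
  rw [h2, Polynomial.eval_C] at h3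
  rw [h2, h3]

theorem C_two : (C 2 : PolyPair) = 2 := map_ofNat C 2

theorem derH_monomial (m : Option (Fin 2 × Fin 3) →₀ ℕ) (c : ℂ) :
    ∃ k : ℂ, derH (monomial m c) = k • monomial m c := by
  refine MvPolynomial.induction_on_monomial (motive := fun G => ∃ k : ℂ, derH G = k • G)
    (fun c => ⟨0, by simp [derH]⟩) (fun P v hP => ?_) m c
  · obtain ⟨k, hk⟩ := hP
    have hv : ∃ l : ℂ, derH (X v) = l • X v := by
      rcases v with _ | ⟨r, c⟩
      · exact ⟨0, by simp [derH, mkDerivation_X]⟩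
      · fin_cases c
        · exact ⟨0, by simp [derH, mkDerivation_X]⟩
        · exact ⟨2, by simp [derH, mkDerivation_X, smul_eq_C_mul, C_two]⟩
        · exact ⟨-2, by simp [derH, mkDerivation_X, smul_eq_C_mul, C_two]⟩
    obtain ⟨l, hl⟩ := hv
    refine ⟨l + k, ?_⟩
    rw [Derivation.leibniz, hk, hl]
    simp only [smul_eq_C_mul, smul_eq_mul, C_add]
    ring

/-- Monomials are eigenvectors: for an eigenvalue `k ≠ 0` the polynomial `1 - X/k` serves, for `k =
0` the constant `1`. Sums are handled by products of polynomials. -/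
theorem derH_eigen (G : PolyPair) : ∃ P : Polynomial ℂ, P.eval 0 = 1 ∧
    (derH : Module.End ℂ PolyPair) (Polynomial.aeval (derH : Module.End ℂ PolyPair) P G) = 0 := by
  induction G using MvPolynomial.induction_on' with
  | monomial m c =>
    obtain ⟨k, hk⟩ := derH_monomial m c
    have hk' : (derH : Module.End ℂ PolyPair) (monomial m c) = k • monomial m c := hk
    by_cases h0 : k = 0
    · exact ⟨1, by simp, by simp [hk', h0]⟩
    · refine ⟨1 - Polynomial.C k⁻¹ * Polynomial.X, by simp, ?_⟩
      have : Polynomial.aeval (derH : Module.End ℂ PolyPair) (1 - Polynomial.C k⁻¹ * Polynomial.X)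
          (monomial m c) = 0 := by
        simp only [map_sub, map_one, map_mul, Polynomial.aeval_C, Polynomial.aeval_X,
          LinearMap.sub_apply, Module.End.one_apply, Module.End.mul_apply, hk',
          Module.algebraMap_end_apply, smul_smul, inv_mul_cancel₀ h0, one_smul, sub_self]
      rw [this, map_zero]
  | add G G' hG hG' =>
    obtain ⟨P, hP, h⟩ := hG
    obtain ⟨P', hP', h'⟩ := hG'
    refine ⟨P * P', by simp [hP, hP'], ?_⟩
    have key : ∀ (P P' : Polynomial ℂ) (G : PolyPair), (derH : Module.End ℂ PolyPair)
        (Polynomial.aeval (derH : Module.End ℂ PolyPair) P G) = 0 →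
        (derH : Module.End ℂ PolyPair)
          (Polynomial.aeval (derH : Module.End ℂ PolyPair) (P' * P) G) = 0 := by
      intro P P' G h
      have h1 : Polynomial.aeval (derH : Module.End ℂ PolyPair) (Polynomial.X * P) G = 0 := by
        simpa using h
      have h2 : Polynomial.aeval (derH : Module.End ℂ PolyPair) (Polynomial.X * (P' * P)) G = 0 := by
        rw [mul_left_comm, map_mul, Module.End.mul_apply, h1, map_zero]
      simpa using h2
    rw [map_add, map_add, key P' P G' h', mul_comm, key P P' G h, add_zero]

theorem derivation_two (D : Derivation ℂ PolyPair PolyPair) : D 2 = 0 := by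
  simpa using D.map_natCast 2

theorem derH_der_zero_one (G : PolyPair) :
    derH (der 0 1 G) = der 0 1 (derH G) + (2 : ℂ) • der 0 1 G := by
  have h : ⁅derH, der 0 1⁆ = (2 : ℂ) • der 0 1 := by
    apply derivation_ext
    rintro (_ | ⟨r, c⟩)
    · simp [derH, der, Derivation.commutator_apply, mkDerivation_X]
    · fin_cases c <;>
        simp [derH, der, Derivation.commutator_apply, mkDerivation_X, smul_eq_C_mul,
          Derivation.leibniz, derivation_two, C_two]
  have h' := DFunLike.congr_fun h G
  rw [Derivation.commutator_apply, sub_eq_iff_eq_add] at h'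
  rw [h', add_comm]; rfl

theorem derH_der_one_zero (G : PolyPair) :
    derH (der 1 0 G) = der 1 0 (derH G) - (2 : ℂ) • der 1 0 G := by
  have h : ⁅derH, der 1 0⁆ = -((2 : ℂ) • der 1 0) := by
    apply derivation_ext
    rintro (_ | ⟨r, c⟩)
    · simp [derH, der, Derivation.commutator_apply, mkDerivation_X]
    · fin_cases c <;>
        simp [derH, der, Derivation.commutator_apply, mkDerivation_X, smul_eq_C_mul,
          Derivation.leibniz, derivation_two, C_two]
  have h' := DFunLike.congr_fun h G
  rw [Derivation.commutator_apply, sub_eq_iff_eq_add] at h'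
  rw [h', sub_eq_add_neg, add_comm]; rfl

theorem der_der (G : PolyPair) : der 0 1 (der 1 0 G) = der 1 0 (der 0 1 G) + derH G := by
  have h : ⁅der 0 1, der 1 0⁆ = derH := by
    apply derivation_ext
    rintro (_ | ⟨r, c⟩)
    · simp [derH, der, Derivation.commutator_apply, mkDerivation_X]
    · fin_cases c <;>
        simp [derH, der, Derivation.commutator_apply, mkDerivation_X, Derivation.leibniz,
          derivation_two]
  rw [← h, Derivation.commutator_apply]; abel

/-- A polynomial that is invariant modulo a stable subspace is congruent to an invariant one. -/
theorem exists_invariant (K : Submodule ℂ PolyPair)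
    (hK : ∀ a b : ℂ, a * b = 0 → ∀ G ∈ K, der a b G ∈ K) {G : PolyPair}
    (hG : ∀ a b : ℂ, a * b = 0 → der a b G ∈ K) :
    ∃ G', G' - G ∈ K ∧ der 0 1 G' = 0 ∧ der 1 0 G' = 0 :=
  -- On coordinate functions brackets are reversed, so the lower triangular `N` gives the raising
  -- operator.
  exists_sl2_invariant (e := (der 0 1 : Module.End ℂ PolyPair))
    (f := (der 1 0 : Module.End ℂ PolyPair)) (h := (derH : Module.End ℂ PolyPair))
    derH_der_zero_one derH_der_one_zero der_der (der_nilpotent (zero_mul _))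
    (der_nilpotent (mul_zero _)) derH_eigen K (hK 0 1 (zero_mul _)) (hK 1 0 (mul_zero _))
    (hG 0 1 (zero_mul _)) (hG 1 0 (mul_zero _))

end PolyPair

namespace PolyPair

open MvPolynomial

/-! ### The first fundamental theorem for two traceless `2 × 2` matrices -/

/-- The value of a polynomial at a scalar and two traceless matrices. -/
def val (G : PolyPair) (c : ℂ) (w w' : Fin 3 → ℂ) : ℂ :=
  aeval (fun v : Option (Fin 2 × Fin 3) => v.elim c fun rc => ![w, w'] rc.1 rc.2) G

/-- Conjugation of a traceless matrix by `(1, t; 0, 1)`. -/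
def up (t : ℂ) (w : Fin 3 → ℂ) : Fin 3 → ℂ :=
  ![w 0 + t * w 2, w 1 - 2 * t * w 0 - t ^ 2 * w 2, w 2]

/-- Conjugation of a traceless matrix by `(1, 0; t, 1)`. -/
def low (t : ℂ) (w : Fin 3 → ℂ) : Fin 3 → ℂ :=
  ![w 0 - t * w 1, w 1, w 2 + 2 * t * w 0 - t ^ 2 * w 1]

/-- The scalar part of the product of two traceless matrices, doubled. -/
def pairing (w w' : Fin 3 → ℂ) : ℂ := 2 * w 0 * w' 0 + w 1 * w' 2 + w 2 * w' 1

theorem pairing_up (t : ℂ) (w w' : Fin 3 → ℂ) : pairing (up t w) (up t w') = pairing w w' := by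
  simp [pairing, up]; ring

theorem pairing_low (t : ℂ) (w w' : Fin 3 → ℂ) : pairing (low t w) (low t w') = pairing w w' := by
  simp [pairing, low]; ring

section Invariant

variable {G : PolyPair}

/-- Evaluating the flow at the parameter `t` is substituting the conjugated matrices, and the flow
of an infinitesimal invariant is constant. -/
theorem val_up (hG : der 1 0 G = 0) (t c : ℂ) (w w' : Fin 3 → ℂ) :
    val G c (up t w) (up t w') = val G c w w' := by
  let φ : Polynomial PolyPair →ₐ[ℂ] ℂ := Polynomial.eval₂AlgHom
    (aeval (fun v : Option (Fin 2 × Fin 3) => v.elim c fun rc => ![w, w'] rc.1 rc.2)) t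
    (fun _ => Commute.all _ _)
  have hC : ∀ H, φ (Polynomial.C H) = val H c w w' := fun H => Polynomial.eval₂_C _ _
  have hX : φ Polynomial.X = t := Polynomial.eval₂_X _ _
  have h : φ.comp (flow 1 0) = aeval (fun v : Option (Fin 2 × Fin 3) =>
      v.elim c fun rc => ![up t w, up t w'] rc.1 rc.2) := by
    apply MvPolynomial.algHom_ext
    rintro (_ | ⟨r, k⟩)
    · simp [flow, hC, val]
    · fin_cases r <;> fin_cases k <;> simp [flow, hC, hX, val, up] <;> ring
  refine (DFunLike.congr_fun h G).symm.trans ?_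
  rw [AlgHom.comp_apply, flow_eq_C (mul_zero _) hG, hC]

theorem val_low (hG : der 0 1 G = 0) (t c : ℂ) (w w' : Fin 3 → ℂ) :
    val G c (low t w) (low t w') = val G c w w' := by
  let φ : Polynomial PolyPair →ₐ[ℂ] ℂ := Polynomial.eval₂AlgHom
    (aeval (fun v : Option (Fin 2 × Fin 3) => v.elim c fun rc => ![w, w'] rc.1 rc.2)) t
    (fun _ => Commute.all _ _)
  have hC : ∀ H, φ (Polynomial.C H) = val H c w w' := fun H => Polynomial.eval₂_C _ _
  have hX : φ Polynomial.X = t := Polynomial.eval₂_X _ _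
  have h : φ.comp (flow 0 1) = aeval (fun v : Option (Fin 2 × Fin 3) =>
      v.elim c fun rc => ![low t w, low t w'] rc.1 rc.2) := by
    apply MvPolynomial.algHom_ext
    rintro (_ | ⟨r, k⟩)
    · simp [flow, hC, val]
    · fin_cases r <;> fin_cases k <;>
        simp [flow, hC, hX, val, low] <;> ring
  refine (DFunLike.congr_fun h G).symm.trans ?_
  rw [AlgHom.comp_apply, flow_eq_C (zero_mul _) hG, hC]

/-- The three unipotent matrices multiply to the Weyl element `(0, l; -l⁻¹, 0)`. -/
theorem up_low_up {l : ℂ} (hl : l ≠ 0) (w : Fin 3 → ℂ) :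
    up l (low (-l⁻¹) (up l w)) = ![-w 0, -l ^ 2 * w 2, -(l ^ 2)⁻¹ * w 1] := by
  ext k
  fin_cases k <;> simp [up, low] <;> field_simp <;> ring

/-- The Weyl elements with parameters `l` and `1` have a diagonal product, so invariance under the
torus follows from the two unipotent groups. -/
theorem val_torus (hE : der 1 0 G = 0) (hF : der 0 1 G = 0) {l : ℂ} (hl : l ≠ 0) (c : ℂ)
    (w w' : Fin 3 → ℂ) :
    val G c ![w 0, l ^ 2 * w 1, (l ^ 2)⁻¹ * w 2] ![w' 0, l ^ 2 * w' 1, (l ^ 2)⁻¹ * w' 2] =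
      val G c w w' := by
  have h : ∀ {l : ℂ} (_ : l ≠ 0) (w w' : Fin 3 → ℂ),
      val G c ![-w 0, -l ^ 2 * w 2, -(l ^ 2)⁻¹ * w 1] ![-w' 0, -l ^ 2 * w' 2, -(l ^ 2)⁻¹ * w' 1] =
        val G c w w' := by
    intro l hl w w'
    rw [← up_low_up hl, ← up_low_up hl, val_up hE, val_low hF, val_up hE]
  have hl2 : l ^ 2 ≠ 0 := pow_ne_zero 2 hl
  rw [← h one_ne_zero w w', ← h hl]
  congr 1 <;> · ext k; fin_cases k <;>
    simp [mul_inv_cancel_left₀ hl2, inv_mul_cancel_left₀ hl2]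

theorem val_scale (hE : der 1 0 G = 0) (hF : der 0 1 G = 0) {y : ℂ} (hy : y ≠ 0)
    (c m n z : ℂ) : val G c ![m, y, 0] ![n, 0, z] = val G c ![m, 1, 0] ![n, 0, y * z] := by
  obtain ⟨l, rfl⟩ : ∃ l : ℂ, l ^ 2 = y := IsAlgClosed.exists_pow_nat_eq y two_pos
  have hl : l ≠ 0 := by rintro rfl; simp at hy
  rw [← val_torus hE hF hl c ![m, 1, 0]]
  congr 1 <;> · ext k; fin_cases k <;> simp [hl]

end Invariant

/-- The restriction of a polynomial to the slice of pairs `(m, 1; 0, -m)`, `(n, 0; z, -n)`, in the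
coordinates `x, m, n` and `τ = 2 m n + z`. -/
def slice : PolyPair →ₐ[ℂ] MvPolynomial (Fin 4) ℂ :=
  aeval fun v => v.elim (X 0) fun rc =>
    ![![X 1, 1, 0], ![X 2, 0, X 3 - 2 * X 1 * X 2]] rc.1 rc.2

theorem eval_slice (G : PolyPair) (y : Fin 4 → ℂ) :
    aeval y (slice G) = val G (y 0) ![y 1, 1, 0] ![y 2, 0, y 3 - 2 * y 1 * y 2] := by
  have h : (aeval y).comp slice = aeval (fun v : Option (Fin 2 × Fin 3) => v.elim (y 0)
      fun rc => ![![y 1, 1, 0], ![y 2, 0, y 3 - 2 * y 1 * y 2]] rc.1 rc.2) := by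
    apply MvPolynomial.algHom_ext
    rintro (_ | ⟨r, k⟩)
    · simp [slice]
    · fin_cases r <;> fin_cases k <;> simp [slice]
  exact DFunLike.congr_fun h G

/-- The substitution `X₁ ↦ -X₁`. -/
def neg1 : MvPolynomial (Fin 4) ℂ →ₐ[ℂ] MvPolynomial (Fin 4) ℂ := aeval ![X 0, -X 1, X 2, X 3]

/-- The substitution `X₂ ↦ -X₂`. -/
def neg2 : MvPolynomial (Fin 4) ℂ →ₐ[ℂ] MvPolynomial (Fin 4) ℂ := aeval ![X 0, X 1, -X 2, X 3]

/-- The substitution `X₁ ↦ X₁²`, `X₂ ↦ X₂²`. -/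
def sqSubst : MvPolynomial (Fin 4) ℂ →ₐ[ℂ] MvPolynomial (Fin 4) ℂ :=
  aeval ![X 0, X 1 ^ 2, X 2 ^ 2, X 3]

theorem aeval_neg1 (P : MvPolynomial (Fin 4) ℂ) (y : Fin 4 → ℂ) :
    aeval y (neg1 P) = aeval ![y 0, -y 1, y 2, y 3] P := by
  have h : (aeval y).comp neg1 = aeval ![y 0, -y 1, y 2, y 3] := by
    apply MvPolynomial.algHom_ext
    intro k
    fin_cases k <;> simp [neg1]
  exact DFunLike.congr_fun h P

theorem aeval_neg2 (P : MvPolynomial (Fin 4) ℂ) (y : Fin 4 → ℂ) :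
    aeval y (neg2 P) = aeval ![y 0, y 1, -y 2, y 3] P := by
  have h : (aeval y).comp neg2 = aeval ![y 0, y 1, -y 2, y 3] := by
    apply MvPolynomial.algHom_ext
    intro k
    fin_cases k <;> simp [neg2]
  exact DFunLike.congr_fun h P

theorem aeval_sqSubst (P : MvPolynomial (Fin 4) ℂ) (y : Fin 4 → ℂ) :
    aeval y (sqSubst P) = aeval ![y 0, y 1 ^ 2, y 2 ^ 2, y 3] P := by
  have h : (aeval y).comp sqSubst = aeval ![y 0, y 1 ^ 2, y 2 ^ 2, y 3] := by
    apply MvPolynomial.algHom_ext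
    intro k
    fin_cases k <;> simp [sqSubst]
  exact DFunLike.congr_fun h P

/-- Summing over both sign changes kills monomials with an odd exponent of `X₁` or `X₂` and
multiplies the others by `4`. -/
theorem symmetrize_mem_range (P : MvPolynomial (Fin 4) ℂ) :
    P + neg1 P + neg2 (P + neg1 P) ∈ sqSubst.range := by
  induction P using MvPolynomial.induction_on' with
  | add P P' h h' =>
    have := add_mem h h'
    rw [map_add, add_add_add_comm P P', map_add]
    convert this using 1
    ring
  | monomial m c =>
    have hm : monomial m c = C c * (X 0 ^ m 0 * X 1 ^ m 1 * X 2 ^ m 2 * X 3 ^ m 3) := by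
      rw [monomial_eq, Finsupp.prod_fintype _ _ (fun _ => pow_zero _), Fin.prod_univ_four]
    have h1 : neg1 (C c) = C c := AlgHom.commutes _ c
    have h2 : neg2 (C c) = C c := AlgHom.commutes _ c
    have hs : sqSubst (C c) = C c := AlgHom.commutes _ c
    rw [hm]
    simp only [map_add, map_mul, map_pow, h1, h2]
    simp only [neg1, neg2, aeval_X]
    simp only [Matrix.cons_val, map_neg, aeval_X]
    rcases Nat.even_or_odd (m 1) with ⟨k, hk⟩ | h1
    · rcases Nat.even_or_odd (m 2) with ⟨l, hl⟩ | h2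
      · refine ⟨4 * (C c * (X 0 ^ m 0 * X 1 ^ k * X 2 ^ l * X 3 ^ m 3)), ?_⟩
        change sqSubst _ = _
        rw [hk, hl, (Even.neg_pow ⟨k, rfl⟩ _), (Even.neg_pow ⟨l, rfl⟩ _)]
        simp only [map_mul, map_pow, hs, map_ofNat]
        simp only [sqSubst, aeval_X]
        simp only [Matrix.cons_val]
        ring
      · rw [h2.neg_pow]
        convert sqSubst.range.zero_mem using 1
        ring
    · rw [h1.neg_pow]
      convert sqSubst.range.zero_mem using 1
      ring

theorem mem_range_sqSubst {P : MvPolynomial (Fin 4) ℂ} (h1 : neg1 P = P) (h2 : neg2 P = P) :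
    ∃ P', sqSubst P' = P := by
  obtain ⟨P', hP'⟩ := symmetrize_mem_range P
  rw [h1, map_add, h2] at hP'
  refine ⟨(4 : ℂ)⁻¹ • P', ?_⟩
  rw [map_smul]
  rw [show sqSubst P' = (4 : ℂ) • P from hP'.trans (by module), smul_smul,
    inv_mul_cancel₀ (by norm_num), one_smul]

section Invariant

variable {G : PolyPair} (hE : der 1 0 G = 0) (hF : der 0 1 G = 0)

-- Conjugation by `(1, 0; 2m, 1)` maps the slice to itself, with `m ↦ -m` and `n`, `τ` fixed.
include hF in
theorem neg1_slice : neg1 (slice G) = slice G := by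
  apply MvPolynomial.funext
  intro y
  change aeval y _ = aeval y _
  rw [aeval_neg1, eval_slice, eval_slice, ← val_low hF (2 * y 1) _ ![y 1, 1, 0]]
  congr 1 <;> · ext k; fin_cases k <;> simp [low] <;> ring

-- The torus moves the corner `z` to the first matrix, so that the second is `(n, 0; 1, -n)`.
-- Conjugation by `(1, -2n; 0, 1)` then replaces `n` by `-n` and the corner by `z + 4mn`, which
-- fixes `τ`.
include hE hF in
theorem neg2_slice : neg2 (slice G) = slice G := by
  have key : ∀ c m n z : ℂ, z ≠ 0 → z + 4 * m * n ≠ 0 →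
      val G c ![m, 1, 0] ![n, 0, z] = val G c ![m, 1, 0] ![-n, 0, z + 4 * m * n] := by
    intro c m n z hz hz'
    have h1 := val_scale hE hF hz c m n 1
    have h2 := val_scale hE hF hz' c m (-n) 1
    rw [mul_one] at h1 h2
    rw [← h1, ← h2, ← val_up hE (-2 * n)]
    congr 1 <;> · ext k; fin_cases k <;> simp [up] <;> ring
  -- Moving the corners requires `z` and `z + 4mn` to be nonzero; in the slice coordinates these are
  -- the two factors, cancelled afterwards in the domain.
  have hprod : (neg2 (slice G) - slice G) *
      ((X 3 - 2 * X 1 * X 2) * (X 3 + 2 * X 1 * X 2)) = 0 := by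
    apply MvPolynomial.funext
    intro y
    change aeval y _ = aeval y _
    rw [map_mul, map_sub, aeval_neg2, eval_slice, eval_slice]
    simp only [map_mul, map_sub, map_add, aeval_X, map_ofNat, map_zero, mul_eq_zero]
    by_cases hz : y 3 - 2 * y 1 * y 2 = 0
    · exact Or.inr (Or.inl hz)
    by_cases hz' : y 3 + 2 * y 1 * y 2 = 0
    · exact Or.inr (Or.inr hz')
    left
    rw [key (y 0) (y 1) (y 2) _ hz (by convert hz' using 1; ring), sub_eq_zero]
    congr 1
    ext k; fin_cases k <;> simp
    ring
  have hne : ∀ a : ℂ, (X 3 + C a * X 1 * X 2 : MvPolynomial (Fin 4) ℂ) ≠ 0 := by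
    intro a h
    have := congrArg (aeval (![0, 0, 0, 1] : Fin 4 → ℂ)) h
    simp at this
  rw [mul_eq_zero] at hprod
  refine sub_eq_zero.1 (hprod.resolve_right (mul_ne_zero ?_ ?_))
  · convert hne (-2) using 1
    rw [C_neg, map_ofNat C 2]
    ring
  · simpa only [map_ofNat C 2] using hne 2

/-- The invariants `x`, `I = -det M`, `J = -det M'` and `tr(M M')` of a pair of matrices. -/
def invSubst : MvPolynomial (Fin 4) ℂ →ₐ[ℂ] PolyPair :=
  aeval ![s, u 0 0 ^ 2 + u 0 1 * u 0 2, u 1 0 ^ 2 + u 1 1 * u 1 2,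
    2 * u 0 0 * u 1 0 + u 0 1 * u 1 2 + u 0 2 * u 1 1]

/-- Minus the determinant of a traceless matrix. -/
def negDet (w : Fin 3 → ℂ) : ℂ := w 0 ^ 2 + w 1 * w 2

omit hE hF in
theorem val_invSubst (P : MvPolynomial (Fin 4) ℂ) (c : ℂ) (w w' : Fin 3 → ℂ) :
    val (invSubst P) c w w' = aeval ![c, negDet w, negDet w', pairing w w'] P := by
  have h : (aeval (fun v : Option (Fin 2 × Fin 3) => v.elim c fun rc => ![w, w'] rc.1 rc.2)).comp
      invSubst = aeval ![c, negDet w, negDet w', pairing w w'] := by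
    apply MvPolynomial.algHom_ext
    intro k
    fin_cases k <;> simp [invSubst, negDet, pairing]
  exact DFunLike.congr_fun h P

omit hE hF in
theorem negDet_up (t : ℂ) (w : Fin 3 → ℂ) : negDet (up t w) = negDet w := by
  simp [negDet, up]; ring

omit hE hF in
theorem negDet_low (t : ℂ) (w : Fin 3 → ℂ) : negDet (low t w) = negDet w := by
  simp [negDet, low]; ring

include hE hF in
/-- A generic pair of traceless matrices can be moved to the slice. -/
theorem exists_slice_point (c : ℂ) (w w' : Fin 3 → ℂ) (hw : w 1 ≠ 0)
    (hd : pairing w w' ^ 2 - 4 * negDet w * negDet w' ≠ 0) :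
    ∃ m n z : ℂ, val G c w w' = val G c ![m, 1, 0] ![n, 0, z] ∧ negDet w = m ^ 2 ∧
      negDet w' = n ^ 2 ∧ pairing w w' = 2 * m * n + z := by
  -- The parameter `(w 0 + r) / w 1` is a root of the quadratic equation that clears the lower left
  -- entry; `r²` is its reduced discriminant.
  obtain ⟨r, hr⟩ : ∃ r : ℂ, r ^ 2 = negDet w := IsAlgClosed.exists_pow_nat_eq _ two_pos
  obtain ⟨v, hv⟩ : ∃ v, v = low ((w 0 + r) / w 1) w := ⟨_, rfl⟩
  obtain ⟨v', hv'⟩ : ∃ v', v' = low ((w 0 + r) / w 1) w' := ⟨_, rfl⟩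
  have hval : val G c w w' = val G c v v' := by rw [hv, hv', val_low hF]
  have hp : pairing w w' = pairing v v' := by rw [hv, hv', pairing_low]
  have hD : negDet w = negDet v := by rw [hv, negDet_low]
  have hD' : negDet w' = negDet v' := by rw [hv', negDet_low]
  have hv2 : v 2 = 0 := by
    rw [negDet] at hr
    simp only [hv, low, Matrix.cons_val]
    field_simp
    linear_combination -hr
  rw [hp, hD, hD'] at hd
  rw [hval, hD, hD', hp]
  -- Otherwise both matrices would be upper triangular, and then the discriminant in `hd` vanishes.
  have hz : v' 2 ≠ 0 := by
    intro h
    apply hd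
    simp only [pairing, negDet, hv2, h]
    ring
  obtain ⟨r', hr'⟩ : ∃ r : ℂ, r ^ 2 = negDet v' := IsAlgClosed.exists_pow_nat_eq _ two_pos
  obtain ⟨y, hy⟩ : ∃ y, y = up ((r' - v' 0) / v' 2) v := ⟨_, rfl⟩
  obtain ⟨y', hy'⟩ : ∃ y', y' = up ((r' - v' 0) / v' 2) v' := ⟨_, rfl⟩
  have hval' : val G c v v' = val G c y y' := by rw [hy, hy', val_up hE]
  have hp' : pairing v v' = pairing y y' := by rw [hy, hy', pairing_up]
  have hN : negDet v = negDet y := by rw [hy, negDet_up]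
  have hN' : negDet v' = negDet y' := by rw [hy', negDet_up]
  have hy2 : y 2 = 0 := by rw [hy]; simpa [up] using hv2
  have hy1 : y' 1 = 0 := by
    rw [negDet] at hr'
    simp only [hy', up, Matrix.cons_val]
    field_simp
    linear_combination -hr'
  rw [hp', hN, hN'] at hd
  have hy0 : y 1 ≠ 0 := by
    intro h
    apply hd
    simp only [pairing, negDet, hy2, hy1, h]
    ring
  refine ⟨y 0, y' 0, y 1 * y' 2, ?_, ?_, ?_, ?_⟩
  · rw [hval', ← val_scale hE hF hy0]
    congr 1 <;> · ext k; fin_cases k <;> simp [hy2, hy1]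
  · rw [hN, negDet, hy2]; ring
  · rw [hN', negDet, hy1]; ring
  · rw [hp', pairing, hy2]; ring

include hE hF in
/-- The first fundamental theorem: invariants of two traceless matrices are polynomials in the
traces. -/
theorem exists_eq_invSubst : ∃ P, G = invSubst P := by
  obtain ⟨P, hP⟩ := mem_range_sqSubst (neg1_slice hF) (neg2_slice hE hF)
  refine ⟨P, ?_⟩
  -- On the slice, `G` is `P` evaluated at `m²`, `n²` and `τ`, the invariants of the pair. Generic
  -- pairs can be moved to the slice; the extra factor vanishes on the others.
  have hprod : (G - invSubst P) * (u 0 1 * invSubst (X 3 ^ 2 - 4 * X 1 * X 2)) = 0 := by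
    apply MvPolynomial.funext
    intro y
    have hy : y = fun v : Option (Fin 2 × Fin 3) => v.elim (y none)
        fun rc => ![fun k => y (some (0, k)), fun k => y (some (1, k))] rc.1 rc.2 := by
      ext v
      rcases v with _ | ⟨r, k⟩
      · rfl
      · fin_cases r <;> rfl
    rw [hy]
    generalize y none = c
    generalize (fun k => y (some (0, k))) = w
    generalize (fun k => y (some (1, k))) = w'
    change val _ c w w' = val _ c w w'
    have hmul : ∀ A B : PolyPair, val (A * B) c w w' = val A c w w' * val B c w w' :=
      fun A B => map_mul _ A B
    have hsub : ∀ A B : PolyPair, val (A - B) c w w' = val A c w w' - val B c w w' :=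
      fun A B => map_sub _ A B
    have hu : val (u 0 1) c w w' = w 1 := by simp [val]
    have h0 : val 0 c w w' = 0 := map_zero _
    rw [hmul, hmul, hsub, hu, h0, val_invSubst, val_invSubst]
    by_cases hw : w 1 = 0
    · rw [hw, zero_mul, mul_zero]
    by_cases hd : pairing w w' ^ 2 - 4 * negDet w * negDet w' = 0
    · have : aeval ![c, negDet w, negDet w', pairing w w']
          (X 3 ^ 2 - 4 * X 1 * X 2 : MvPolynomial (Fin 4) ℂ) = 0 := by
        simpa using hd
      rw [this, mul_zero, mul_zero]
    obtain ⟨m, n, z, h1, h2, h3, h4⟩ := exists_slice_point hE hF c w w' hw hd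
    have h5 := eval_slice G ![c, m, n, 2 * m * n + z]
    rw [← hP, aeval_sqSubst] at h5
    have h6 : aeval ![c, negDet w, negDet w', pairing w w'] P = val G c w w' := by
      rw [h1, h2, h3, h4]
      simpa using h5
    rw [h6, sub_self, zero_mul]
  have hne : u 0 1 * invSubst (X 3 ^ 2 - 4 * X 1 * X 2) ≠ 0 := by
    intro h
    have h1 : val (u 0 1 * invSubst (X 3 ^ 2 - 4 * X 1 * X 2)) 0 ![0, 1, 0] ![0, 0, 1] = 0 := by
      rw [h]; exact map_zero _
    have h2 : val (u 0 1 * invSubst (X 3 ^ 2 - 4 * X 1 * X 2)) 0 ![0, 1, 0] ![0, 0, 1] =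
      val (u 0 1) 0 ![0, 1, 0] ![0, 0, 1] *
        val (invSubst (X 3 ^ 2 - 4 * X 1 * X 2)) 0 ![0, 1, 0] ![0, 0, 1] := map_mul _ _ _
    rw [h2, val_invSubst] at h1
    simp [val, pairing, negDet] at h1
  exact sub_eq_zero.1 ((mul_eq_zero.1 hprod).resolve_right hne)

end Invariant

end PolyPair

open PolyXJ

/-! ### Conjugation on the representation scheme -/

section Conj

variable {π : Type} [Group π] {B : Type*} [CommRing B] [Algebra ℂ B]

theorem evalMat_conj (ρ : π →* Matrix.SpecialLinearGroup (Fin 2) B)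
    (U : Matrix.SpecialLinearGroup (Fin 2) B) (z : BH π) :
    evalMat ((MulAut.conj U).toMonoidHom.comp ρ) z =
      (U : Matrix (Fin 2) (Fin 2) B) * evalMat ρ z * (U⁻¹ : Matrix.SpecialLinearGroup (Fin 2) B) := by
  induction z using BH.induction with
  | of g => rw [evalMat_of, evalMat_of]; rfl
  | add a b ha hb => rw [map_add, map_add, ha, hb, mul_add, add_mul]
  | smul c a ha => rw [map_smul, map_smul, ha, mul_smul_comm, smul_mul_assoc]

theorem evalMat_univRep (z : BH π) : evalMat (univRep π) z = BH.toMat π z := by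
  induction z using BH.induction with
  | of g => rw [evalMat_of, toMat_of]; rfl
  | add a b ha hb => rw [map_add, map_add, ha, hb]
  | smul c a ha => rw [map_smul, map_smul, ha]

theorem repRing_algHom_ext {A : Type*} [CommRing A] [Algebra ℂ A] {φ ψ : RepRing π →ₐ[ℂ] A}
    (h : ∀ g i j, φ (genMat π g i j) = ψ (genMat π g i j)) : φ = ψ := by
  apply Ideal.Quotient.algHom_ext
  apply MvPolynomial.algHom_ext
  rintro ⟨g, i, j⟩
  exact h g i j

/-- The inverse of a matrix of determinant one is its adjugate, and the adjugate of a `2 × 2` matrix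
is linear in it. -/
theorem toMat_inv (z : BH π) : BH.toMat π (BH.inv z) = (BH.toMat π z).adjugate := by
  induction z using BH.induction with
  | of g =>
    rw [BH.inv_of, toMat_of, toMat_of]
    exact (congrArg Subtype.val (map_inv (univRep π) g)).trans
      (Matrix.SpecialLinearGroup.coe_inv _)
  | add a b ha hb =>
    rw [BH.inv_add, map_add, map_add, ha, hb]
    ext i j
    fin_cases i <;> fin_cases j <;> simp [Matrix.adjugate_fin_two, add_comm]
  | smul c a ha =>
    rw [BH.inv_smul, map_smul, map_smul, ha]
    ext i j
    fin_cases i <;> fin_cases j <;> simp [Matrix.adjugate_fin_two]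

theorem eq_zero_of_eq_neg {v : B} (h : v = -v) : v = 0 := by
  have h1 : (2 : ℂ) • v = 0 := by rw [two_smul]; nth_rw 1 [h]; exact neg_add_cancel v
  have h2 : v = (2⁻¹ : ℂ) • (2 : ℂ) • v := by rw [smul_smul, inv_mul_cancel₀ two_ne_zero, one_smul]
  rw [h2, h1, smul_zero]

theorem toMat_traceless {z : BH π} (hz : BH.inv z = -z) :
    BH.toMat π z 1 1 = -BH.toMat π z 0 0 := by
  have h := toMat_inv z
  rw [hz, map_neg, Matrix.adjugate_fin_two] at h
  have := congrFun (congrFun h 0) 0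
  simpa using this.symm

/-- A `2 × 2` matrix that equals its adjugate is scalar, since `2` is invertible. -/
theorem toMat_plus (z : BHplus π) :
    BH.toMat π z = Matrix.scalar (Fin 2) (BH.toMat π z 0 0) := by
  have h := toMat_inv (z : BH π)
  have hz : BH.inv (z : BH π) = z := z.2
  rw [hz, Matrix.adjugate_fin_two] at h
  have h00 := congrFun (congrFun h 0) 0
  have h01 := congrFun (congrFun h 0) 1
  have h10 := congrFun (congrFun h 1) 0
  simp only [Matrix.of_apply, Matrix.cons_val] at h00 h01 h10
  have e01 := eq_zero_of_eq_neg h01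
  have e10 := eq_zero_of_eq_neg h10
  ext i j
  fin_cases i <;> fin_cases j <;> simp [e01, e10, ← h00]

variable (π) in
/-- The map `BH⁺ → O(Rep(π, SL₂))`. -/
def plusToRep : BHplus π →ₐ[ℂ] RepRing π where
  toFun z := BH.toMat π z 0 0
  map_one' := by simp
  map_zero' := by simp
  map_add' a b := by simp
  map_mul' a b := by
    change BH.toMat π (a * b) 0 0 = _
    rw [map_mul, toMat_plus a, Matrix.scalar_apply, Matrix.diagonal_mul]
    simp
  commutes' c := by
    change BH.toMat π (algebraMap ℂ _ c) 0 0 = _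
    rw [AlgHom.commutes, Matrix.algebraMap_matrix_apply, if_pos rfl]

theorem toMat_plus_eq (z : BHplus π) :
    BH.toMat π z = Matrix.scalar (Fin 2) (plusToRep π z) := toMat_plus z

omit [Algebra ℂ B] in
theorem coe_mul_scalar_mul_inv (U : Matrix.SpecialLinearGroup (Fin 2) B) (r : B) :
    (U : Matrix (Fin 2) (Fin 2) B) * Matrix.scalar (Fin 2) r *
      (U⁻¹ : Matrix.SpecialLinearGroup (Fin 2) B) = Matrix.scalar (Fin 2) r := by
  rw [← (Matrix.scalar_commute r (fun _ => Commute.all _ _) _).eq, mul_assoc,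
    ← Matrix.SpecialLinearGroup.coe_mul, mul_inv_cancel, Matrix.SpecialLinearGroup.coe_one, mul_one]

theorem plusToRep_mem (z : BHplus π) : plusToRep π z ∈ charRing π := by
  intro g
  have h := evalMat_conj (univRep π)
    ((Matrix.SpecialLinearGroup.map (algebraMap ℂ (RepRing π)) g)⁻¹) z
  rw [evalMat_univRep, toMat_plus_eq, coe_mul_scalar_mul_inv] at h
  have h1 : conjAct π g (BH.toMat π z 0 0) = Matrix.scalar (Fin 2) (plusToRep π z) 0 0 :=
    congrFun (congrFun h 0) 0
  rw [Matrix.scalar_apply, Matrix.diagonal_apply_eq] at h1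
  exact h1

/-- The ring `A` need not be a domain; linear functionals on it reduce the claim to complex
polynomials, which vanish when all their values do. -/
theorem poly_eq_zero_of_eval {A : Type*} [CommRing A] [Algebra ℂ A] {P : Polynomial A}
    (h : ∀ c : ℂ, P.eval (algebraMap ℂ A c) = 0) : P = 0 := by
  ext n
  rw [Polynomial.coeff_zero, ← Module.forall_dual_apply_eq_zero_iff ℂ]
  intro ℓ
  by_cases hn : n < P.natDegree + 1
  · have hq : ∑ i ∈ Finset.range (P.natDegree + 1),
        Polynomial.C (ℓ (P.coeff i)) * Polynomial.X ^ i = 0 := by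
      apply Polynomial.funext
      intro c
      have h1 := congrArg ℓ (h c)
      rw [Polynomial.eval_eq_sum_range, map_sum, map_zero] at h1
      rw [Polynomial.eval_finsetSum, Polynomial.eval_zero, ← h1]
      refine Finset.sum_congr rfl fun i _ => ?_
      rw [← map_pow, mul_comm (P.coeff i), ← Algebra.smul_def, map_smul]
      rw [Polynomial.eval_mul, Polynomial.eval_C, Polynomial.eval_pow, Polynomial.eval_X, mul_comm,
        smul_eq_mul]
    have h2 := congrArg (Polynomial.coeff · n) hq
    simpa [Polynomial.finsetSum_coeff, Polynomial.coeff_C_mul, Polynomial.coeff_X_pow, hn,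
      Nat.lt_succ_iff] using h2
  · rw [Polynomial.coeff_eq_zero_of_natDegree_lt (by omega), map_zero]

/-- The matrix `(1, t a; t b, 1)`. -/
def flowSL {a b : ℂ} (hab : a * b = 0) (t : B) : Matrix.SpecialLinearGroup (Fin 2) B :=
  ⟨!![1, t * algebraMap ℂ B a; t * algebraMap ℂ B b, 1], by
    rw [Matrix.det_fin_two_of]
    have : algebraMap ℂ B a * algebraMap ℂ B b = 0 := by rw [← map_mul, hab, map_zero]
    linear_combination -(t ^ 2) * this⟩

/-- Conjugation of a representation by the generic matrix `(1, X a; X b, 1)`. -/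
def flowRep {a b : ℂ} (hab : a * b = 0) (ρ : π →* Matrix.SpecialLinearGroup (Fin 2) B) :
    π →* Matrix.SpecialLinearGroup (Fin 2) (Polynomial B) :=
  (MulAut.conj (flowSL hab Polynomial.X)).toMonoidHom.comp
    ((Matrix.SpecialLinearGroup.map Polynomial.C).comp ρ)

theorem evalMat_comp (φ : B →+* Polynomial B) (hφ : ∀ (c : ℂ) (b : B), φ (c • b) = c • φ b)
    (ρ : π →* Matrix.SpecialLinearGroup (Fin 2) B) (z : BH π) :
    evalMat ((Matrix.SpecialLinearGroup.map φ).comp ρ) z = (evalMat ρ z).map φ := by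
  induction z using BH.induction with
  | of g => rw [evalMat_of, evalMat_of]; rfl
  | add a b ha hb =>
    rw [map_add, map_add, ha, hb]
    ext i j : 2
    simp
  | smul c a ha =>
    rw [map_smul, map_smul, ha]
    ext i j : 2
    simp [hφ]

theorem evalMat_flowRep {a b : ℂ} (hab : a * b = 0) (ρ : π →* Matrix.SpecialLinearGroup (Fin 2) B)
    (z : BH π) : evalMat (flowRep hab ρ) z =
      !![1, Polynomial.X * algebraMap ℂ _ a; Polynomial.X * algebraMap ℂ _ b, 1] *
      (evalMat ρ z).map Polynomial.C *
      !![1, -(Polynomial.X * algebraMap ℂ _ a); -(Polynomial.X * algebraMap ℂ _ b), 1] := by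
  have h := evalMat_conj ((Matrix.SpecialLinearGroup.map Polynomial.C).comp ρ)
    (flowSL hab Polynomial.X) z
  rw [evalMat_comp _ (fun c b => (Polynomial.smul_C c b).symm),
    Matrix.SpecialLinearGroup.coe_inv] at h
  refine h.trans ?_
  congr 1
  exact Matrix.adjugate_fin_two_of _ _ _ _

theorem eval_flow_matrix (M : Matrix (Fin 2) (Fin 2) B) (a b c : ℂ) (i j : Fin 2) :
    ((!![1, Polynomial.X * algebraMap ℂ (Polynomial B) a;
        Polynomial.X * algebraMap ℂ (Polynomial B) b, 1] * M.map Polynomial.C *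
      !![1, -(Polynomial.X * algebraMap ℂ (Polynomial B) a);
        -(Polynomial.X * algebraMap ℂ (Polynomial B) b), 1] :
          Matrix (Fin 2) (Fin 2) (Polynomial B)) i j).eval (algebraMap ℂ B c) =
    (!![1, algebraMap ℂ B (c * a); algebraMap ℂ B (c * b), 1] * M *
      !![1, -algebraMap ℂ B (c * a); -algebraMap ℂ B (c * b), 1] :
        Matrix (Fin 2) (Fin 2) B) i j := by
  simp only [Matrix.mul_apply, Fin.sum_univ_two, Matrix.map_apply]
  fin_cases i <;> fin_cases j <;>
    simp [Polynomial.algebraMap_apply] <;> ring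

theorem coe_map_flowSL {a b : ℂ} (hab : a * b = 0) (c : ℂ) :
    (Matrix.SpecialLinearGroup.map (algebraMap ℂ B) (flowSL hab c) : Matrix (Fin 2) (Fin 2) B) =
      !![1, algebraMap ℂ B (c * a); algebraMap ℂ B (c * b), 1] := by
  refine (Matrix.SpecialLinearGroup.map_apply_coe _ _).trans ?_
  ext i j
  fin_cases i <;> fin_cases j <;> simp [flowSL]

variable (π) in
/-- Conjugation of the universal representation by the generic matrix `(1, X a; X b, 1)`. -/
def repFlow {a b : ℂ} (hab : a * b = 0) : RepRing π →ₐ[ℂ] Polynomial (RepRing π) :=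
  repLift (B := Polynomial (RepRing π)) (flowRep hab (univRep π))

theorem repFlow_toMat {a b : ℂ} (hab : a * b = 0) (z : BH π) (i j : Fin 2) :
    repFlow π hab (BH.toMat π z i j) =
      (!![1, Polynomial.X * algebraMap ℂ _ a; Polynomial.X * algebraMap ℂ _ b, 1] *
      (BH.toMat π z).map Polynomial.C *
      !![1, -(Polynomial.X * algebraMap ℂ _ a); -(Polynomial.X * algebraMap ℂ _ b), 1] :
        Matrix (Fin 2) (Fin 2) (Polynomial (RepRing π))) i j := by
  rw [← evalMat_univRep, ← evalMat_flowRep, evalMat_univRep]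
  rfl

theorem map_inv_inv {G H : Type*} [Group G] [Group H] (f : G →* H) (g : G) : (f g⁻¹)⁻¹ = f g := by
  rw [map_inv, inv_inv]

theorem conjAct_inv (g : Matrix.SpecialLinearGroup (Fin 2) ℂ) :
    conjAct π g⁻¹ = repLift ((MulAut.conj (Matrix.SpecialLinearGroup.map
      (algebraMap ℂ (RepRing π)) g)).toMonoidHom.comp (univRep π)) :=
  congrArg (fun U => repLift ((MulAut.conj U).toMonoidHom.comp (univRep π)))
    (map_inv_inv (Matrix.SpecialLinearGroup.map (algebraMap ℂ (RepRing π))) g)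

/-- At a complex parameter the generic conjugation becomes that by a complex matrix; the inverse
appears because `conjAct` uses `g⁻¹ ρ g`. -/
theorem eval_repFlow_toMat {a b : ℂ} (hab : a * b = 0) (c : ℂ) (z : BH π) (i j : Fin 2) :
    (repFlow π hab (BH.toMat π z i j)).eval (algebraMap ℂ (RepRing π) c) =
      conjAct π (flowSL hab c)⁻¹ (BH.toMat π z i j) := by
  have h2 := evalMat_conj (univRep π)
      (Matrix.SpecialLinearGroup.map (algebraMap ℂ (RepRing π)) (flowSL hab c)) z
  rw [evalMat_univRep, Matrix.SpecialLinearGroup.coe_inv, coe_map_flowSL,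
    Matrix.adjugate_fin_two_of] at h2
  rw [repFlow_toMat, eval_flow_matrix, conjAct_inv]
  exact (congrFun (congrFun h2 i) j).symm

/-- Invariance under the complex points of a unipotent group gives invariance with a polynomial
parameter, as the difference vanishes at every complex value. -/
theorem repFlow_of_mem_charRing {a b : ℂ} (hab : a * b = 0) {f : RepRing π} (hf : f ∈ charRing π) :
    repFlow π hab f = Polynomial.C f := by
  rw [← sub_eq_zero]
  apply poly_eq_zero_of_eval
  intro c
  let φ : Polynomial (RepRing π) →ₐ[ℂ] RepRing π :=
    (Polynomial.aeval (algebraMap ℂ (RepRing π) c)).restrictScalars ℂ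
  have hφ' : ∀ P, φ P = P.eval (algebraMap ℂ (RepRing π) c) := fun P =>
    congrFun (Polynomial.coe_aeval_eq_eval _) P
  have hφ : φ.comp (repFlow π hab) = conjAct π (flowSL hab c)⁻¹ := by
    apply repRing_algHom_ext
    intro g i j
    have h1 := eval_repFlow_toMat hab c (BH.of π g) i j
    rw [toMat_of] at h1
    exact (hφ' _).trans h1
  have h := DFunLike.congr_fun hφ f
  rw [hf, AlgHom.comp_apply, hφ'] at h
  rw [Polynomial.eval_sub, Polynomial.eval_C, h, sub_self]

end Conj

open PolyXJ

/-! ### The character ring of a two-bridge knot -/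

section CharRing

variable (p : ℕ) (q : ℤ)

/-- The entries of a traceless matrix. -/
def entries {B : Type*} (M : Matrix (Fin 2) (Fin 2) B) : Fin 3 → B := ![M 0 0, M 0 1, M 1 0]

/-- The images of `i` and `j` over the coordinate ring of the representation scheme. -/
def ijMat (r : Fin 2) : Matrix (Fin 2) (Fin 2) (RepRing (KnotGroup p q)) :=
  ![BH.toMat _ (iBH p q), BH.toMat _ (jBH p q)] r

/-- The surjection from the ring of polynomials in a scalar and two traceless matrices to the
coordinate ring of the representation scheme of a two-bridge knot. -/
def projRep : PolyPair →ₐ[ℂ] RepRing (KnotGroup p q) :=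
  MvPolynomial.aeval fun v => v.elim (plusToRep _ (elx p q)) fun rc => entries (ijMat p q rc.1) rc.2

theorem projRep_s : projRep p q PolyPair.s = plusToRep _ (elx p q) := MvPolynomial.aeval_X _ _

theorem projRep_u (r : Fin 2) (c : Fin 3) :
    projRep p q (PolyPair.u r c) = entries (ijMat p q r) c := MvPolynomial.aeval_X _ _

theorem ijMat_one_one (r : Fin 2) : ijMat p q r 1 1 = -ijMat p q r 0 0 := by
  fin_cases r
  · exact toMat_traceless (inv_ijBH p q _)
  · exact toMat_traceless (inv_ijBH p q _)

/-- Every element of `BH π` is a combination of `1`, `i`, `j`, `ij` over polynomials in `x` and `J`,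
so its matrix entries are polynomials in `x` and the entries of `i` and `j`. -/
theorem projRep_surjective : Function.Surjective (projRep p q) := by
  have hij : ∀ r a b, ijMat p q r a b ∈ (projRep p q).range := by
    intro r a b
    have h0 : ijMat p q r 0 0 ∈ (projRep p q).range := ⟨_, projRep_u p q r 0⟩
    have h1 : ijMat p q r 0 1 ∈ (projRep p q).range := ⟨_, projRep_u p q r 1⟩
    have h2 : ijMat p q r 1 0 ∈ (projRep p q).range := ⟨_, projRep_u p q r 2⟩
    fin_cases a <;> fin_cases b
    · exact h0
    · exact h1
    · exact h2
    · change ijMat p q r 1 1 ∈ _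
      rw [ijMat_one_one]
      exact neg_mem h0
  have hmul : ∀ M N : Matrix (Fin 2) (Fin 2) (RepRing (KnotGroup p q)),
      (∀ a b, M a b ∈ (projRep p q).range) → (∀ a b, N a b ∈ (projRep p q).range) →
      ∀ a b, (M * N) a b ∈ (projRep p q).range := by
    intro M N hM hN a b
    rw [Matrix.mul_apply]
    exact sum_mem fun k _ => mul_mem (hM a k) (hN k b)
  have hplus : ∀ r : PolyXJ, plusToRep _ (evPlus p q r) ∈ (projRep p q).range := by
    have hx : plusToRep _ (elx p q) ∈ (projRep p q).range := ⟨_, projRep_s p q⟩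
    have hJ : plusToRep _ (elIJ p q 1) ∈ (projRep p q).range := by
      change BH.toMat _ (jBH p q * jBH p q) 0 0 ∈ _
      rw [map_mul]
      exact hmul _ _ (hij 1) (hij 1) 0 0
    obtain ⟨X, hX⟩ := hx
    obtain ⟨Y, hY⟩ := hJ
    intro r
    have h : (plusToRep _).comp (evPlus p q) = (projRep p q).comp (ev X Y) := by
      apply PolyXJ.algHom_ext
      · simpa using hX.symm
      · simpa using hY.symm
    exact ⟨_, (DFunLike.congr_fun h r).symm⟩
  have hscal : ∀ (r : PolyXJ) (a b),
      BH.toMat (KnotGroup p q) (evPlus p q r) a b ∈ (projRep p q).range := by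
    intro r a b
    rw [toMat_plus_eq, Matrix.scalar_apply, Matrix.diagonal_apply]
    split_ifs
    · exact hplus r
    · exact zero_mem _
  have hall : ∀ (z : BH (KnotGroup p q)) (a b), BH.toMat _ z a b ∈ (projRep p q).range := by
    intro z a b
    obtain ⟨z, rfl⟩ := quatBH_surjective p q z
    rw [quatBH_apply, map_add, map_add, map_add, map_mul, map_mul, map_mul, map_mul]
    exact add_mem (add_mem (add_mem (hscal _ a b) (hmul _ _ (hscal _) (hij 0) a b))
      (hmul _ _ (hscal _) (hij 1) a b)) (hmul _ _ (hscal _) (hmul _ _ (hij 0) (hij 1)) a b)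
  intro f
  obtain ⟨F, rfl⟩ := Ideal.Quotient.mk_surjective f
  change Ideal.Quotient.mk _ F ∈ (projRep p q).range
  induction F using MvPolynomial.induction_on with
  | C c => exact (projRep p q).range.algebraMap_mem c
  | add P Q hP hQ => rw [map_add]; exact add_mem hP hQ
  | mul_X P v hP =>
    rw [map_mul]
    refine mul_mem hP ?_
    have h := hall (BH.of _ v.1) v.2.1 v.2.2
    rwa [toMat_of] at h

theorem flow_entries {B : Type*} [CommRing B] [Algebra ℂ B] {a b : ℂ} (hab : a * b = 0)
    {M : Matrix (Fin 2) (Fin 2) B} (hM : M 1 1 = -M 0 0) (k : Fin 3) :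
    entries (!![1, Polynomial.X * algebraMap ℂ (Polynomial B) a;
        Polynomial.X * algebraMap ℂ (Polynomial B) b, 1] * M.map Polynomial.C *
      !![1, -(Polynomial.X * algebraMap ℂ (Polynomial B) a);
        -(Polynomial.X * algebraMap ℂ (Polynomial B) b), 1]) k =
    ![Polynomial.C (entries M 0) + Polynomial.X * Polynomial.C (algebraMap ℂ B a * entries M 2 -
        algebraMap ℂ B b * entries M 1),
      Polynomial.C (entries M 1) - Polynomial.X * Polynomial.C (2 * algebraMap ℂ B a * entries M 0) -
        Polynomial.X ^ 2 * Polynomial.C (algebraMap ℂ B a ^ 2 * entries M 2),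
      Polynomial.C (entries M 2) + Polynomial.X * Polynomial.C (2 * algebraMap ℂ B b * entries M 0) -
        Polynomial.X ^ 2 * Polynomial.C (algebraMap ℂ B b ^ 2 * entries M 1)] k := by
  have h0 : Polynomial.C (algebraMap ℂ B a) * Polynomial.C (algebraMap ℂ B b) = 0 := by
    rw [← Polynomial.C_mul, ← map_mul, hab, map_zero, map_zero]
  have hC2 : (Polynomial.C 2 : Polynomial B) = 2 := map_ofNat Polynomial.C 2
  simp only [entries, Matrix.mul_apply, Fin.sum_univ_two, Matrix.map_apply, hM]
  fin_cases k
  · simp [Polynomial.algebraMap_apply]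
    linear_combination (Polynomial.X ^ 2 * Polynomial.C (M 0 0)) * h0
  · simp [Polynomial.algebraMap_apply, hC2]
    ring
  · simp [Polynomial.algebraMap_apply, hC2]
    ring

theorem flow_scalar {B : Type*} [CommRing B] [Algebra ℂ B] {a b : ℂ} (hab : a * b = 0) (r : B) :
    ((!![1, Polynomial.X * algebraMap ℂ (Polynomial B) a;
        Polynomial.X * algebraMap ℂ (Polynomial B) b, 1] *
        (Matrix.scalar (Fin 2) r).map Polynomial.C *
      !![1, -(Polynomial.X * algebraMap ℂ (Polynomial B) a);
        -(Polynomial.X * algebraMap ℂ (Polynomial B) b), 1] :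
        Matrix (Fin 2) (Fin 2) (Polynomial B))) 0 0 = Polynomial.C r := by
  have h0 : Polynomial.C (algebraMap ℂ B a) * Polynomial.C (algebraMap ℂ B b) = 0 := by
    rw [← Polynomial.C_mul, ← map_mul, hab, map_zero, map_zero]
  simp only [Matrix.mul_apply, Fin.sum_univ_two, Matrix.map_apply]
  simp [Polynomial.algebraMap_apply]
  linear_combination (Polynomial.X ^ 2 * Polynomial.C r) * h0

theorem map_flow_u {B : Type*} [CommRing B] [Algebra ℂ B] (φ : PolyPair →ₐ[ℂ] B) (a b : ℂ)
    (r : Fin 2) (k : Fin 3) :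
    Polynomial.mapAlgHom φ (PolyPair.flow a b (PolyPair.u r k)) =
    ![Polynomial.C (φ (PolyPair.u r 0)) + Polynomial.X * Polynomial.C (algebraMap ℂ B a *
        φ (PolyPair.u r 2) - algebraMap ℂ B b * φ (PolyPair.u r 1)),
      Polynomial.C (φ (PolyPair.u r 1)) - Polynomial.X * Polynomial.C (2 * algebraMap ℂ B a *
        φ (PolyPair.u r 0)) -
        Polynomial.X ^ 2 * Polynomial.C (algebraMap ℂ B a ^ 2 * φ (PolyPair.u r 2)),
      Polynomial.C (φ (PolyPair.u r 2)) + Polynomial.X * Polynomial.C (2 * algebraMap ℂ B b *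
        φ (PolyPair.u r 0)) -
        Polynomial.X ^ 2 * Polynomial.C (algebraMap ℂ B b ^ 2 * φ (PolyPair.u r 1))] k := by
  have hcc : ∀ c, φ (MvPolynomial.C c) = algebraMap ℂ _ c := fun c => AlgHom.commutes _ c
  have hC2 : (Polynomial.C 2 : Polynomial B) = 2 := map_ofNat Polynomial.C 2
  fin_cases k <;> simp [PolyPair.flow, hcc, hC2, map_ofNat φ 2]

/-- Equivariance of the projection: both flows conjugate `i` and `j` by `(1, Xa; Xb, 1)` and fix the
scalar. -/
theorem repFlow_projRep {a b : ℂ} (hab : a * b = 0) (G : PolyPair) :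
    repFlow _ hab (projRep p q G) =
      Polynomial.mapAlgHom (projRep p q) (PolyPair.flow a b G) := by
  have h : (repFlow _ hab).comp (projRep p q) =
      (Polynomial.mapAlgHom (projRep p q)).comp (PolyPair.flow a b) := by
    apply MvPolynomial.algHom_ext
    rintro (_ | ⟨r, k⟩)
    · have h1 : PolyPair.flow a b PolyPair.s = Polynomial.C PolyPair.s := by simp [PolyPair.flow]
      rw [AlgHom.comp_apply, AlgHom.comp_apply, h1, projRep_s]
      refine (repFlow_toMat hab _ 0 0).trans ?_
      rw [toMat_plus_eq]
      refine (flow_scalar hab _).trans ?_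
      rw [← projRep_s]
      exact (Polynomial.map_C _).symm
    · rw [AlgHom.comp_apply, AlgHom.comp_apply, map_flow_u]
      simp only [projRep_u]
      refine Eq.trans ?_ (flow_entries hab (ijMat_one_one p q r) k)
      have key : ∀ (z : BH (KnotGroup p q)) (k : Fin 3), repFlow _ hab (entries (BH.toMat _ z) k) =
          entries (!![1, Polynomial.X * algebraMap ℂ (Polynomial (RepRing (KnotGroup p q))) a;
            Polynomial.X * algebraMap ℂ (Polynomial (RepRing (KnotGroup p q))) b, 1] *
            (BH.toMat (KnotGroup p q) z).map Polynomial.C *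
            !![1, -(Polynomial.X * algebraMap ℂ (Polynomial (RepRing (KnotGroup p q))) a);
            -(Polynomial.X * algebraMap ℂ (Polynomial (RepRing (KnotGroup p q))) b), 1]) k := by
        intro z k
        fin_cases k
        · exact repFlow_toMat hab z 0 0
        · exact repFlow_toMat hab z 0 1
        · exact repFlow_toMat hab z 1 0
      fin_cases r
      · exact key (iBH p q) k
      · exact key (jBH p q) k
  exact DFunLike.congr_fun h G

theorem eval_zero_mapAlgHom {B : Type*} [CommRing B] [Algebra ℂ B] (φ : PolyPair →ₐ[ℂ] B)
    (P : Polynomial PolyPair) : (Polynomial.mapAlgHom φ P).eval 0 = φ (P.eval 0) := by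
  have h := Polynomial.eval_map_apply (φ : PolyPair →+* B) (p := P) 0
  rw [map_zero] at h
  exact h

/-- Differentiate the constant flow at parameter zero. This yields both the stability of the kernel
of `projRep` and the invariance modulo that kernel of any lift of an invariant. -/
theorem projRep_der {a b : ℂ} (hab : a * b = 0) {G : PolyPair}
    (hG : ∃ f, repFlow _ hab (projRep p q G) = Polynomial.C f) :
    projRep p q (PolyPair.der a b G) = 0 := by
  obtain ⟨f, hf⟩ := hG
  rw [repFlow_projRep] at hf
  rw [← PolyPair.eval_zero_flow a b (PolyPair.der a b G), ← PolyPair.derivative_flow hab,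
    ← eval_zero_mapAlgHom]
  have h : Polynomial.mapAlgHom (projRep p q) (Polynomial.derivative (PolyPair.flow a b G)) =
      Polynomial.derivative (Polynomial.mapAlgHom (projRep p q) (PolyPair.flow a b G)) :=
    (Polynomial.derivative_map _ _).symm
  rw [h, hf, Polynomial.derivative_C, Polynomial.eval_zero]

/-- The mixed invariant goes to `tr(ij) = 0`, because `i` and `j` anticommute; the others go to `x`,
`I` and `J`. -/
theorem projRep_invSubst (P : MvPolynomial (Fin 4) ℂ) :
    ∃ z, projRep p q (PolyPair.invSubst P) = plusToRep _ z := by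
  refine ⟨MvPolynomial.aeval ![elx p q, elIJ p q (-1), elIJ p q 1, 0] P, ?_⟩
  have hsq : ∀ r, (ijMat p q r * ijMat p q r) 0 0 =
      ijMat p q r 0 0 ^ 2 + ijMat p q r 0 1 * ijMat p q r 1 0 := by
    intro r; rw [Matrix.mul_apply, Fin.sum_univ_two]; ring
  have hanti : 2 * ijMat p q 0 0 0 * ijMat p q 1 0 0 + ijMat p q 0 0 1 * ijMat p q 1 1 0 +
      ijMat p q 0 1 0 * ijMat p q 1 0 1 = 0 := by
    have h := congrArg (fun z => BH.toMat _ z 0 0) (jBH_mul_iBH p q)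
    simp only [map_mul, map_neg] at h
    have h' : (ijMat p q 1 * ijMat p q 0) 0 0 = -(ijMat p q 0 * ijMat p q 1) 0 0 := h
    rw [Matrix.mul_apply, Matrix.mul_apply, Fin.sum_univ_two, Fin.sum_univ_two] at h'
    linear_combination h'
  have h : (projRep p q).comp PolyPair.invSubst =
      (plusToRep _).comp (MvPolynomial.aeval ![elx p q, elIJ p q (-1), elIJ p q 1, 0]) := by
    apply MvPolynomial.algHom_ext
    intro k
    rw [AlgHom.comp_apply, AlgHom.comp_apply, MvPolynomial.aeval_X, PolyPair.invSubst,
      MvPolynomial.aeval_X]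
    fin_cases k
    · exact projRep_s p q
    · simp only [Fin.mk_one, Matrix.cons_val, map_add, map_mul, map_pow, projRep_u]
      refine (hsq 0).symm.trans ?_
      exact (congrFun (congrFun (map_mul (BH.toMat _) (iBH p q) (iBH p q)) 0) 0).symm
    · simp only [Fin.reduceFinMk, Matrix.cons_val, map_add, map_mul, map_pow, projRep_u]
      refine (hsq 1).symm.trans ?_
      exact (congrFun (congrFun (map_mul (BH.toMat _) (jBH p q) (jBH p q)) 0) 0).symm
    · simp only [Fin.reduceFinMk, Matrix.cons_val, map_add, map_mul, projRep_u, map_ofNat]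
      rw [map_zero]
      exact hanti
  exact DFunLike.congr_fun h P

theorem exists_plusToRep_eq {f : RepRing (KnotGroup p q)} (hf : f ∈ charRing (KnotGroup p q)) :
    ∃ z, plusToRep _ z = f := by
  obtain ⟨G, rfl⟩ := projRep_surjective p q f
  obtain ⟨G', hG', hF, hE⟩ := PolyPair.exists_invariant (LinearMap.ker (projRep p q).toLinearMap)
    (fun a b hab G hG => by
      have hG0 : projRep p q G = 0 := hG
      exact projRep_der p q hab ⟨0, by rw [hG0, map_zero, map_zero]⟩)
    (fun a b hab => projRep_der p q hab ⟨_, repFlow_of_mem_charRing hab hf⟩)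
  obtain ⟨P, rfl⟩ := PolyPair.exists_eq_invSubst hE hF
  obtain ⟨z, hz⟩ := projRep_invSubst p q P
  refine ⟨z, hz.symm.trans ?_⟩
  have h0 : projRep p q (PolyPair.invSubst P - G) = 0 := hG'
  rwa [map_sub, sub_eq_zero] at h0

/-- The isomorphism from `BH⁺` to the character ring. -/
def plusEquiv : BHplus (KnotGroup p q) ≃ₐ[ℂ] charRing (KnotGroup p q) :=
  AlgEquiv.ofBijective ((plusToRep _).codRestrict _ plusToRep_mem) (by
    constructor
    · rw [injective_iff_map_eq_zero]
      intro z hz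
      apply eq_zero_of_toMat_eq_zero
      have hz' : plusToRep (KnotGroup p q) z = 0 := congrArg Subtype.val hz
      rw [toMat_plus_eq, hz', map_zero]
    · rintro ⟨f, hf⟩
      obtain ⟨z, hz⟩ := exists_plusToRep_eq p q hf
      exact ⟨z, Subtype.ext hz⟩)

theorem toMat_plusEquiv (z : BHplus (KnotGroup p q)) : BH.toMat (KnotGroup p q) z =
    Matrix.scalar (Fin 2) (plusEquiv p q z : RepRing (KnotGroup p q)) := toMat_plus_eq z

end CharRing

/-! ### Representations of the double affine Hecke algebra by reflection operators -/

/-- A commutative algebra with an involution `s` that inverts two units `X` and `Y`, such that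
`X - X⁻¹` is invertible. -/
structure ReflectionData (L : Type*) [CommRing L] [Algebra ℂ L] where
  /-- The unit `X`. -/
  X : L
  /-- The inverse of `X`. -/
  Xinv : L
  /-- The inverse of `X - X⁻¹`. -/
  δinv : L
  /-- The unit `Y`. -/
  Y : L
  /-- The involution. -/
  s : L →ₐ[ℂ] L
  s_s : ∀ u, s (s u) = u
  s_X : s X = Xinv
  X_mul : X * Xinv = 1
  δ_mul : (X - Xinv) * δinv = 1
  Y_mul : Y * s Y = 1

namespace ReflectionData

variable {L : Type*} [CommRing L] [Algebra ℂ L] (R : ReflectionData L) (t₁ t₂ : ℂˣ)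

theorem s_Xinv : R.s R.Xinv = R.X := by rw [← R.s_X, R.s_s]

theorem s_δinv : R.s R.δinv = -R.δinv := by
  have h := congrArg R.s R.δ_mul
  rw [map_mul, map_sub, map_one, R.s_X, R.s_Xinv] at h
  linear_combination (-R.s R.δinv) * R.δ_mul - R.δinv * h

/-- The operator `u ↦ α u + β s(Y u)`. -/
def op (α β : L) : Module.End ℂ L :=
  LinearMap.mulLeft ℂ α + LinearMap.mulLeft ℂ β ∘ₗ R.s.toLinearMap ∘ₗ LinearMap.mulLeft ℂ R.Y

theorem op_apply (α β u : L) : R.op α β u = α * u + β * R.s (R.Y * u) := rfl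

/-- Since `Y s(Y) = 1`, the map `u ↦ s(Yu)` is an involution, so these operators are closed under
composition. -/
theorem op_op (α β α' β' u : L) : R.op α β (R.op α' β' u) =
    R.op (α * α' + β * R.s β') (α * β' + β * R.s α') u := by
  simp only [op_apply, map_add, map_mul, R.s_s]
  linear_combination (β * R.s β' * u) * R.Y_mul

/-- The square has coefficients `α² + β s(β)` and `β(α + s(α))`; the two hypotheses say that it is
`1 + (t - t⁻¹)` times the operator. -/
theorem op_quadratic {α β : L} {t : ℂˣ}
    (h : α + R.s α = algebraMap ℂ L t - algebraMap ℂ L (t : ℂ)⁻¹)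
    (h' : β * R.s β - α * R.s α = 1) (u : L) :
    R.op α β (R.op α β u) - (t : ℂ) • R.op α β u + (t : ℂ)⁻¹ • R.op α β u - u = 0 := by
  rw [op_op]
  simp only [op_apply, Algebra.smul_def]
  linear_combination (α * u + β * R.s (R.Y * u)) * h + u * h'

/-- The coefficient `(t̄₁ X + t̄₂) δ⁻¹`, where `t̄ᵢ = tᵢ - tᵢ⁻¹`. -/
def coeff : L :=
  (((t₁ : ℂ) - (t₁ : ℂ)⁻¹) • R.X + algebraMap ℂ L ((t₂ : ℂ) - (t₂ : ℂ)⁻¹)) * R.δinv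

theorem s_coeff : R.s (R.coeff t₁ t₂) =
    -((((t₁ : ℂ) - (t₁ : ℂ)⁻¹) • R.Xinv + algebraMap ℂ L ((t₂ : ℂ) - (t₂ : ℂ)⁻¹)) * R.δinv) := by
  simp only [coeff, map_mul, map_add, map_smul, R.s_X, R.s_δinv, AlgHom.commutes]
  ring

theorem coeff_add_s : R.coeff t₁ t₂ + R.s (R.coeff t₁ t₂) =
    algebraMap ℂ L t₁ - algebraMap ℂ L (t₁ : ℂ)⁻¹ := by
  rw [s_coeff, coeff]
  simp only [Algebra.smul_def, map_sub]
  linear_combination (algebraMap ℂ L t₁ - algebraMap ℂ L (t₁ : ℂ)⁻¹) * R.δ_mul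

theorem X_mul_s_coeff : R.X * R.s (R.coeff t₁ t₂) + R.Xinv * R.coeff t₁ t₂ =
    -(algebraMap ℂ L t₂ - algebraMap ℂ L (t₂ : ℂ)⁻¹) := by
  rw [s_coeff, coeff]
  simp only [Algebra.smul_def, map_sub]
  linear_combination -(algebraMap ℂ L t₂ - algebraMap ℂ L (t₂ : ℂ)⁻¹) * R.δ_mul

theorem algebraMap_mul_inv (t : ℂˣ) : algebraMap ℂ L t * algebraMap ℂ L (t : ℂ)⁻¹ = 1 := by
  rw [← map_mul, mul_inv_cancel₀ t.ne_zero, map_one]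

/-- The operators by which the generators of the double affine Hecke algebra act. -/
def genOp : DAHAGen → Module.End ℂ L
  | .T0 => R.op (R.coeff t₁ t₂) (R.coeff t₁ t₂ - algebraMap ℂ L t₁)
  -- This is `T₀⁻¹ X`: by the quadratic relation `T₀⁻¹ = T₀ - t̄₁`, and `coeff - t̄₁ = -s(coeff)`.
  | .T0v => R.op (-(R.X * R.s (R.coeff t₁ t₂))) (R.Xinv * (R.coeff t₁ t₂ - algebraMap ℂ L t₁))
  | .T1 => R.s.toLinearMap
  | .T1v => -(LinearMap.mulLeft ℂ R.Xinv ∘ₗ R.s.toLinearMap)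

theorem coeff_identity : (R.coeff t₁ t₂ - algebraMap ℂ L t₁) *
    R.s (R.coeff t₁ t₂ - algebraMap ℂ L t₁) - R.coeff t₁ t₂ * R.s (R.coeff t₁ t₂) = 1 := by
  rw [map_sub, AlgHom.commutes]
  linear_combination (-algebraMap ℂ L t₁) * R.coeff_add_s t₁ t₂ + algebraMap_mul_inv (L := L) t₁

theorem genOp_T0_T0v (u : L) : R.genOp t₁ t₂ .T0 (R.genOp t₁ t₂ .T0v u) = R.X * u := by
  rw [genOp, genOp, op_op, op_apply, map_mul, R.s_Xinv, map_neg, map_mul, R.s_s, R.s_X]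
  linear_combination (R.X * u) * R.coeff_identity t₁ t₂

theorem genOp_rel {a b : FreeAlgebra ℂ DAHAGen} (h : DAHARel (-1) t₁ t₂ 1 1 a b) :
    FreeAlgebra.lift ℂ (R.genOp t₁ t₂) a = FreeAlgebra.lift ℂ (R.genOp t₁ t₂) b := by
  have quad : ∀ (T : Module.End ℂ L) (t : ℂˣ),
      (∀ u, T (T u) - (t : ℂ) • T u + (t : ℂ)⁻¹ • T u - u = 0) →
      (T - algebraMap ℂ _ (t : ℂ)) * (T + algebraMap ℂ _ (t : ℂ)⁻¹) = 0 := by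
    intro T t hT
    ext u
    rw [LinearMap.zero_apply, ← hT u]
    simp only [Module.End.mul_apply, LinearMap.sub_apply, LinearMap.add_apply,
      Module.algebraMap_end_apply, map_add, map_smul, smul_sub, smul_smul,
      inv_mul_cancel₀ t.ne_zero, one_smul]
    abel
  cases h <;> simp only [map_mul, map_sub, map_add, map_zero, AlgHom.commutes,
    FreeAlgebra.lift_ι_apply]
  · refine quad _ t₁ fun u => R.op_quadratic (R.coeff_add_s t₁ t₂) (R.coeff_identity t₁ t₂) u
  · refine quad _ t₂ fun u => R.op_quadratic ?_ ?_ u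
    · rw [map_neg, map_mul, R.s_X, R.s_s]
      linear_combination -(R.X_mul_s_coeff t₁ t₂)
    · rw [map_neg, map_mul, map_mul, R.s_X, R.s_s, R.s_Xinv]
      linear_combination (R.X * R.Xinv) * R.coeff_identity t₁ t₂ + R.X_mul
  · refine quad _ 1 fun u => ?_
    simp [genOp, R.s_s]
  · refine quad _ 1 fun u => ?_
    simp only [genOp, LinearMap.neg_apply, LinearMap.comp_apply, LinearMap.mulLeft_apply,
      AlgHom.toLinearMap_apply, map_neg, map_mul, R.s_Xinv, R.s_s, Units.val_one, inv_one, one_smul]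
    linear_combination u * R.X_mul
  -- Here `T₀ T₀^∨ = X` and `T₁^∨ T₁ = -X⁻¹ s s = -X⁻¹`.
  · ext u
    have h1 := R.genOp_T0_T0v t₁ t₂ u
    simp only [Module.End.mul_apply, h1]
    simp only [genOp, LinearMap.neg_apply, LinearMap.comp_apply, LinearMap.mulLeft_apply,
      AlgHom.toLinearMap_apply, R.s_s, Module.algebraMap_end_apply, Units.val_neg, Units.val_one,
      neg_smul, one_smul]
    linear_combination (-u) * R.X_mul

variable (M : Submodule ℂ L)

/-- A subspace that is stable under the operators of the generators. -/
structure Stable : Prop where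
  X_mem : ∀ u ∈ M, R.X * u ∈ M
  Xinv_mem : ∀ u ∈ M, R.Xinv * u ∈ M
  s_mem : ∀ u ∈ M, R.s u ∈ M
  Y_mem : ∀ u ∈ M, R.Y * u ∈ M
  div_mem : ∀ u ∈ M, R.δinv * (u + R.s (R.Y * u)) ∈ M

variable {M}

theorem genOp_T0_eq (u : L) : R.genOp t₁ t₂ .T0 u = -((t₁ : ℂ) • R.s (R.Y * u)) +
    (((t₁ : ℂ) - (t₁ : ℂ)⁻¹) • R.X + algebraMap ℂ L ((t₂ : ℂ) - (t₂ : ℂ)⁻¹)) * R.δinv *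
      (u + R.s (R.Y * u)) := by
  rw [genOp, op_apply, coeff, Algebra.smul_def (t₁ : ℂ)]
  ring

/-- Expresses `T₀⁻¹ X` through `T₀` and `X`, so that stability under it needs no further condition.
-/
theorem genOp_T0v_eq (u : L) : R.genOp t₁ t₂ .T0v u =
    R.genOp t₁ t₂ .T0 (R.X * u) - ((t₁ : ℂ) - (t₁ : ℂ)⁻¹) • (R.X * u) := by
  have h := R.coeff_add_s t₁ t₂
  rw [genOp, genOp, op_apply, op_apply, Algebra.smul_def, map_sub, map_mul R.s, map_mul R.s,
    map_mul R.s, R.s_X]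
  linear_combination (-(R.X * u)) * h

theorem Stable.genOp_mem (hM : R.Stable M) (g : DAHAGen) {u : L} (hu : u ∈ M) :
    R.genOp t₁ t₂ g u ∈ M := by
  have hT0 : ∀ u ∈ M, R.genOp t₁ t₂ .T0 u ∈ M := by
    intro u hu
    rw [genOp_T0_eq, mul_assoc, add_mul, smul_mul_assoc, ← Algebra.smul_def]
    have h := hM.div_mem u hu
    exact add_mem (neg_mem (M.smul_mem _ (hM.s_mem _ (hM.Y_mem _ hu))))
      (add_mem (M.smul_mem _ (hM.X_mem _ h)) (M.smul_mem _ h))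
  cases g with
  | T0 => exact hT0 u hu
  | T0v =>
    rw [genOp_T0v_eq]
    exact sub_mem (hT0 _ (hM.X_mem _ hu)) (M.smul_mem _ (hM.X_mem _ hu))
  | T1 => exact hM.s_mem _ hu
  | T1v => exact neg_mem (hM.Xinv_mem _ (hM.s_mem _ hu))

/-- The operators of the generators on a stable subspace. -/
def genOpOn (hM : R.Stable M) (g : DAHAGen) : Module.End ℂ M :=
  (R.genOp t₁ t₂ g).restrict fun _ hu => hM.genOp_mem R t₁ t₂ g hu

theorem coe_lift_genOpOn (hM : R.Stable M) (a : FreeAlgebra ℂ DAHAGen) (u : M) :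
    (FreeAlgebra.lift ℂ (R.genOpOn t₁ t₂ hM) a u : L) =
      FreeAlgebra.lift ℂ (R.genOp t₁ t₂) a u := by
  induction a using FreeAlgebra.induction generalizing u with
  | grade0 c => simp only [AlgHom.commutes, Module.algebraMap_end_apply]; rfl
  | grade1 g => simp only [FreeAlgebra.lift_ι_apply]; rfl
  | mul a b ha hb => simp only [map_mul, Module.End.mul_apply, ha, hb]
  | add a b ha hb => simp only [map_add, LinearMap.add_apply, Submodule.coe_add, ha, hb]

/-- The representation of the double affine Hecke algebra on a stable subspace. -/
def rep (hM : R.Stable M) : H t₁ t₂ →ₐ[ℂ] Module.End ℂ M :=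
  RingQuot.liftAlgHom ℂ ⟨FreeAlgebra.lift ℂ (R.genOpOn t₁ t₂ hM), by
    intro a b h
    ext u
    rw [coe_lift_genOpOn, coe_lift_genOpOn, R.genOp_rel t₁ t₂ h]⟩

theorem rep_gen (hM : R.Stable M) (g : DAHAGen) (u : M) :
    (R.rep t₁ t₂ hM (DAHA.gen (-1) t₁ t₂ 1 1 g) u : L) = R.genOp t₁ t₂ g u := by
  have h : R.rep t₁ t₂ hM (DAHA.gen (-1) t₁ t₂ 1 1 g) = R.genOpOn t₁ t₂ hM g :=
    (RingQuot.liftAlgHom_mkAlgHom_apply ℂ _ _ _).trans (FreeAlgebra.lift_ι_apply _ _)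
  rw [h]; rfl

theorem rep_e (hM : R.Stable M) (u : M) :
    (R.rep t₁ t₂ hM (H.e t₁ t₂) u : L) = (1 / 2 : ℂ) • ((u : L) + R.s u) := by
  have h := R.rep_gen t₁ t₂ hM .T1 u
  rw [show H.e t₁ t₂ = _ from DAHA.e.eq_1 _ _ _ _ _, map_smul, map_add, AlgHom.commutes, LinearMap.smul_apply, LinearMap.add_apply,
    Module.algebraMap_end_apply, Submodule.coe_smul, Submodule.coe_add, h, Submodule.coe_smul,
    Units.val_one, inv_one, one_smul, add_comm]
  norm_num
  exact add_comm _ _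

end ReflectionData

/-! ### The action of the spherical subalgebra on the symmetric part -/

section Spherical

variable {M V : Type*} [AddCommMonoid M] [Module ℂ M] [AddCommMonoid V] [Module ℂ V]
  {t₁ t₂ : ℂˣ}

theorem SH.e_mul (h : SH t₁ t₂) : H.e t₁ t₂ * h.1 = h.1 :=
  (Subsemigroup.mem_corner_iff (H.isIdempotentElem_e t₁ t₂)).1 h.2 |>.1

/-- An identification of `V` with the subspace `e M` of a module `M` over the double affine Hecke
algebra. -/
structure SymmetricPart (D : H t₁ t₂ →ₐ[ℂ] Module.End ℂ M) (j : V →ₗ[ℂ] M) : Prop where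
  injective : Function.Injective j
  e_mem_range : ∀ u, D (H.e t₁ t₂) u ∈ LinearMap.range j
  e_apply : ∀ v, D (H.e t₁ t₂) (j v) = j v

namespace SymmetricPart

variable {D : H t₁ t₂ →ₐ[ℂ] Module.End ℂ M} {j : V →ₗ[ℂ] M} (hj : SymmetricPart D j)

/-- The projection of `M` to `e M`. -/
def proj : M →ₗ[ℂ] V :=
  (LinearEquiv.ofInjective j hj.injective).symm.toLinearMap ∘ₗ
    (D (H.e t₁ t₂)).codRestrict _ hj.e_mem_range

theorem apply_proj (u : M) : j (hj.proj u) = D (H.e t₁ t₂) u :=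
  congrArg Subtype.val ((LinearEquiv.ofInjective j hj.injective).apply_symm_apply _)

theorem proj_apply (v : V) : hj.proj (j v) = v :=
  hj.injective ((hj.apply_proj _).trans (hj.e_apply v))

/-- The action of the spherical subalgebra on a space `V` that is identified with `e M`. -/
def rep : SH t₁ t₂ →+* Module.End ℂ V where
  toFun h := hj.proj ∘ₗ D h.1 ∘ₗ j
  map_zero' := by
    have h0 : (0 : SH t₁ t₂).1 = 0 := rfl
    ext v; simp [h0]
  map_add' h h' := by
    have h0 : (h + h').1 = h.1 + h'.1 := rfl
    ext v; simp [h0]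
  map_one' := by
    have h0 : (1 : SH t₁ t₂).1 = H.e t₁ t₂ := rfl
    ext v
    simp only [LinearMap.comp_apply, h0, hj.e_apply, hj.proj_apply, Module.End.one_apply]
  map_mul' h h' := by
    have h0 : (h * h').1 = h.1 * h'.1 := rfl
    ext v
    simp only [LinearMap.comp_apply, h0, map_mul, Module.End.mul_apply, hj.apply_proj]
    rw [← Module.End.mul_apply (D (H.e t₁ t₂)), ← map_mul, SH.e_mul]

/-- As `e h = h` in the corner, `D h` already has values in `e M`. -/
theorem apply_rep (h : SH t₁ t₂) (v : V) : j (hj.rep h v) = D h.1 (j v) := by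
  change j (hj.proj (D h.1 (j v))) = _
  rw [hj.apply_proj, ← Module.End.mul_apply, ← map_mul, SH.e_mul]

theorem rep_smul {c : ℂ} {h h' : SH t₁ t₂} (hc : h'.1 = c • h.1) : hj.rep h' = c • hj.rep h := by
  ext v
  apply hj.injective
  rw [hj.apply_rep, hc, map_smul, LinearMap.smul_apply, LinearMap.smul_apply, map_smul,
    hj.apply_rep]

end SymmetricPart

end Spherical

/-! ### The localization `BH⁺[X^{±1}][δ⁻¹]` -/

section Loc

variable {π : Type} [Group π] (m : π)

/-- The inclusion of `BH⁺` in `BH⁺[X^{±1}]`. -/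
def inclX : BHplus π →ₐ[ℂ] BHX m := Subalgebra.inclusion (BHplus_le_BHX m)

theorem ιplus_apply (u : BHplus π) : ιplus m u = algebraMap _ (BHLoc m) (inclX m u) := rfl

/-- The element `(X + X⁻¹) / 2` of `BH⁺`. -/
def halfTrace : BHplus π :=
  ⟨(1 / 2 : ℂ) • (BH.of π m + BH.of π m⁻¹), by
    change BH.inv _ = _
    simp [add_comm]⟩

theorem elX_mul_elXinv : elX m * elXinv m = 1 :=
  Subtype.ext (by
    change BH.of π m * BH.of π m⁻¹ = 1
    rw [← map_mul, mul_inv_cancel, map_one])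

theorem two_mul_halfTrace : 2 * inclX m (halfTrace m) = elX m + elXinv m := by
  apply Subtype.ext
  change (2 : BH π) * ((1 / 2 : ℂ) • (BH.of π m + BH.of π m⁻¹)) = BH.of π m + BH.of π m⁻¹
  rw [← map_ofNat (algebraMap ℂ (BH π)) 2, ← Algebra.smul_def, smul_smul]
  norm_num

theorem elδ_sq : elδ m * elδ m = inclX m (4 * halfTrace m ^ 2 - 4) := by
  rw [map_sub, map_mul, map_pow, map_ofNat, elδ]
  linear_combination (-(2 * inclX m (halfTrace m) + elX m + elXinv m)) * two_mul_halfTrace m -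
    4 * elX_mul_elXinv m

theorem exists_half : ∃ r : BHplus π, 2 * r = 1 :=
  ⟨algebraMap ℂ _ (1 / 2), by
    rw [← map_ofNat (algebraMap ℂ (BHplus π)) 2, ← map_mul]; norm_num⟩

/-- Half the trace plus or minus `δ/2` is `X^{±1}`, and `δ²` lies in `BH⁺`. -/
theorem exists_eq_add_mul_elδ (y : BHX m) : ∃ A B : BHplus π, y = inclX m A + inclX m B * elδ m := by
  obtain ⟨y, hy⟩ := y
  induction hy using Algebra.adjoin_induction with
  | mem x hx =>
    obtain ⟨r, hr⟩ := exists_half (π := π)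
    have hr' : 2 * inclX m r = 1 := by rw [← map_ofNat (inclX m) 2, ← map_mul, hr, map_one]
    rcases hx with hx | rfl | rfl
    · refine ⟨⟨x, hx⟩, 0, ?_⟩
      rw [map_zero, zero_mul, add_zero]; rfl
    · refine ⟨halfTrace m, r, ?_⟩
      change elX m = _
      rw [elδ]
      linear_combination (inclX m (halfTrace m) - elX m) * hr' - inclX m r * two_mul_halfTrace m
    · refine ⟨halfTrace m, -r, ?_⟩
      change elXinv m = _
      rw [elδ, map_neg]
      linear_combination (inclX m (halfTrace m) - elXinv m) * hr' - inclX m r * two_mul_halfTrace m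
  | algebraMap c =>
    refine ⟨algebraMap ℂ _ c, 0, ?_⟩
    rw [map_zero, zero_mul, add_zero]; rfl
  | add x y hx hy h h' =>
    obtain ⟨A, B, h⟩ := h
    obtain ⟨A', B', h'⟩ := h'
    refine ⟨A + A', B + B', ?_⟩
    have e : (⟨x + y, add_mem hx hy⟩ : BHX m) = ⟨x, hx⟩ + ⟨y, hy⟩ := rfl
    rw [e, h, h', map_add, map_add]
    ring
  | mul x y hx hy h h' =>
    obtain ⟨A, B, h⟩ := h
    obtain ⟨A', B', h'⟩ := h'
    refine ⟨A * A' + B * B' * (4 * halfTrace m ^ 2 - 4), A * B' + B * A', ?_⟩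
    have e : (⟨x * y, mul_mem hx hy⟩ : BHX m) = ⟨x, hx⟩ * ⟨y, hy⟩ := rfl
    rw [e, h, h', map_add, map_add, map_mul, map_mul, map_mul, map_mul, map_mul, ← elδ_sq]
    ring

theorem elδ_mul_δinv : algebraMap _ (BHLoc m) (elδ m) * δinv m = 1 :=
  IsLocalization.Away.mul_invSelf _

theorem sLoc_algebraMap (y : BHX m) :
    sLoc m (algebraMap _ _ y) = algebraMap _ (BHLoc m) (sX m y) :=
  IsLocalization.Away.lift_eq _ _ _

theorem sX_inclX (u : BHplus π) : sX m (inclX m u) = inclX m u := Subtype.ext u.2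

theorem sX_sX (y : BHX m) : sX m (sX m y) = y := Subtype.ext (BH.inv_inv _)

theorem sX_elX : sX m (elX m) = elXinv m := Subtype.ext (BH.inv_of _)

theorem sLoc_sLoc (u : BHLoc m) : sLoc m (sLoc m u) = u := by
  have h : (sLoc m).comp (sLoc m) = RingHom.id _ := by
    apply IsLocalization.ringHom_ext (Submonoid.powers (elδ m))
    ext y
    simp only [RingHom.comp_apply, sLoc_algebraMap, sX_sX, RingHom.id_apply]
  exact DFunLike.congr_fun h u

theorem algebraMap_BHLoc (c : ℂ) : algebraMap ℂ (BHLoc m) c = ιplus m (algebraMap ℂ _ c) :=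
  ((ιplus m).commutes c).symm

theorem sLoc_ιplus (u : BHplus π) : sLoc m (ιplus m u) = ιplus m u := by
  rw [ιplus_apply, sLoc_algebraMap, sX_inclX]

/-- The involution `s` of the localization, as an algebra map. -/
def sLocAlg : BHLoc m →ₐ[ℂ] BHLoc m :=
  { sLoc m with
    commutes' := fun c => by
      change sLoc m _ = _
      rw [algebraMap_BHLoc, sLoc_ιplus] }

theorem of_mul_sX {g : π} (hg : BH.of π g ∈ BHX m) :
    (⟨_, hg⟩ : BHX m) * sX m ⟨_, hg⟩ = 1 :=
  Subtype.ext (by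
    change BH.of π g * BH.inv (BH.of π g) = 1
    rw [BH.inv_of, ← map_mul, mul_inv_cancel, map_one])

/-- The operators `X`, `Y`, `s` on the localization. -/
def reflectionData {g : π} (hg : BH.of π g ∈ BHX m) : ReflectionData (BHLoc m) where
  X := algebraMap _ _ (elX m)
  Xinv := algebraMap _ _ (elXinv m)
  δinv := δinv m
  Y := algebraMap (BHX m) _ ⟨_, hg⟩
  s := sLocAlg m
  s_s := sLoc_sLoc m
  s_X := (sLoc_algebraMap m _).trans (by rw [sX_elX])
  X_mul := by rw [← map_mul, elX_mul_elXinv, map_one]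
  δ_mul := by rw [← map_sub]; exact elδ_mul_δinv m
  Y_mul := by
    change _ * sLoc m _ = 1
    rw [sLoc_algebraMap, ← map_mul, of_mul_sX, map_one]

/-- An element that dies is killed by a power of `δ`, hence by the same power of `δ² ∈ BH⁺`. -/
theorem ιplus_injective (h : ∀ u : BHplus π, u * (4 * halfTrace m ^ 2 - 4) = 0 → u = 0) :
    Function.Injective (ιplus m) := by
  rw [injective_iff_map_eq_zero]
  intro u hu
  obtain ⟨⟨_, n, rfl⟩, hn⟩ :=
    (IsLocalization.map_eq_zero_iff (Submonoid.powers (elδ m)) (BHLoc m) (inclX m u)).1 hu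
  have h2 : inclX m (u * (4 * halfTrace m ^ 2 - 4) ^ n) = 0 := by
    rw [map_mul, map_pow, ← elδ_sq, mul_pow]
    change elδ m ^ n * inclX m u = 0 at hn
    linear_combination elδ m ^ n * hn
  have h3 : u * (4 * halfTrace m ^ 2 - 4) ^ n = 0 :=
    Subalgebra.inclusion_injective (BHplus_le_BHX m) (h2.trans (map_zero (inclX m)).symm)
  clear hn h2 hu
  induction n with
  | zero => simpa using h3
  | succ n ih => exact ih (h _ (by rw [mul_assoc, ← pow_succ, h3]))

/-- The product of `δ` with `Qδ⁻¹` is `Q`, which is absorbed in `BH⁺`. -/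
theorem mem_fracModule_iff {Q : BHplus π} {u : BHLoc m} : u ∈ fracModule m Q ↔ ∃ A B C,
    u = ιplus m A + ιplus m B * algebraMap _ _ (elδ m) + ιplus m C * (ιplus m Q * δinv m) := by
  have hδ := elδ_mul_δinv m
  rw [fracModule, Submodule.restrictScalars_mem, Submodule.mem_span_pair]
  constructor
  · rintro ⟨y, z, rfl⟩
    obtain ⟨A, B, rfl⟩ := exists_eq_add_mul_elδ m y
    obtain ⟨C, D, rfl⟩ := exists_eq_add_mul_elδ m z
    refine ⟨A + D * Q, B, C, ?_⟩
    simp only [Algebra.smul_def, map_add, map_mul, ιplus_apply]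
    linear_combination (algebraMap _ (BHLoc m) (inclX m D) *
      algebraMap _ (BHLoc m) (inclX m Q)) * hδ
  · rintro ⟨A, B, C, rfl⟩
    refine ⟨inclX m A + inclX m B * elδ m, inclX m C, ?_⟩
    simp only [Algebra.smul_def, map_add, map_mul, ιplus_apply]
    ring

theorem sLoc_elδ : sLoc m (algebraMap _ _ (elδ m)) = -algebraMap _ (BHLoc m) (elδ m) := by
  rw [sLoc_algebraMap, sX_δ, map_neg]

theorem sLoc_δinv : sLoc m (δinv m) = -δinv m := by
  have h := congrArg (sLoc m) (elδ_mul_δinv m)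
  rw [map_mul, sLoc_elδ, map_one] at h
  linear_combination (-sLoc m (δinv m)) * elδ_mul_δinv m - δinv m * h

/-- The operator `u ↦ δ⁻¹(u + s(Yu))` sends `a` to `a(1 + A)δ⁻¹ - aB`, `bδ` to `b(1 - A) + bBδ`, and
`cQδ⁻¹` to `cQ(1 - A)δ⁻² + cBQδ⁻¹`. The two hypotheses clear the denominators in the first and
third. -/
theorem stable_fracModule {g : π} (hg : BH.of π g ∈ BHX m) {Q A B e₁ e₂ f : BHplus π}
    (hY : (⟨_, hg⟩ : BHX m) = inclX m A + inclX m B * elδ m)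
    (h₁ : 1 + A = Q * e₁ + (4 * halfTrace m ^ 2 - 4) * e₂)
    (h₂ : Q * (1 - A) = (4 * halfTrace m ^ 2 - 4) * f) :
    (reflectionData m hg).Stable (fracModule m Q) := by
  have hmul : ∀ (y : BHX m), ∀ u ∈ fracModule m Q, algebraMap _ _ y * u ∈ fracModule m Q := by
    intro y u hu
    rw [← Algebra.smul_def]
    exact Submodule.smul_mem (Submodule.span (BHX m) {1, ιplus m Q * δinv m}) y hu
  have hδ := elδ_mul_δinv m
  have hs := sLoc_elδ m
  have hs' := sLoc_δinv m
  have hd : algebraMap _ (BHLoc m) (elδ m) * algebraMap _ (BHLoc m) (elδ m) =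
      ιplus m (4 * halfTrace m ^ 2 - 4) := by rw [← map_mul, elδ_sq, ιplus_apply]
  have hY' : algebraMap (BHX m) (BHLoc m) ⟨_, hg⟩ = ιplus m A + ιplus m B * algebraMap _ _ (elδ m) := by
    rw [hY, map_add, map_mul]; rfl
  have h₁' := congrArg (ιplus m) h₁
  have h₂' := congrArg (ιplus m) h₂
  refine ⟨hmul _, hmul _, ?_, hmul _, ?_⟩
  · intro u hu
    obtain ⟨a, b, c, rfl⟩ := (mem_fracModule_iff m).1 hu
    change sLoc m _ ∈ _
    refine (mem_fracModule_iff m).2 ⟨a, -b, -c, ?_⟩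
    simp only [map_add, map_mul, sLoc_ιplus, hs, hs', map_neg]
    ring
  · intro u hu
    obtain ⟨a, b, c, rfl⟩ := (mem_fracModule_iff m).1 hu
    change δinv m * (_ + sLoc m (algebraMap _ _ _ * _)) ∈ _
    rw [hY']
    refine (mem_fracModule_iff m).2
      ⟨-a * B + b * (1 - A) + c * f, a * e₂ + b * B, a * e₁ + c * B, ?_⟩
    simp only [map_add, map_mul, map_sub, map_one, map_neg, sLoc_ιplus, hs, hs'] at h₁' h₂' hd ⊢
    generalize algebraMap _ (BHLoc m) (elδ m) = δ at *
    generalize δinv m = ε at *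
    generalize ιplus m (halfTrace m) = x at *
    generalize ιplus m A = A at *
    generalize ιplus m B = B at *
    generalize ιplus m Q = Q at *
    generalize ιplus m a = a at *
    generalize ιplus m b = b at *
    generalize ιplus m c = c at *
    generalize ιplus m e₁ = e₁ at *
    generalize ιplus m e₂ = e₂ at *
    generalize ιplus m f = f at *
    rw [← hd] at h₁' h₂'
    linear_combination a * ε * h₁' + (a * e₂ * δ - a * B + b * (1 - A + B * δ) +
      c * f * (δ * ε + 1) + c * Q * B * ε) * hδ + c * ε ^ 2 * h₂'

end Loc

/-! ### The longitude of a two-bridge knot -/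

section Longitude

variable {π : Type} [Group π] (m : π)

/-- With `x` half the trace, `X^{±2} = 1 + δ²/2 ± xδ`, so the symmetric part of an even power is `1`
modulo `δ²`. The exponent of the meridian in the longitude is even. -/
theorem exists_elX_pow (n : ℕ) : ∃ g h : BHplus π, elX m ^ (2 * n) =
    inclX m (1 + (4 * halfTrace m ^ 2 - 4) * g) + inclX m h * elδ m ∧
    elXinv m ^ (2 * n) = inclX m (1 + (4 * halfTrace m ^ 2 - 4) * g) - inclX m h * elδ m := by
  obtain ⟨r, hr⟩ := exists_half (π := π)
  have hr' : 2 * inclX m r = 1 := by rw [← map_ofNat (inclX m) 2, ← map_mul, hr, map_one]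
  have hx := two_mul_halfTrace m
  have hX := elX_mul_elXinv m
  induction n with
  | zero => exact ⟨0, 0, by simp, by simp⟩
  | succ n ih =>
    obtain ⟨g, h, h1, h2⟩ := ih
    have hd := elδ_sq m
    set d := 4 * halfTrace m ^ 2 - 4
    have e : elδ m = elX m - elXinv m := rfl
    have h3 : elX m ^ 2 = 1 + inclX m r * inclX m d + inclX m (halfTrace m) * elδ m := by
      rw [← hd, e]
      linear_combination (-(elX m ^ 2 - 1)) * hr' + 2 * inclX m r * hX +
        (elX m - elXinv m) * (inclX m (halfTrace m) * hr' - inclX m r * hx)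
    have h4 : elXinv m ^ 2 = 1 + inclX m r * inclX m d - inclX m (halfTrace m) * elδ m := by
      rw [← hd, e]
      linear_combination (-(elXinv m ^ 2 - 1)) * hr' + 2 * inclX m r * hX -
        (elX m - elXinv m) * (inclX m (halfTrace m) * hr' - inclX m r * hx)
    refine ⟨g + r + d * g * r + h * halfTrace m, halfTrace m * (1 + d * g) + h * (1 + d * r), ?_, ?_⟩
    · rw [mul_add, mul_one, pow_add, h1, h3]
      simp only [map_add, map_mul, map_one]
      linear_combination (inclX m h * inclX m (halfTrace m)) * hd
    · rw [mul_add, mul_one, pow_add, h2, h4]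
      simp only [map_add, map_mul, map_one]
      linear_combination (inclX m h * inclX m (halfTrace m)) * hd

theorem exists_zpow_mem_BHX (n : ℤ) : ∃ g h : BHplus π, BH.of π (m ^ (2 * n)) =
    (inclX m (1 + (4 * halfTrace m ^ 2 - 4) * g) + inclX m h * elδ m : BHX m) := by
  obtain ⟨n, rfl | rfl⟩ := n.eq_nat_or_neg
  · obtain ⟨g, h, h1, -⟩ := exists_elX_pow m n
    refine ⟨g, h, ?_⟩
    rw [← h1, show (2 * (n : ℤ)) = ((2 * n : ℕ) : ℤ) by push_cast; rfl, zpow_natCast, map_pow]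
    rfl
  · obtain ⟨g, h, -, h1⟩ := exists_elX_pow m n
    refine ⟨g, -h, ?_⟩
    rw [map_neg, neg_mul, ← sub_eq_add_neg, ← h1,
      show (2 * -(n : ℤ)) = -((2 * n : ℕ) : ℤ) by push_cast; ring, zpow_neg, zpow_natCast,
      ← inv_pow, map_pow]
    rfl

variable (p : ℕ) (q : ℤ)

theorem halfTrace_meridian : halfTrace (meridian p q) = elx p q := rfl

/-- Reversal changes `w = L + Mj + Nk` to `L + Mj - Nk`; the product has scalar part `1 + 2JM²` by
the norm identity, no `k`-part, and `2JMN i + 2LM j` as the rest. -/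
theorem exists_of_wWord_mul_reverse : ∃ l u n : BHplus (KnotGroup p q),
    l ^ 2 - elIJ p q 1 * u ^ 2 + elIJ p q (-1) * elIJ p q 1 * n ^ 2 = 1 ∧
    l = elQ p q + elIJ p q 1 * n ∧
    BH.of (KnotGroup p q) (PresentedGroup.mk _ (FreeGroup.mk (wWord p q)) *
      PresentedGroup.mk _ (FreeGroup.mk (wWord p q).reverse)) =
      (inclX (meridian p q) (1 + 2 * elIJ p q 1 * u ^ 2) +
        inclX (meridian p q) (2 * l * u) * elδ (meridian p q) : BHX (meridian p q)) := by
  have hnorm := congrArg (evPlus p q) (quatNorm_wQuat p q PolyXJ.x PolyXJ.I PolyXJ.J PolyXJ.I_add_J)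
  have himI := imI_wQuat p q PolyXJ.x PolyXJ.I PolyXJ.J
  have hQ := evPlus_Qpoly p q
  have hw : BH.of (KnotGroup p q) (PresentedGroup.mk _ (FreeGroup.mk (wWord p q)) *
      PresentedGroup.mk _ (FreeGroup.mk (wWord p q).reverse)) =
      quatBH p q (wQuat p q PolyXJ.x PolyXJ.I PolyXJ.J *
        negK (wQuat p q PolyXJ.x PolyXJ.I PolyXJ.J)) := by
    rw [map_mul, map_mul, ← quatBH_prod, ← quatBH_prod, prod_map_reverse]; rfl
  rw [Qpoly, polyQ_eq] at hQ
  generalize wQuat p q PolyXJ.x PolyXJ.I PolyXJ.J = w at *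
  obtain ⟨L, z, M, N⟩ := w
  simp only at himI hQ
  subst himI
  simp only [quatNorm] at hnorm
  rw [hw, quatBH_apply]
  simp only [negK, QuaternionAlgebra.re_mul, QuaternionAlgebra.imI_mul,
    QuaternionAlgebra.imJ_mul, QuaternionAlgebra.imK_mul]
  simp only [mul_zero, zero_mul, sub_zero, add_zero, zero_add, mul_neg, sub_neg_eq_add, map_add,
    map_sub, map_neg, map_mul, map_pow, map_zero, map_one, evPlus_I, evPlus_J] at hnorm hQ ⊢
  refine ⟨evPlus p q L, evPlus p q M, evPlus p q N, ?_, ?_, ?_⟩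
  · linear_combination hnorm
  · linear_combination hQ
  generalize evPlus p q L = l at *
  generalize evPlus p q M = u at *
  generalize evPlus p q N = n at *
  change _ = ((1 + 2 * elIJ p q 1 * u ^ 2 : BHplus _) : BH _) +
    ((2 * l * u : BHplus _) : BH _) * (BH.of _ (knotGen p q 0) - BH.of _ (knotGen p q 0)⁻¹)
  have h1 : l * l + elIJ p q 1 * u * u + elIJ p q (-1) * elIJ p q 1 * n * n =
      1 + 2 * elIJ p q 1 * u ^ 2 := by
    linear_combination hnorm
  -- From `Q i = 0`, `L` and `JN` agree in front of `i`; this makes both coefficients `2LM`, and `i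
  -- + j = δ`.
  have h2 : ((2 * l * u : BHplus _) : BH _) * iBH p q =
      ((2 * elIJ p q 1 * n * u : BHplus _) : BH _) * iBH p q := by
    have h3 : (2 * l * u : BHplus _) = 2 * elIJ p q 1 * n * u + 2 * u * elQ p q := by
      linear_combination 2 * u * hQ
    rw [h3, Subalgebra.coe_add, add_mul, Subalgebra.coe_mul _ (2 * u),
      mul_assoc (_ : BH (KnotGroup p q)), elQ_mul_iBH, mul_zero, add_zero]
  have h4 : elIJ p q 1 * u * n + elIJ p q 1 * n * u = 2 * elIJ p q 1 * n * u := by ring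
  have h5 : l * u + u * l = 2 * l * u := by ring
  have h6 : -(l * n) + n * l = 0 := by ring
  rw [← iBH_add_jBH, mul_add, h2, h1, h4, h5, h6, Subalgebra.coe_zero, zero_mul, add_zero,
    add_assoc]

theorem of_longitude : ∃ l u n g h : BHplus (KnotGroup p q),
    l ^ 2 - elIJ p q 1 * u ^ 2 + elIJ p q (-1) * elIJ p q 1 * n ^ 2 = 1 ∧
    l = elQ p q + elIJ p q 1 * n ∧
    BH.of (KnotGroup p q) (longitude p q) =
      ((inclX (meridian p q) (1 + 2 * elIJ p q 1 * u ^ 2) +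
        inclX (meridian p q) (2 * l * u) * elδ (meridian p q)) *
      (inclX (meridian p q) (1 + (elIJ p q (-1) + elIJ p q 1) * g) +
        inclX (meridian p q) h * elδ (meridian p q)) : BHX (meridian p q)) := by
  obtain ⟨g, h, hgh⟩ := exists_zpow_mem_BHX (meridian p q)
    (-(2 * ∑ n ∈ Finset.range ((p - 1) / 2), (kn p q (n + 1)).sign))
  have hs : -sExp p q =
      2 * -(2 * ∑ n ∈ Finset.range ((p - 1) / 2), (kn p q (n + 1)).sign) := by
    rw [sExp]; ring
  obtain ⟨l, u, n, hnorm, hl, hprod⟩ := exists_of_wWord_mul_reverse p q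
  rw [← hs, halfTrace_meridian, ← elI_add_elJ] at hgh
  exact ⟨l, u, n, g, h, hnorm, hl, (map_mul _ _ _).trans (congrArg₂ (· * ·) hprod hgh)⟩

theorem of_longitude_mem : BH.of (KnotGroup p q) (longitude p q) ∈ BHX (meridian p q) := by
  obtain ⟨l, u, n, g, h, -, -, hY⟩ := of_longitude p q
  rw [hY]
  exact Subtype.coe_prop _

/-- The image `Y` of the longitude in `BH⁺[X^{±1}]`. -/
def elY : BHX (meridian p q) := ⟨_, of_longitude_mem p q⟩

/-- Modulo `δ² = I + J`, the scalar part gives `1 + A ≡ 2 + 2JM² = 2(L² + IJN²) ≡ 2(L² - J²N²) =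
2Q(L + JN)` and `1 - A ≡ -2JM²`, while `QJ = Q(I + J)` because `QI = 0`. -/
theorem exists_elY_eq : ∃ A B e₁ e₂ f : BHplus (KnotGroup p q),
    elY p q = inclX (meridian p q) A + inclX (meridian p q) B * elδ (meridian p q) ∧
      1 + A = elQ p q * e₁ + (4 * halfTrace (meridian p q) ^ 2 - 4) * e₂ ∧
      elQ p q * (1 - A) = (4 * halfTrace (meridian p q) ^ 2 - 4) * f := by
  obtain ⟨l, u, n, g, h, hnorm, hl, hY⟩ := of_longitude p q
  replace hY : elY p q = _ := Subtype.ext hY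
  have hQI := elQ_mul_elI p q
  have hd : 4 * halfTrace (meridian p q) ^ 2 - 4 = elIJ p q (-1) + elIJ p q 1 :=
    (elI_add_elJ p q).symm
  have hδ := elδ_sq (meridian p q)
  rw [hd] at hδ ⊢
  generalize elIJ p q (-1) = I at *
  generalize elIJ p q 1 = J at *
  refine ⟨(1 + 2 * J * u ^ 2) * (1 + (I + J) * g) + 2 * l * u * h * (I + J),
    (1 + 2 * J * u ^ 2) * h + 2 * l * u * (1 + (I + J) * g), 2 * (l + J * n),
    2 * J * n ^ 2 + (1 + 2 * J * u ^ 2) * g + 2 * l * u * h,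
    -(elQ p q * (2 * u ^ 2 + (1 + 2 * J * u ^ 2) * g + 2 * l * u * h)), ?_, ?_, ?_⟩
  · rw [hY]
    simp only [map_add, map_mul] at hδ ⊢
    linear_combination (inclX (meridian p q) 2 * inclX (meridian p q) l * inclX (meridian p q) u *
      inclX (meridian p q) h) * hδ
  · linear_combination (-2) * hnorm + 2 * (l + J * n) * hl
  · linear_combination (2 * u ^ 2) * hQI

end Longitude

/-! ### The action on `M` and its transport to the character ring. -/

section Main

variable (p : ℕ) (q : ℤ)

theorem injective_ιplus_meridian : Function.Injective (ιplus (meridian p q)) :=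
  ιplus_injective _ fun _ hu => eq_zero_of_mul_sq_eq_zero p q hu

/-- The inclusion of `BH⁺` in the module `M`. -/
def inclModule : BHplus (KnotGroup p q) →ₗ[ℂ] knotModule p q :=
  (ιplus (meridian p q)).toLinearMap.codRestrict (knotModule p q) fun u =>
    (mem_fracModule_iff _).2 ⟨u, 0, 0, by simp⟩

theorem coe_inclModule (u : BHplus (KnotGroup p q)) :
    (inclModule p q u : BHLoc (meridian p q)) = ιplus (meridian p q) u := rfl

theorem inclModule_injective : Function.Injective (inclModule p q) := fun _ _ h =>
  injective_ιplus_meridian p q (congrArg Subtype.val h)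

variable {p q}

/-- The involution negates `δ` and `δ⁻¹`, so only the summand in `BH⁺` survives the average. -/
theorem half_smul_add_sLoc {u : BHLoc (meridian p q)} (hu : u ∈ knotModule p q) :
    ∃ a, ιplus (meridian p q) a = (1 / 2 : ℂ) • (u + sLoc (meridian p q) u) := by
  obtain ⟨a, b, c, rfl⟩ := (mem_fracModule_iff _).1 hu
  refine ⟨a, ?_⟩
  simp only [map_add, map_mul, sLoc_ιplus, sLoc_elδ, sLoc_δinv, Algebra.smul_def]
  have h2 : algebraMap ℂ (BHLoc (meridian p q)) (1 / 2) * 2 = 1 := by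
    rw [← map_ofNat (algebraMap ℂ (BHLoc (meridian p q))) 2, ← map_mul]
    norm_num
  linear_combination (-ιplus (meridian p q) a) * h2

variable (p q)

/-- The operators `X`, `Y`, `s` of the knot. -/
def knotData : ReflectionData (BHLoc (meridian p q)) :=
  reflectionData (meridian p q) (of_longitude_mem p q)

theorem stable_knotModule : (knotData p q).Stable (knotModule p q) := by
  obtain ⟨A, B, e₁, e₂, f, hAB, h₁, h₂⟩ := exists_elY_eq p q
  exact stable_fracModule (meridian p q) (of_longitude_mem p q) hAB h₁ h₂

/-- The action of the double affine Hecke algebra on the module `M`. -/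
def knotModuleRep (t₁ t₂ : ℂˣ) : H t₁ t₂ →ₐ[ℂ] Module.End ℂ (knotModule p q) :=
  (knotData p q).rep t₁ t₂ (stable_knotModule p q)

variable {p q} (t₁ t₂ : ℂˣ)

theorem genOp_T0_knotData (u : BHLoc (meridian p q)) :
    (knotData p q).genOp t₁ t₂ .T0 u = opT0 (meridian p q) (elY p q) t₁ t₂ u :=
  (knotData p q).genOp_T0_eq t₁ t₂ u

theorem knotModuleRep_T0 (u : knotModule p q) :
    (knotModuleRep p q t₁ t₂ (DAHA.gen (-1) t₁ t₂ 1 1 .T0) u : BHLoc (meridian p q)) =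
      opT0 (meridian p q) (elY p q) t₁ t₂ u := by
  rw [← genOp_T0_knotData]
  exact (knotData p q).rep_gen t₁ t₂ (stable_knotModule p q) .T0 u

theorem opT0_knotModuleRep_T0v (u : knotModule p q) :
    opT0 (meridian p q) (elY p q) t₁ t₂
        (knotModuleRep p q t₁ t₂ (DAHA.gen (-1) t₁ t₂ 1 1 .T0v) u) =
      algebraMap _ (BHLoc (meridian p q)) (elX (meridian p q)) * u := by
  rw [← genOp_T0_knotData, knotModuleRep, ReflectionData.rep_gen]
  exact (knotData p q).genOp_T0_T0v t₁ t₂ u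

theorem knotModuleRep_T1 (u : knotModule p q) :
    (knotModuleRep p q t₁ t₂ (DAHA.gen (-1) t₁ t₂ 1 1 .T1) u : BHLoc (meridian p q)) =
      sLoc (meridian p q) u :=
  (knotData p q).rep_gen t₁ t₂ (stable_knotModule p q) .T1 u

theorem knotModuleRep_T1v (u : knotModule p q) :
    (knotModuleRep p q t₁ t₂ (DAHA.gen (-1) t₁ t₂ 1 1 .T1v) u : BHLoc (meridian p q)) =
      -(algebraMap _ (BHLoc (meridian p q)) (elXinv (meridian p q)) * sLoc (meridian p q) u) :=
  (knotData p q).rep_gen t₁ t₂ (stable_knotModule p q) .T1v u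

theorem knotModuleRep_e (u : knotModule p q) :
    (knotModuleRep p q t₁ t₂ (H.e t₁ t₂) u : BHLoc (meridian p q)) =
      (1 / 2 : ℂ) • ((u : BHLoc (meridian p q)) + sLoc (meridian p q) u) :=
  (knotData p q).rep_e t₁ t₂ (stable_knotModule p q) u

theorem knotModuleRep_e_inclModule (v : BHplus (KnotGroup p q)) :
    knotModuleRep p q t₁ t₂ (H.e t₁ t₂) (inclModule p q v) = inclModule p q v := by
  apply Subtype.ext
  rw [knotModuleRep_e, coe_inclModule, sLoc_ιplus]
  module

theorem knotModuleRep_e_mem_range (u : knotModule p q) :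
    knotModuleRep p q t₁ t₂ (H.e t₁ t₂) u ∈ LinearMap.range (inclModule p q) := by
  obtain ⟨a, ha⟩ := half_smul_add_sLoc u.2
  exact ⟨a, Subtype.ext (ha.trans (knotModuleRep_e t₁ t₂ u).symm)⟩

theorem range_knotModuleRep_e :
    (Set.range fun u : knotModule p q =>
      (knotModuleRep p q t₁ t₂ (H.e t₁ t₂) u : BHLoc (meridian p q))) =
      Set.range (ιplus (meridian p q)) := by
  ext u
  constructor
  · rintro ⟨v, rfl⟩
    obtain ⟨a, ha⟩ := knotModuleRep_e_mem_range t₁ t₂ v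
    exact ⟨a, congrArg Subtype.val ha⟩
  · rintro ⟨a, rfl⟩
    exact ⟨inclModule p q a, congrArg Subtype.val (knotModuleRep_e_inclModule t₁ t₂ a)⟩

variable (p q) in
/-- The inclusion of the character ring in the module `M`. -/
def inclChar : charRing (KnotGroup p q) →ₗ[ℂ] knotModule p q :=
  inclModule p q ∘ₗ (plusEquiv p q).symm.toLinearMap

theorem symmetricPart_inclChar : SymmetricPart (knotModuleRep p q t₁ t₂) (inclChar p q) where
  injective := (inclModule_injective p q).comp (plusEquiv p q).symm.injective
  e_mem_range u := by
    obtain ⟨a, ha⟩ := knotModuleRep_e_mem_range t₁ t₂ u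
    exact ⟨plusEquiv p q a, (congrArg _ ((plusEquiv p q).symm_apply_apply a)).trans ha⟩
  e_apply f := knotModuleRep_e_inclModule t₁ t₂ _

end Main

end TwoBridge

end

open TwoBridge in
theorem mainTheorem10 (p : ℕ) (q : ℤ) (hp : Odd p) (hq : Odd q) (hqp : |q| < p)
    (hpq : IsCoprime (p : ℤ) q) (t₁ t₂ : ℂˣ) :
    -- `BH⁺` embeds in the localization, and it is canonically the character ring
    Function.Injective (ιplus (meridian p q)) ∧
    ∃ Φ : BHplus (KnotGroup p q) ≃ₐ[ℂ] charRing (KnotGroup p q),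
      (∀ a : BHplus (KnotGroup p q),
        BH.toMat (KnotGroup p q) a = Matrix.scalar (Fin 2) (Φ a : RepRing (KnotGroup p q))) ∧
    -- the image `Y` of the longitude lies in `BH⁺[X^{±1}]`
    ∃ hY : BH.of (KnotGroup p q) (longitude p q) ∈ BHX (meridian p q),
    -- the operators below define an action `D` of `H_{-1,t₁,t₂}` on `M`
    ∃ D : H t₁ t₂ →ₐ[ℂ] Module.End ℂ (knotModule p q),
      (∀ u : knotModule p q,
        (D (DAHA.gen (-1) t₁ t₂ 1 1 DAHAGen.T0) u : BHLoc (meridian p q)) =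
            opT0 (meridian p q) ⟨_, hY⟩ t₁ t₂ u ∧
        opT0 (meridian p q) ⟨_, hY⟩ t₁ t₂ (D (DAHA.gen (-1) t₁ t₂ 1 1 DAHAGen.T0v) u) =
            algebraMap _ (BHLoc (meridian p q)) (elX (meridian p q)) * u ∧
        (D (DAHA.gen (-1) t₁ t₂ 1 1 DAHAGen.T1) u : BHLoc (meridian p q)) =
            sLoc (meridian p q) u ∧
        (D (DAHA.gen (-1) t₁ t₂ 1 1 DAHAGen.T1v) u : BHLoc (meridian p q)) =
            -(algebraMap _ (BHLoc (meridian p q)) (elXinv (meridian p q)) *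
              sLoc (meridian p q) u)) ∧
    -- `e M = BH⁺`
      (Set.range fun u : knotModule p q => (D (H.e t₁ t₂) u : BHLoc (meridian p q))) =
        Set.range (ιplus (meridian p q)) ∧
    -- hence the induced action `S` of the spherical subalgebra on the character ring
    ∃ S : SH t₁ t₂ →+* Module.End ℂ (charRing (KnotGroup p q)),
      (∀ (c : ℂ) (h h' : SH t₁ t₂), (h'.1 : H t₁ t₂) = c • (h.1 : H t₁ t₂) → S h' = c • S h) ∧
      ∀ (h : SH t₁ t₂) (f : charRing (KnotGroup p q)) (u : knotModule p q),
        (u : BHLoc (meridian p q)) = ιplus (meridian p q) (Φ.symm f) →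
          ιplus (meridian p q) (Φ.symm (S h f)) =
            (D (h.1 : H t₁ t₂) u : BHLoc (meridian p q)) := by
  refine ⟨injective_ιplus_meridian p q, plusEquiv p q, toMat_plusEquiv p q, of_longitude_mem p q,
    knotModuleRep p q t₁ t₂, fun u => ⟨knotModuleRep_T0 t₁ t₂ u, opT0_knotModuleRep_T0v t₁ t₂ u,
      knotModuleRep_T1 t₁ t₂ u, knotModuleRep_T1v t₁ t₂ u⟩, range_knotModuleRep_e t₁ t₂,
    (symmetricPart_inclChar t₁ t₂).rep, fun _ _ _ hc => (symmetricPart_inclChar t₁ t₂).rep_smul hc,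
    fun h f u hu => ?_⟩
  have hu' : u = inclChar p q f := Subtype.ext hu
  rw [hu']
  exact congrArg Subtype.val ((symmetricPart_inclChar t₁ t₂).apply_rep h f)
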